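/- **Theorem (Multi-input case).** Fix $L$ hidden layers, an input dimension $d$ and an output dimension $d_{\rm out}$, reals $\sigma_b\ge 0$, $\sigma_v>0$, and $\phi:\mathbb R\to\mathbb R$. For every vector of hidden widths $\mathbf p=(p_1,\dots,p_L)$, $p_l\ge 1$ (with $p_0=d$, $p_{L+1}=d_{\rm out}$), consider the random feedforward network $$Z^{(1)}_k(\mathbf x;\mathbf p)=\sum_{j=1}^{d}W^{(1)}_{jk}x_j+B^{(1)}_k,\qquad Z^{(l)}_k(\mathbf x;\mathbf p)=\sum_{j=1}^{p_{l-1}}W^{(l)}_{jk}\,\phi\big(Z^{(l-1)}_j(\mathbf x;\mathbf p)\big)+B^{(l)}_k\quad(2\le l\le L+1),$$ where $W^{(l+1)}_{jk}=\sqrt{\lambda^{(l)}_{p_l,j}}\,V^{(l+1)}_{jk}$, $\lambda^{(0)}_{p_0,j}=1/d$, $\lambda^{(l)}_{p_l,j}\sim\mu^{(l)}_{p_l}$ for probability measures $\mu^{(l)}_{p}$ on $[0,\infty)$ ($1\le l\le L$), $V^{(l)}_{jk}\sim\mathcal N(0,\sigma_v^2)$, $B^{(l)}_k\sim\mathcal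 N(0,\sigma_b^2)$, all of these variables being independent. For $a\ge 0$ and a Lévy measure $\rho$ on $(0,\infty)$ (that is, $\int\min(1,w)\,\rho(dw)<\infty$), $\mathrm{ID}(a,\rho)$ denotes the law on $[0,\infty)$ with Laplace transform $t\mapsto\exp\big(-ta-\int_0^\infty(1-e^{-wt})\rho(dw)\big)$, $t\ge 0$. Assume that $\phi$ is continuous and that $|\phi(z)|\le A+B|z|^C$ for all $z\in\mathbb R$, for some $A,B,C>0$, and that for each $l=1,\dots,L$, for some $a^{(l)}\ge 0$ and some Lévy measure $\rho^{(l)}$, $\sum_{j=1}^{p_l}\lambda^{(l)}_{p_l,j}$ converges in distribution to $\mathrm{ID}(a^{(l)},\rho^{(l)})$ as $p_l\to\infty$. Consider the following recursion for random kernels $K^{(1)},\dots,K^{(L+1)}:\mathbb R^d\times\mathbb R^d\to\mathbb R$: $K^{(1)}(\mathbf x,\mathbf x')=\sigma_b^2+\sigma_v^2\,\mathbf x^T\mathbf x'/d$ and, for $l=1,\dots,L$ and all $\mathbf x,\mathbf x'$, almost surely, $$K^{(l+1)}(\mathbf x,\mathbf x')=\sigma_b^2+\sigma_v^2a^{(l)}\,\mathbf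 E\big[\phi(\zeta^{(l)}_1(\mathbf x))\phi(\zeta^{(l)}_1(\mathbf x'))\,\big|\,K^{(l)}\big]+\sigma_v^2\sum_{j\ge1}\widetilde\lambda^{(l)}_j\,\phi(\zeta^{(l)}_j(\mathbf x))\phi(\zeta^{(l)}_j(\mathbf x')),$$ with an (absolutely) convergent series. Here $\{\widetilde\lambda^{(l)}_j\}_{j\ge1}$ are the (possibly finitely many) points of a Poisson point process on $(0,\infty)$ with mean measure $\rho^{(l)}$, independent of $(K^{(1)},\dots,K^{(l)})$; conditionally on $(K^{(1)},\dots,K^{(l)})$ and on these points, $\zeta^{(l)}_1,\zeta^{(l)}_2,\dots$ are iid centred Gaussian processes on $\mathbb R^d$ with covariance function $K^{(l)}$; and the conditional expectation is the integral with respect to the conditional law of $\zeta^{(l)}_1$ given $K^{(l)}$. Then this recursion has a solution on some probability space for which every $K^{(l)}$ is a random covariance kernel (symmetric and positive semidefinite). Moreover, for every solution, $(K^{(1)},\dots,K^{(L+1)})$ is a Markov sequence, and for all inputs $\mathbf x_1,\dots,\mathbf x_n\in\mathbb R^d$ and all $l=1,\dots,L+1$, the random $n\times n$ matrix $\Sigma^{(l)}=(K^{(l)}(\mathbf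 x_i,\mathbf x_j))_{i,j}$ is almost surely positive semidefinite and, for all $m$ (with $m\le d_{\rm out}$ if $l=L+1$), the vectors $\vec Z^{(l)}_k=(Z^{(l)}_k(\mathbf x_1;\mathbf p),\dots,Z^{(l)}_k(\mathbf x_n;\mathbf p))^T$ satisfy $$\big(\vec Z^{(l)}_k\big)_{k=1,\dots,m}\ \xrightarrow{\ d\ }\ \mathbf E\Big[\bigotimes_{k=1}^m\mathcal N(0,\Sigma^{(l)})\Big]$$ as $\mathbf p\to\infty$ in the order $\lim_{p_L\to\infty}\cdots\lim_{p_1\to\infty}$ (an iterated limit of laws for weak convergence; $p_1\to\infty$ is the innermost limit, and at each stage only large widths matter, so that the $m$ nodes exist). -/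

import Mathlib

open MeasureTheory ProbabilityTheory Filter Topology
open scoped NNReal ENNReal

noncomputable section

/-! ### Infinitely divisible laws on the half-line and Poisson point processes -/

/-- `ρ` is a Lévy measure on `(0, ∞)`, viewed as a measure on `ℝ` carried by `(0, ∞)`. -/
structure IsLevyMeasure (ρ : Measure ℝ) : Prop where
  carried : ρ (Set.Iic 0) = 0
  lintegral_lt_top : ∫⁻ x, ENNReal.ofReal (min 1 x) ∂ρ < ∞

/-- `Λ` is the law `ID(a, ρ)`: it is carried by `[0, ∞)` and has Laplace transform
`t ↦ exp (-t a - ∫ (1 - exp (-w t)) ρ(dw))` on `[0, ∞)`. -/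
structure IsIDLaw (a : ℝ) (ρ : Measure ℝ) (Λ : ProbabilityMeasure ℝ) : Prop where
  carried : (Λ : Measure ℝ) (Set.Iio 0) = 0
  laplace : ∀ t : ℝ, 0 ≤ t →
    ∫ x, Real.exp (-(t * x)) ∂(Λ : Measure ℝ)
      = Real.exp (-(t * a) - ∫ w, (1 - Real.exp (-(w * t))) ∂ρ)

/-- The law of the sum of `q` independent random variables with common law `μ`. -/
def iidSumLaw (q : ℕ) (μ : ProbabilityMeasure ℝ) : ProbabilityMeasure ℝ :=
  (ProbabilityMeasure.pi fun _ : Fin q => μ).map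
    (f := fun v : Fin q → ℝ => ∑ j, v j)
    (Finset.measurable_fun_sum _ fun j _ => measurable_pi_apply j).aemeasurable

/-- The number of indices `j` with `t j ∈ s`, with values in `[0, ∞]`. -/
def pointCount (t : ℕ → ℝ) (s : Set ℝ) : ℝ≥0∞ :=
  Measure.sum (fun j => Measure.dirac (t j)) s

/-- The sequence `T` enumerates the points of a Poisson point process on `(0, ∞)` with mean
measure `ρ`. When the process has only finitely many points, the remaining entries of the
sequence are `0`, which is not a point of `(0, ∞)` (zero entries may also stand between points). -/
structure IsPoissonPoints {Ω : Type*} [MeasurableSpace Ω] (P : Measure Ω)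
    (T : ℕ → Ω → ℝ) (ρ : Measure ℝ) : Prop where
  measurable : ∀ j, Measurable (T j)
  nonneg : ∀ j ω, 0 ≤ T j ω
  count_law : ∀ s : Set ℝ, MeasurableSet s → s ⊆ Set.Ioi 0 → ρ s < ∞ →
    HasLaw (fun ω => pointCount (fun j => T j ω) s)
      ((poissonMeasure (ρ s).toNNReal).map (Nat.cast : ℕ → ℝ≥0∞)) P
  count_indep : ∀ (r : ℕ) (s : Fin r → Set ℝ), (∀ i, MeasurableSet (s i)) →
    (∀ i, s i ⊆ Set.Ioi 0) → Pairwise (fun i j => Disjoint (s i) (s j)) →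
    iIndepFun (fun i ω => pointCount (fun j => T j ω) (s i)) P

/-! ### The feedforward network

The hidden layers are `1, …, L`; the entry `i : Fin L` of a family refers to hidden layer `i + 1`,
and the entry `i : Fin (L + 1)` of `V`, `B` and of the pre-activations refers to layer `i + 1`
(so that `Fin.last L` is the output layer). Nodes are numbered from `0`. -/

/-- The number of nodes of the layers `0, …, L + 1`. -/
def layerWidth {L : ℕ} (d dout : ℕ) (p : Fin L → ℕ+) : Fin (L + 2) → ℕ :=
  Fin.cons d (Fin.snoc (fun i => (p i : ℕ)) dout)

/-- Pre-activation of node `k` at layer `i + 1` for the input `x`, in a network with hidden widths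
`p`, node variances `lam`, Gaussian factors `V` and biases `B`; the weight between node `j` and
node `k` is `√(lam j) * V j k`, where `lam j = 1 / d` in the input layer. -/
def preact {L d : ℕ} {Ω : Type*} (φ : ℝ → ℝ) (p : Fin L → ℕ+) (lam : Fin L → ℕ → Ω → ℝ)
    (V : Fin (L + 1) → ℕ → ℕ → Ω → ℝ) (B : Fin (L + 1) → ℕ → Ω → ℝ)
    (x : EuclideanSpace ℝ (Fin d)) : Fin (L + 1) → ℕ → Ω → ℝ :=
  Fin.induction (motive := fun _ => ℕ → Ω → ℝ)
    (fun k ω => ∑ j : Fin d, Real.sqrt (1 / (d : ℝ)) * V 0 j k ω * x j + B 0 k ω)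
    (fun i Z k ω => ∑ j ∈ Finset.range (p i),
      Real.sqrt (lam i j ω) * V i.succ j k ω * φ (Z j ω) + B i.succ k ω)

/-- The parameters of a network with hidden widths `p`, as one family of random variables: the
node variances of the hidden layers, then the Gaussian factors, then the biases. -/
def networkParams {L : ℕ} {Ω : Type*} (d dout : ℕ) (p : Fin L → ℕ+) (lam : Fin L → ℕ → Ω → ℝ)
    (V : Fin (L + 1) → ℕ → ℕ → Ω → ℝ) (B : Fin (L + 1) → ℕ → Ω → ℝ) :
    ((Σ i : Fin L, Fin (p i)) ⊕
      (Σ i : Fin (L + 1),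
        Fin (layerWidth d dout p i.castSucc) × Fin (layerWidth d dout p i.succ)) ⊕
      (Σ i : Fin (L + 1), Fin (layerWidth d dout p i.succ))) → Ω → ℝ
  | Sum.inl ⟨i, j⟩ => lam i j
  | Sum.inr (Sum.inl ⟨i, j, k⟩) => V i j k
  | Sum.inr (Sum.inr ⟨i, k⟩) => B i k

/-- The law of the parameters of a network with `d` inputs, hidden widths `p` and `dout` outputs.
Only indices of actual nodes are constrained, apart from measurability. -/
structure IsNetwork {L : ℕ} {Ω : Type*} [MeasurableSpace Ω] (d dout : ℕ) (σb σv : ℝ≥0)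
    (μ : Fin L → ℕ+ → ProbabilityMeasure ℝ) (p : Fin L → ℕ+) (P : Measure Ω)
    (lam : Fin L → ℕ → Ω → ℝ) (V : Fin (L + 1) → ℕ → ℕ → Ω → ℝ)
    (B : Fin (L + 1) → ℕ → Ω → ℝ) : Prop where
  aemeasurable_lam : ∀ i j, AEMeasurable (lam i j) P
  aemeasurable_V : ∀ i j k, AEMeasurable (V i j k) P
  aemeasurable_B : ∀ i k, AEMeasurable (B i k) P
  law_lam : ∀ (i : Fin L) (j : Fin (p i)), HasLaw (lam i j) (μ i (p i) : Measure ℝ) P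
  law_V : ∀ (i : Fin (L + 1)) (j : Fin (layerWidth d dout p i.castSucc))
    (k : Fin (layerWidth d dout p i.succ)), HasLaw (V i j k) (gaussianReal 0 (σv ^ 2)) P
  law_B : ∀ (i : Fin (L + 1)) (k : Fin (layerWidth d dout p i.succ)),
    HasLaw (B i k) (gaussianReal 0 (σb ^ 2)) P
  indep : iIndepFun (networkParams d dout p lam V B) P

/-- The pre-activations of the first `m` nodes of layer `l + 1` at the inputs `x 0, …, x (n - 1)`:
one vector of `ℝⁿ` per node. -/
def outputs {L d n : ℕ} {Ω : Type*} (φ : ℝ → ℝ) (p : Fin L → ℕ+) (lam : Fin L → ℕ → Ω → ℝ)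
    (V : Fin (L + 1) → ℕ → ℕ → Ω → ℝ) (B : Fin (L + 1) → ℕ → Ω → ℝ)
    (x : Fin n → EuclideanSpace ℝ (Fin d)) (l : Fin (L + 1)) (m : ℕ) :
    Ω → Fin m → EuclideanSpace ℝ (Fin n) :=
  fun ω k => WithLp.toLp 2 fun i => preact φ p lam V B (x i) l k ω

theorem IsNetwork.aemeasurable_preact {L d dout : ℕ} {Ω : Type*} [MeasurableSpace Ω]
    {σb σv : ℝ≥0} {μ : Fin L → ℕ+ → ProbabilityMeasure ℝ} {p : Fin L → ℕ+} {P : Measure Ω}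
    {lam : Fin L → ℕ → Ω → ℝ} {V : Fin (L + 1) → ℕ → ℕ → Ω → ℝ}
    {B : Fin (L + 1) → ℕ → Ω → ℝ} (h : IsNetwork d dout σb σv μ p P lam V B)
    {φ : ℝ → ℝ} (hφ : Continuous φ) (x : EuclideanSpace ℝ (Fin d)) (l : Fin (L + 1)) (k : ℕ) :
    AEMeasurable (preact φ p lam V B x l k) P := by
  revert k
  refine Fin.induction (motive := fun l => ∀ k, AEMeasurable (preact φ p lam V B x l k) P)
    ?_ ?_ l
  · intro k
    refine AEMeasurable.add ?_ (h.aemeasurable_B 0 k)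
    exact Finset.aemeasurable_fun_sum _ fun j _ =>
      ((h.aemeasurable_V 0 j k).const_mul _).mul_const _
  · intro i ih k
    refine AEMeasurable.add ?_ (h.aemeasurable_B i.succ k)
    exact Finset.aemeasurable_fun_sum _ fun j _ =>
      (((h.aemeasurable_lam i j).sqrt).mul (h.aemeasurable_V i.succ j k)).mul
        (hφ.measurable.comp_aemeasurable (ih j))

theorem IsNetwork.aemeasurable_outputs {L d dout n : ℕ} {Ω : Type*} [MeasurableSpace Ω]
    {σb σv : ℝ≥0} {μ : Fin L → ℕ+ → ProbabilityMeasure ℝ} {p : Fin L → ℕ+} {P : Measure Ω}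
    {lam : Fin L → ℕ → Ω → ℝ} {V : Fin (L + 1) → ℕ → ℕ → Ω → ℝ}
    {B : Fin (L + 1) → ℕ → Ω → ℝ} (h : IsNetwork d dout σb σv μ p P lam V B)
    {φ : ℝ → ℝ} (hφ : Continuous φ) (x : Fin n → EuclideanSpace ℝ (Fin d)) (l : Fin (L + 1))
    (m : ℕ) : AEMeasurable (outputs φ p lam V B x l m) P := by
  refine aemeasurable_pi_lambda _ fun k => ?_
  refine (WithLp.measurable_toLp 2 (Fin n → ℝ)).comp_aemeasurable ?_
  exact aemeasurable_pi_lambda _ fun i => h.aemeasurable_preact hφ (x i) l k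

/-- The law of `outputs`. -/
def outputsLaw {L d dout n : ℕ} {Ω : Type*} [MeasurableSpace Ω]
    {σb σv : ℝ≥0} {μ : Fin L → ℕ+ → ProbabilityMeasure ℝ} {p : Fin L → ℕ+} {P : Measure Ω}
    [IsProbabilityMeasure P] {lam : Fin L → ℕ → Ω → ℝ} {V : Fin (L + 1) → ℕ → ℕ → Ω → ℝ}
    {B : Fin (L + 1) → ℕ → Ω → ℝ} (h : IsNetwork d dout σb σv μ p P lam V B)
    {φ : ℝ → ℝ} (hφ : Continuous φ) (x : Fin n → EuclideanSpace ℝ (Fin d)) (l : Fin (L + 1))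
    (m : ℕ) : ProbabilityMeasure (Fin m → EuclideanSpace ℝ (Fin n)) :=
  ⟨P.map (outputs φ p lam V B x l m),
    Measure.isProbabilityMeasure_map (h.aemeasurable_outputs hφ x l m)⟩

/-- The iterated limit `lim_{p_L → ∞} ⋯ lim_{p_1 → ∞} f (p_1, …, p_L)` exists and equals `e`.
As usual for a limit, at each stage only the large values of the variable matter. -/
def IteratedTendsto {E : Type*} [TopologicalSpace E] :
    (L : ℕ) → ((Fin L → ℕ+) → E) → E → Prop
  | 0, f, e => f Fin.elim0 = e
  | L + 1, f, e => ∃ g : ℕ+ → E, Tendsto g atTop (𝓝 e) ∧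
      ∀ᶠ k in atTop, IteratedTendsto L (fun q => f (Fin.snoc q k)) (g k)

/-! ### The limiting random kernels -/

/-- The matrix `(k (x i) (x j))_{i, j}`. -/
def gramMatrix {X : Type*} {n : ℕ} (k : X → X → ℝ) (x : Fin n → X) : Matrix (Fin n) (Fin n) ℝ :=
  Matrix.of fun i j => k (x i) (x j)

/-- `k` is a covariance kernel, i.e. symmetric and positive semidefinite. -/
def IsCovKernel {X : Type*} (k : X → X → ℝ) : Prop :=
  ∀ (n : ℕ) (x : Fin n → X), (gramMatrix k x).PosSemidef

/-- The law of `m` independent copies of `(ζ (x 0), …, ζ (x (n - 1)))` where `ζ ∼ GP(0, k)`. -/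
def iidGaussian {X : Type*} {n : ℕ} (k : X → X → ℝ) (x : Fin n → X) (m : ℕ) :
    Measure (Fin m → EuclideanSpace ℝ (Fin n)) :=
  Measure.pi fun _ => multivariateGaussian 0 (gramMatrix k x)

/-- `E[φ(ζ(x)) φ(ζ(x'))]` for `ζ ∼ GP(0, k)`. -/
def activationMoment {X : Type*} (φ : ℝ → ℝ) (k : X → X → ℝ) (x x' : X) : ℝ :=
  ∫ u : EuclideanSpace ℝ (Fin 2), φ (u 0) * φ (u 1)
    ∂(multivariateGaussian 0 (gramMatrix k ![x, x']))

/-- The σ-algebra generated by one random kernel. -/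
abbrev kernelSigma {Ω X : Type*} (K : Ω → X → X → ℝ) : MeasurableSpace Ω :=
  MeasurableSpace.comap K MeasurableSpace.pi

/-- The σ-algebra generated by the random kernels `K 0, …, K l`. -/
abbrev historySigma {Ω X : Type*} {L : ℕ} (K : Fin (L + 1) → Ω → X → X → ℝ) (l : Fin (L + 1)) :
    MeasurableSpace Ω :=
  ⨆ i ∈ Set.Iic l, kernelSigma (K i)

/-- The random kernels `K 0, …, K L` (for the layers `1, …, L + 1`) obey the stochastic recursion
`K^(1)(x, x') = σb² + σv² xᵀx' / d`,
`K^(l+1)(x, x') = σb² + σv² a^(l) E[φ(ζ_1^(l)(x)) φ(ζ_1^(l)(x')) | K^(l)]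
  + σv² ∑_j T_j^(l) φ(ζ_j^(l)(x)) φ(ζ_j^(l)(x'))`,
driven by the points `T` of Poisson point processes, drawn independently of the kernels up to the
current layer, and by `ζ_j^(l) | K^(l) ∼ GP(0, K^(l))`, iid in `j` and drawn given the kernels
up to the current layer and the points `T^(l)`. The conditional expectation in the
recursion is the integral against the conditional law of `ζ_1^(l)` given `K^(l)`. -/
structure IsKernelRecursion {L d : ℕ} {Ω : Type*} [MeasurableSpace Ω] (P : Measure Ω)
    (σb σv : ℝ≥0) (φ : ℝ → ℝ) (a : Fin L → ℝ) (ρ : Fin L → Measure ℝ)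
    (K : Fin (L + 1) → Ω → EuclideanSpace ℝ (Fin d) → EuclideanSpace ℝ (Fin d) → ℝ)
    (T : Fin L → ℕ → Ω → ℝ) (ζ : Fin L → ℕ → Ω → EuclideanSpace ℝ (Fin d) → ℝ) : Prop where
  measurable_K : ∀ l, Measurable (K l)
  measurable_ζ : ∀ i j, Measurable (ζ i j)
  init : ∀ ω x x', K 0 ω x x' = (σb : ℝ) ^ 2 + (σv : ℝ) ^ 2 * (inner ℝ x x' / d)
  poisson : ∀ i, IsPoissonPoints P (T i) (ρ i)
  indep : ∀ i : Fin L, Indep (MeasurableSpace.comap (fun ω j => T i j ω) MeasurableSpace.pi)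
    (historySigma K i.castSucc) P
  gaussian : ∀ (i : Fin L) (m n : ℕ) (x : Fin n → EuclideanSpace ℝ (Fin d))
    (C : Set (Fin m → EuclideanSpace ℝ (Fin n))), MeasurableSet C →
    P⟦{ω | (fun j : Fin m => WithLp.toLp 2 fun r : Fin n => ζ i j ω (x r)) ∈ C} |
        historySigma K i.castSucc ⊔
          MeasurableSpace.comap (fun ω j => T i j ω) MeasurableSpace.pi⟧
      =ᵐ[P] fun ω => (iidGaussian (K i.castSucc ω) x m).real C
  recursion : ∀ (i : Fin L) (x x' : EuclideanSpace ℝ (Fin d)), ∀ᵐ ω ∂P,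
    HasSum (fun j => (σv : ℝ) ^ 2 * (T i j ω * φ (ζ i j ω x) * φ (ζ i j ω x')))
      (K i.succ ω x x' - (σb : ℝ) ^ 2
        - (σv : ℝ) ^ 2 * (a i * activationMoment φ (K i.castSucc ω) x x'))

end

/-!
The proof combines an analysis of one layer of large width, done with characteristic functions and
Laplace transforms, with a construction of the limiting kernels as a Markov chain.

*One layer.* Fix the inputs, let `m` nodes be given and let `t` be the argument of the joint
characteristic function of their pre-activations. Given the node variances `λⱼ` and the
pre-activations `zⱼ` of the previous layer, the Gaussian weights and biases can be integrated out,
and the result is `exp (-biasQuad t - ∑ⱼ λⱼ Q(zⱼ))` for a quadratic form `Q = quadAct` in the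
activations. If the `zⱼ` are, given a random covariance matrix, iid Gaussian vectors with law `N`,
then integrating over `λ` and `z` leaves the power `(∫ E[exp (-λ Q)] dN) ^ p`. The assumption on
the sums of the `λⱼ` says that `p (1 - E[exp (-s λ)])` converges to the Laplace exponent of
`ID(a, ρ)` at each `s ≥ 0`, and it is dominated by a multiple of `1 + s`; as `Q` is integrable under
Gaussian laws, the power converges to `exp (-∫ ψ(Q) dN)`, where `ψ = levyExponent a ρ`
(`tendsto_integral_mixLaplace_pow`). The limit is identified with `E[exp (-∑ tₖᵀ Σ' tₖ / 2)]`, where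
`Σ'` is given by the kernel recursion, by the Laplace functional of a Poisson process with
independent marks (`integral_expNeg_marked`, `IsKernelRecursion.jointCharFun_succ`). Lévy's
continuity theorem concludes (`tendsto_layerStep`).

*Iterated limit.* The law of a layer is a weakly continuous function of the law of the layer before
(`continuous_layerStep`), so the inner limits can be taken inside the outer ones, and the theorem
follows by induction over the layers (`IsKernelRecursion.iteratedTendsto_netLaw`).

*Markov property.* By the recursion, the next kernel is a function of the current kernel, of the
points and of the Gaussian processes, up to null events. The points are independent of the past and
the law of the processes given the past and the points depends only on the current kernel; a π-system
argument gives the conditional independence (`IsKernelRecursion.markov`).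

*Existence.* Gaussian processes on an arbitrary index set come from Kolmogorov's extension theorem
(`exists_isProjectiveLimit`). A Poisson process with given Lévy measure is a superposition of
processes with finite mean measures, and is recognised by its Laplace functional
(`isPoissonPoints_of_laplace`). The kernels, points and processes of the successive layers are then
a trajectory of a Markov chain (`exists_isKernelRecursion`). The only delicate point is that the
series in the recursion converges almost surely for each pair of inputs, but not for all inputs
simultaneously. Hence activations at inputs of divergence are replaced by `0`, which makes
the next kernel positive semidefinite everywhere and a measurable function of the data
(`nextKernel`).
-/

set_option linter.unusedSectionVars false

noncomputable section

/-! ### Gaussian laws with random covariance matrices -/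

instance matrixMeasurableSpace {n : ℕ} : MeasurableSpace (Matrix (Fin n) (Fin n) ℝ) :=
  inferInstanceAs (MeasurableSpace (Fin n → Fin n → ℝ))

instance matrixBorelSpace {n : ℕ} : BorelSpace (Matrix (Fin n) (Fin n) ℝ) :=
  inferInstanceAs (BorelSpace (Fin n → Fin n → ℝ))

theorem measurable_matrix_entry {n : ℕ} (i j : Fin n) :
    Measurable (fun S : Matrix (Fin n) (Fin n) ℝ => S i j) :=
  (measurable_pi_apply j).comp (measurable_pi_apply (X := fun _ : Fin n => Fin n → ℝ) i)

theorem isClosed_posSemidef {n : ℕ} :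
    IsClosed {S : Matrix (Fin n) (Fin n) ℝ | S.PosSemidef} := by
  have h : {S : Matrix (Fin n) (Fin n) ℝ | S.PosSemidef}
      = {S | S.transpose = S} ∩ ⋂ x : Fin n → ℝ, {S | 0 ≤ x ⬝ᵥ (S.mulVec x)} := by
    ext S
    simp only [Set.mem_ofPred_eq, Set.mem_inter_iff, Set.mem_iInter]
    rw [Matrix.posSemidef_iff_dotProduct_mulVec]
    simp [Matrix.IsHermitian, Matrix.conjTranspose_eq_transpose_of_trivial]
  rw [h]
  refine (isClosed_eq (by fun_prop) (by fun_prop)).inter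
    (isClosed_iInter fun x => isClosed_le (by fun_prop) (by fun_prop))

section
open scoped MatrixOrder Matrix.Norms.L2Operator

/-- The square root is continuous on the closed cone of positive semidefinite matrices, and takes
the value `0` outside of it. -/
theorem measurable_matrix_sqrt {n : ℕ} :
    Measurable (fun S : Matrix (Fin n) (Fin n) ℝ => CFC.sqrt S) := by
  have hm : MeasurableSet {S : Matrix (Fin n) (Fin n) ℝ | S.PosSemidef} :=
    isClosed_posSemidef.measurableSet
  refine measurable_of_restrict_of_restrict_compl hm ?_ ?_
  · have h : ContinuousOn (fun S : Matrix (Fin n) (Fin n) ℝ => CFC.sqrt S)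
        {S : Matrix (Fin n) (Fin n) ℝ | S.PosSemidef} := by
      have := CFC.continuousOn_sqrt (A := Matrix (Fin n) (Fin n) ℝ)
      refine this.mono fun S hS => ?_
      exact Matrix.PosSemidef.nonneg hS
    exact (continuousOn_iff_continuous_domRestrict.1 h).measurable
  · have : ({S : Matrix (Fin n) (Fin n) ℝ | S.PosSemidef}ᶜ).domRestrict
        (fun S : Matrix (Fin n) (Fin n) ℝ => CFC.sqrt S) = fun _ => 0 := by
      ext1 ⟨S, hS⟩
      simp only [Set.domRestrict_apply]
      rw [CFC.sqrt, cfcₙ_apply_of_not_predicate]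
      change ¬ (S - 0).PosSemidef
      simpa using hS
    rw [this]
    exact measurable_const

/-- `N(0, S)` is the law of `√S Y` for a standard Gaussian vector `Y`, jointly measurable in
`(S, Y)`. -/
theorem measurable_multivariateGaussian {n : ℕ} :
    Measurable (fun S : Matrix (Fin n) (Fin n) ℝ =>
      multivariateGaussian (0 : EuclideanSpace ℝ (Fin n)) S) := by
  have hf : Measurable (fun p : Matrix (Fin n) (Fin n) ℝ × EuclideanSpace ℝ (Fin n) =>
      (0 : EuclideanSpace ℝ (Fin n)) +
        Matrix.toEuclideanCLM (n := Fin n) (𝕜 := ℝ) (CFC.sqrt p.1) p.2) := by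
    simp only [zero_add]
    have : (fun p : Matrix (Fin n) (Fin n) ℝ × EuclideanSpace ℝ (Fin n) =>
        Matrix.toEuclideanCLM (n := Fin n) (𝕜 := ℝ) (CFC.sqrt p.1) p.2)
        = fun p => WithLp.toLp 2 fun i =>
          ∑ j, (CFC.sqrt p.1 : Matrix (Fin n) (Fin n) ℝ) i j * p.2 j := by
      ext p i
      rw [Matrix.ofLp_toEuclideanCLM]
      rfl
    rw [this]
    refine (WithLp.measurable_toLp 2 (Fin n → ℝ)).comp (measurable_pi_lambda _ fun i => ?_)
    refine Finset.measurable_fun_sum _ fun j _ => Measurable.mul ?_ (by fun_prop)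
    exact (measurable_matrix_entry i j).comp (measurable_matrix_sqrt.comp measurable_fst)
  have h2 := (Measure.measurable_map _ hf).comp
    (Measurable.map_prodMk_left (ν := stdGaussian (EuclideanSpace ℝ (Fin n)))
      (α := Matrix (Fin n) (Fin n) ℝ))
  convert h2 using 1
  ext1 S
  rw [Function.comp_apply, Measure.map_map hf measurable_prodMk_left]
  rfl

end

/-- The Markov kernel `S ↦ N(0, S)^{⊗ m}`. -/
def gaussianKernel (n m : ℕ) :
    Kernel (Matrix (Fin n) (Fin n) ℝ) (Fin m → EuclideanSpace ℝ (Fin n)) where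
  toFun S := Measure.pi fun _ => multivariateGaussian 0 S
  measurable' := by
    refine Measurable.measure_of_isPiSystem_of_isProbabilityMeasure
      generateFrom_pi.symm isPiSystem_pi ?_
    rintro _ ⟨t, ht, rfl⟩
    simp only [Set.mem_pi, Set.mem_univ, forall_const, Set.mem_ofPred_eq] at ht
    simp_rw [Measure.pi_pi]
    refine Finset.measurable_fun_prod _ fun i _ => ?_
    exact (Measure.measurable_coe (ht i)).comp measurable_multivariateGaussian

instance {n m : ℕ} : IsMarkovKernel (gaussianKernel n m) :=
  ⟨fun S => by
    change IsProbabilityMeasure (Measure.pi fun _ => multivariateGaussian 0 S)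
    infer_instance⟩

/-- A coordinate map of a centred Gaussian vector is centred Gaussian with the corresponding
covariance submatrix; the index map need not be injective. -/
theorem map_multivariateGaussian_comp {ι κ : Type*} [Fintype ι] [DecidableEq ι]
    [Fintype κ] [DecidableEq κ] {S : Matrix ι ι ℝ}
    (hS : S.PosSemidef) (f : κ → ι) :
    (multivariateGaussian 0 S).map
        (fun z : EuclideanSpace ℝ ι => WithLp.toLp 2 fun i => z (f i))
      = multivariateGaussian 0 (S.submatrix f f) := by
  have hm : Measurable (fun z : EuclideanSpace ℝ ι =>
      (WithLp.toLp 2 fun i => z (f i) : EuclideanSpace ℝ κ)) := by fun_prop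
  have : IsProbabilityMeasure ((multivariateGaussian 0 S).map
        (fun z : EuclideanSpace ℝ ι =>
          (WithLp.toLp 2 fun i => z (f i) : EuclideanSpace ℝ κ))) :=
    Measure.isProbabilityMeasure_map hm.aemeasurable
  refine Measure.ext_of_charFun (funext fun t => ?_)
  -- the adjoint of the coordinate map
  let u : EuclideanSpace ℝ ι := WithLp.toLp 2 fun j => ∑ i, if f i = j then t i else 0
  have hu : ∀ z : EuclideanSpace ℝ ι,
      inner ℝ (WithLp.toLp 2 fun i => z (f i) : EuclideanSpace ℝ κ) t = inner ℝ z u := by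
    intro z
    simp only [PiLp.inner_apply, RCLike.inner_apply, conj_trivial, u, Finset.sum_mul]
    rw [Finset.sum_comm]
    simp
  have h1 : charFun ((multivariateGaussian 0 S).map
        (fun z : EuclideanSpace ℝ ι =>
          (WithLp.toLp 2 fun i => z (f i) : EuclideanSpace ℝ κ))) t
      = charFun (multivariateGaussian 0 S) u := by
    rw [charFun_apply, integral_map hm.aemeasurable (by fun_prop), charFun_apply]
    simp_rw [hu]
  rw [h1, charFun_multivariateGaussian hS, charFun_multivariateGaussian (hS.submatrix f)]
  have h2 : ∀ v : ι → ℝ, (u : ι → ℝ) ⬝ᵥ v = ∑ i, t i * v (f i) := by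
    intro v
    simp only [dotProduct, u, Finset.sum_mul]
    rw [Finset.sum_comm]
    simp
  have h3 : ∀ v : ι → ℝ, v ⬝ᵥ (u : ι → ℝ) = ∑ i, v (f i) * t i := by
    intro v
    rw [dotProduct_comm, h2]
    simp_rw [mul_comm]
  have h4 : (u : ι → ℝ) ⬝ᵥ S.mulVec u
      = (t : κ → ℝ) ⬝ᵥ (S.submatrix f f).mulVec t := by
    rw [h2]
    simp only [Matrix.mulVec, h3]
    rfl
  rw [h4]
  simp

/-! ### Characteristic functions of finite families of random vectors -/

/-- The joint characteristic function of `m` random vectors of `ℝⁿ`. -/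
def jointCharFun {m n : ℕ} (μ : Measure (Fin m → EuclideanSpace ℝ (Fin n)))
    (t : Fin m → EuclideanSpace ℝ (Fin n)) : ℂ :=
  ∫ x, Complex.exp ((∑ k, inner ℝ (x k) (t k) : ℝ) * Complex.I) ∂μ

theorem charFun_map_toLp_pi {m n : ℕ} (μ : Measure (Fin m → EuclideanSpace ℝ (Fin n)))
    (t : PiLp 2 fun _ : Fin m => EuclideanSpace ℝ (Fin n)) :
    charFun (μ.map (WithLp.toLp 2)) t = jointCharFun μ t := by
  rw [charFun_apply, integral_map (by fun_prop) (by fun_prop), jointCharFun]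
  simp [PiLp.inner_apply]

/-- Lévy's continuity theorem for finite families of random vectors. -/
theorem tendsto_of_tendsto_jointCharFun {m n : ℕ}
    {μ : ℕ+ → ProbabilityMeasure (Fin m → EuclideanSpace ℝ (Fin n))}
    {μ₀ : ProbabilityMeasure (Fin m → EuclideanSpace ℝ (Fin n))}
    (h : ∀ t, Tendsto (fun k => jointCharFun (μ k).toMeasure t) atTop
      (𝓝 (jointCharFun μ₀.toMeasure t))) :
    Tendsto μ atTop (𝓝 μ₀) := by
  have hc : Continuous (WithLp.toLp 2 : (Fin m → EuclideanSpace ℝ (Fin n)) →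
      PiLp 2 fun _ : Fin m => EuclideanSpace ℝ (Fin n)) := PiLp.continuous_toLp 2 _
  have hc' : Continuous (WithLp.ofLp : (PiLp 2 fun _ : Fin m => EuclideanSpace ℝ (Fin n)) →
      (Fin m → EuclideanSpace ℝ (Fin n))) := PiLp.continuous_ofLp 2 _
  have h0 : Tendsto Nat.succPNat atTop atTop :=
    tendsto_atTop_atTop.2 fun b => ⟨b, fun a hab => by
      have : (b : ℕ) ≤ a.succPNat := hab.trans a.le_succ
      exact_mod_cast this⟩
  have h1 : Tendsto (fun k : ℕ => (μ k.succPNat).map hc.measurable.aemeasurable) atTop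
      (𝓝 (μ₀.map hc.measurable.aemeasurable)) := by
    refine ProbabilityMeasure.tendsto_of_tendsto_charFun fun t => ?_
    simp only [ProbabilityMeasure.toMeasure_map, charFun_map_toLp_pi]
    exact (h t).comp h0
  have h2 := ((ProbabilityMeasure.continuous_map hc').tendsto _).comp h1
  have h3 : ∀ ν : ProbabilityMeasure (Fin m → EuclideanSpace ℝ (Fin n)),
      (ν.map hc.measurable.aemeasurable).map hc'.measurable.aemeasurable = ν := by
    intro ν
    apply Subtype.ext
    change (ν.toMeasure.map (WithLp.toLp 2)).map WithLp.ofLp = ν.toMeasure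
    rw [Measure.map_map hc'.measurable hc.measurable]
    exact Measure.map_id
  rw [h3] at h2
  have h4 : Tendsto (fun k : ℕ => μ k.succPNat) atTop (𝓝 μ₀) := by
    refine h2.congr fun k => ?_
    exact h3 _
  have h5 : Tendsto (fun k : ℕ+ => k.natPred) atTop atTop := by
    refine tendsto_atTop_atTop.2 fun b => ⟨b.succPNat, fun a ha => ?_⟩
    have := PNat.natPred_le_natPred.2 ha
    simpa using this
  refine (h4.comp h5).congr fun k => ?_
  simp

theorem ext_of_jointCharFun {m n : ℕ} {μ ν : Measure (Fin m → EuclideanSpace ℝ (Fin n))}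
    [IsFiniteMeasure μ] [IsFiniteMeasure ν] (h : ∀ t, jointCharFun μ t = jointCharFun ν t) :
    μ = ν := by
  have hm : Measurable (WithLp.toLp 2 : (Fin m → EuclideanSpace ℝ (Fin n)) →
      PiLp 2 fun _ : Fin m => EuclideanSpace ℝ (Fin n)) := by fun_prop
  have hm' : Measurable (WithLp.ofLp : (PiLp 2 fun _ : Fin m => EuclideanSpace ℝ (Fin n)) →
      (Fin m → EuclideanSpace ℝ (Fin n))) := by fun_prop
  have h1 : μ.map (WithLp.toLp 2) = ν.map (WithLp.toLp 2) :=
    Measure.ext_of_charFun (funext fun t => by simp only [charFun_map_toLp_pi, h])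
  have h2 := congrArg (Measure.map WithLp.ofLp) h1
  rw [Measure.map_map hm' hm, Measure.map_map hm' hm] at h2
  simpa [Function.comp_def] using h2

theorem jointCharFun_pi_multivariateGaussian {m n : ℕ} {S : Matrix (Fin n) (Fin n) ℝ}
    (hS : S.PosSemidef) (t : Fin m → EuclideanSpace ℝ (Fin n)) :
    jointCharFun (Measure.pi fun _ => multivariateGaussian 0 S) t
      = (Real.exp (-(∑ k, (t k : Fin n → ℝ) ⬝ᵥ S.mulVec (t k)) / 2) : ℝ) := by
  rw [jointCharFun]
  have : ∀ x : Fin m → EuclideanSpace ℝ (Fin n),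
      Complex.exp ((∑ k, inner ℝ (x k) (t k) : ℝ) * Complex.I)
        = ∏ k, Complex.exp ((inner ℝ (x k) (t k) : ℝ) * Complex.I) := by
    intro x
    rw [← Complex.exp_sum]
    push_cast
    rw [Finset.sum_mul]
  simp_rw [this]
  rw [integral_fintype_prod_eq_prod (𝕜 := ℂ)
    (f := fun k (z : EuclideanSpace ℝ (Fin n)) =>
      Complex.exp ((inner ℝ z (t k) : ℝ) * Complex.I))]
  have h2 : ∀ k, ∫ z : EuclideanSpace ℝ (Fin n),
      Complex.exp ((inner ℝ z (t k) : ℝ) * Complex.I) ∂(multivariateGaussian 0 S)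
        = Complex.exp (-((t k : Fin n → ℝ) ⬝ᵥ S.mulVec (t k) : ℝ) / 2) := by
    intro k
    rw [← charFun_apply, charFun_multivariateGaussian hS]
    congr 1
    simp [neg_div]
  simp_rw [h2]
  rw [← Complex.exp_sum]
  push_cast
  congr 1
  rw [← Finset.sum_div, Finset.sum_neg_distrib]

/-- Gaussian vectors have moments of all orders, so that activations of polynomial growth are square
integrable. -/
theorem integrable_sq_activation {n : ℕ} {φ : ℝ → ℝ} (hφ : Continuous φ)
    (henv : ∃ A B C : ℝ, 0 < A ∧ 0 < B ∧ 0 < C ∧ ∀ z : ℝ, |φ z| ≤ A + B * |z| ^ C)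
    (S : Matrix (Fin n) (Fin n) ℝ) (i : Fin n) :
    Integrable (fun z : EuclideanSpace ℝ (Fin n) => φ (z i) ^ 2) (multivariateGaussian 0 S) := by
  obtain ⟨A, B, C, hA, hB, hC, hb⟩ := henv
  obtain ⟨N, hN⟩ := exists_nat_ge C
  have h1 : ∀ z : EuclideanSpace ℝ (Fin n),
      |φ (z i)| ≤ A + B * (1 + ‖z‖ ^ N) := by
    intro z
    refine (hb _).trans ?_
    gcongr
    have hz : |z i| ≤ ‖z‖ := PiLp.norm_apply_le z i
    rcases le_total |z i| 1 with h | h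
    · have := Real.rpow_le_one (abs_nonneg (z i)) h hC.le
      have : 0 ≤ ‖z‖ ^ N := by positivity
      linarith
    · have h2 : |z i| ^ C ≤ |z i| ^ (N : ℝ) := Real.rpow_le_rpow_of_exponent_le h hN
      rw [Real.rpow_natCast] at h2
      have h3 : |z i| ^ N ≤ ‖z‖ ^ N := pow_le_pow_left₀ (abs_nonneg _) hz N
      linarith
  have h2 : Integrable (fun z : EuclideanSpace ℝ (Fin n) => ‖z‖ ^ (2 * N))
      (multivariateGaussian 0 S) := by
    have := (IsGaussian.memLp_id (multivariateGaussian (0 : EuclideanSpace ℝ (Fin n)) S)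
      ((2 * N : ℕ) : ℝ≥0∞) (ENNReal.natCast_ne_top _)).integrable_norm_pow'
    simpa using this
  refine ((h2.const_mul (2 * B ^ 2)).add (integrable_const (2 * (A + B) ^ 2))).mono'
    (by fun_prop) (ae_of_all _ fun z => ?_)
  rw [Real.norm_of_nonneg (sq_nonneg _), ← sq_abs]
  have h3 := h1 z
  have h4 : |φ (z i)| ^ 2 ≤ (A + B * (1 + ‖z‖ ^ N)) ^ 2 := pow_le_pow_left₀ (abs_nonneg _) h3 2
  refine h4.trans ?_
  simp only [Pi.add_apply]
  have : ‖z‖ ^ (2 * N) = (‖z‖ ^ N) ^ 2 := by rw [mul_comm, pow_mul]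
  rw [this]
  nlinarith [sq_nonneg ((A + B) - B * ‖z‖ ^ N)]

theorem integrable_mul_activation {n : ℕ} {φ : ℝ → ℝ} (hφ : Continuous φ)
    (henv : ∃ A B C : ℝ, 0 < A ∧ 0 < B ∧ 0 < C ∧ ∀ z : ℝ, |φ z| ≤ A + B * |z| ^ C)
    (S : Matrix (Fin n) (Fin n) ℝ) (i j : Fin n) :
    Integrable (fun z : EuclideanSpace ℝ (Fin n) => φ (z i) * φ (z j))
      (multivariateGaussian 0 S) := by
  refine ((integrable_sq_activation hφ henv S i).add
    (integrable_sq_activation hφ henv S j)).mono' (by fun_prop) (ae_of_all _ fun z => ?_)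
  rw [Real.norm_eq_abs, abs_mul]
  simp only [Pi.add_apply]
  nlinarith [sq_nonneg (|φ (z i)| - |φ (z j)|), sq_abs (φ (z i)), sq_abs (φ (z j)),
    sq_nonneg (φ (z i)), sq_nonneg (φ (z j))]

/-! ### The Laplace functional of a Poisson point process -/

/-- The function `x ↦ exp (-x)` on `[0, ∞]`, with `exp (-∞) = 0`. -/
def expNeg (x : ℝ≥0∞) : ℝ := (EReal.exp (-(x : EReal))).toReal

theorem expNeg_ofReal {x : ℝ} (hx : 0 ≤ x) : expNeg (ENNReal.ofReal x) = Real.exp (-x) := by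
  have : (-((ENNReal.ofReal x : ℝ≥0∞) : EReal)) = ((-x : ℝ) : EReal) := by
    rw [EReal.coe_ennreal_ofReal, max_eq_left hx]; rfl
  rw [expNeg, this, EReal.exp_coe, ENNReal.toReal_ofReal (Real.exp_pos _).le]

theorem expNeg_le_ennreal (x : ℝ≥0∞) : EReal.exp (-(x : EReal)) ≤ 1 := by
  rw [EReal.exp_le_one_iff]
  simpa using EReal.coe_ennreal_nonneg x

theorem expNeg_nonneg (x : ℝ≥0∞) : 0 ≤ expNeg x := ENNReal.toReal_nonneg

theorem expNeg_le_one (x : ℝ≥0∞) : expNeg x ≤ 1 := by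
  have := ENNReal.toReal_mono ENNReal.one_ne_top (expNeg_le_ennreal x)
  simpa [expNeg] using this

@[simp] theorem expNeg_zero : expNeg 0 = 1 := by simp [expNeg]

@[simp] theorem expNeg_top : expNeg ∞ = 0 := by simp [expNeg]

theorem expNeg_add (x y : ℝ≥0∞) : expNeg (x + y) = expNeg x * expNeg y := by
  rcases eq_or_ne x ∞ with rfl | hx
  · simp
  rcases eq_or_ne y ∞ with rfl | hy
  · simp
  lift x to ℝ≥0 using hx
  lift y to ℝ≥0 using hy
  have h : ∀ z : ℝ≥0, expNeg z = Real.exp (-z) := fun z => by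
    simpa using expNeg_ofReal z.2
  rw [← ENNReal.coe_add, h, h, h, ← Real.exp_add]
  congr 1; push_cast; ring

theorem expNeg_sum {ι : Type*} (s : Finset ι) (f : ι → ℝ≥0∞) :
    expNeg (∑ i ∈ s, f i) = ∏ i ∈ s, expNeg (f i) := by
  classical
  induction s using Finset.induction with
  | empty => simp
  | insert i s hi ih => rw [Finset.sum_insert hi, Finset.prod_insert hi, expNeg_add, ih]

theorem expNeg_mul_natCast (c : ℝ≥0∞) (n : ℕ) : expNeg (c * n) = expNeg c ^ n := by
  have := expNeg_sum (Finset.range n) (fun _ => c)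
  simpa [mul_comm] using this

theorem continuous_expNeg : Continuous expNeg := by
  have h1 : Continuous fun x : ℝ≥0∞ => EReal.exp (-(x : EReal)) :=
    ENNReal.continuous_exp.comp (continuous_neg.comp continuous_coe_ennreal_ereal)
  refine continuous_iff_continuousAt.2 fun x => ?_
  refine (ENNReal.tendsto_toReal ?_).comp h1.continuousAt
  exact ((expNeg_le_ennreal x).trans_lt ENNReal.one_lt_top).ne

theorem measurable_expNeg_const_mul (c : ℝ≥0∞) : Measurable fun x => expNeg (c * x) :=
  continuous_expNeg.measurable.comp (measurable_const_mul c)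

theorem expNeg_antitone : Antitone expNeg := by
  intro x y hxy
  refine ENNReal.toReal_mono ((expNeg_le_ennreal x).trans_lt ENNReal.one_lt_top).ne ?_
  rw [EReal.exp_le_exp_iff, EReal.neg_le_neg_iff]
  exact_mod_cast hxy

theorem IsLevyMeasure.measure_Ici_lt_top {ρ : Measure ℝ} (hρ : IsLevyMeasure ρ) {ε : ℝ}
    (hε : 0 < ε) : ρ (Set.Ici ε) < ∞ := by
  have h1 := hρ.lintegral_lt_top
  have h2 : ENNReal.ofReal (min 1 ε) * ρ {x | ENNReal.ofReal (min 1 ε) ≤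
      ENNReal.ofReal (min 1 x)} ≤ ∫⁻ x, ENNReal.ofReal (min 1 x) ∂ρ :=
    mul_meas_ge_le_lintegral (by fun_prop) _
  have h3 : Set.Ici ε ⊆ {x | ENNReal.ofReal (min 1 ε) ≤ ENNReal.ofReal (min 1 x)} :=
    fun x hx => ENNReal.ofReal_le_ofReal (min_le_min_left _ hx)
  refine (measure_mono h3).trans_lt ?_
  by_contra h
  rw [not_lt, top_le_iff] at h
  rw [h, ENNReal.mul_top (by simp [hε])] at h2
  exact absurd h1 (not_lt.2 h2)

theorem integral_pow_poissonMeasure (r : ℝ≥0) (c : ℝ) :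
    ∫ n, c ^ n ∂(poissonMeasure r) = Real.exp (-(r * (1 - c))) := by
  rw [integral_poissonMeasure]
  simp_rw [smul_eq_mul]
  have h := (NormedSpace.expSeries_div_hasSum_exp (𝔸 := ℝ) ((r : ℝ) * c)).mul_left
    (Real.exp (-r))
  rw [← Real.exp_eq_exp_ℝ] at h
  rw [show -((r : ℝ) * (1 - c)) = -r + r * c by ring, Real.exp_add, ← h.tsum_eq]
  congr 1
  ext n
  rw [mul_pow]
  ring

theorem integral_expNeg_poisson (r : ℝ≥0) (c : ℝ≥0∞) :
    ∫ n, expNeg (c * n) ∂((poissonMeasure r).map (Nat.cast : ℕ → ℝ≥0∞))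
      = Real.exp (-(r * (1 - expNeg c))) := by
  rw [integral_map (by fun_prop) (measurable_expNeg_const_mul c).aestronglyMeasurable]
  simp_rw [expNeg_mul_natCast]
  exact integral_pow_poissonMeasure r _

/-- The Laplace functional at a simple function. -/
theorem IsPoissonPoints.laplace_simpleFunc {Ω : Type*} [MeasurableSpace Ω] {P : Measure Ω}
    [IsProbabilityMeasure P] {T : ℕ → Ω → ℝ} {ρ : Measure ℝ} (hT : IsPoissonPoints P T ρ)
    (f : SimpleFunc ℝ ℝ≥0∞) (hf : ∀ c, c ≠ 0 → ρ (f ⁻¹' {c}) < ∞)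
    (hf' : ∀ c, c ≠ 0 → f ⁻¹' {c} ⊆ Set.Ioi 0) :
    ∫ ω, expNeg (∑' j, f (T j ω)) ∂P
      = expNeg (∫⁻ w, ENNReal.ofReal (1 - expNeg (f w)) ∂ρ) := by
  classical
  set I : Finset ℝ≥0∞ := f.range.filter (· ≠ 0) with hI
  have hI0 : ∀ c : I, (c : ℝ≥0∞) ≠ 0 := fun c => (Finset.mem_filter.1 c.2).2
  have h1 : ∀ ω, ∑' j, f (T j ω)
      = ∑ c : I, (c : ℝ≥0∞) * pointCount (fun j => T j ω) (f ⁻¹' {(c : ℝ≥0∞)}) := by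
    intro ω
    have : ∑' j, f (T j ω) = ∫⁻ x, f x ∂(Measure.sum fun j => Measure.dirac (T j ω)) := by
      rw [lintegral_sum_measure]
      simp_rw [lintegral_dirac' _ f.measurable]
    rw [this, SimpleFunc.lintegral_eq_lintegral, SimpleFunc.lintegral,
      ← Finset.sum_filter_ne_zero, Finset.sum_coe_sort I
        (fun c => c * pointCount (fun j => T j ω) (f ⁻¹' {c})), hI]
    refine (Finset.sum_subset ?_ ?_)
    · intro c hc
      simp only [Finset.mem_filter] at hc ⊢
      exact ⟨hc.1, left_ne_zero_of_mul hc.2⟩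
    · intro c hc hc'
      by_contra h
      exact hc' (Finset.mem_filter.2 ⟨(Finset.mem_filter.1 hc).1, h⟩)
  set e := I.equivFin
  have h2 := hT.count_indep I.card (fun i => f ⁻¹' {((e.symm i : I) : ℝ≥0∞)})
    (fun i => f.measurableSet_preimage _) (fun i => hf' _ (hI0 _))
    (fun i j hij => by
      refine Disjoint.preimage _ ?_
      simp only [Set.disjoint_singleton, ne_eq, Subtype.coe_inj, EmbeddingLike.apply_eq_iff_eq]
      exact hij)
  have hmc : ∀ c : ℝ≥0∞, c ≠ 0 → HasLaw (fun ω => pointCount (fun j => T j ω) (f ⁻¹' {c}))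
      ((poissonMeasure (ρ (f ⁻¹' {c})).toNNReal).map (Nat.cast : ℕ → ℝ≥0∞)) P :=
    fun c hc => hT.count_law _ (f.measurableSet_preimage _) (hf' _ hc) (hf _ hc)
  have h3 : ∫ ω, expNeg (∑' j, f (T j ω)) ∂P
      = ∏ i, ∫ ω, expNeg ((e.symm i : I) *
          pointCount (fun j => T j ω) (f ⁻¹' {((e.symm i : I) : ℝ≥0∞)})) ∂P := by
    rw [← h2.integral_fun_prod_comp
      (f := fun i x => expNeg (((e.symm i : I) : ℝ≥0∞) * x)) (fun i => (hmc _ (hI0 _)).aemeasurable)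
      (fun i => (measurable_expNeg_const_mul _).aestronglyMeasurable)]
    congr 1
    ext ω
    rw [h1, expNeg_sum]
    exact (Equiv.prod_comp e.symm (fun c : I => expNeg ((c : ℝ≥0∞) *
      pointCount (fun j => T j ω) (f ⁻¹' {(c : ℝ≥0∞)})))).symm
  have h4 : ∀ c : I, ∫ ω, expNeg ((c : ℝ≥0∞) *
      pointCount (fun j => T j ω) (f ⁻¹' {(c : ℝ≥0∞)})) ∂P
      = expNeg (ENNReal.ofReal (1 - expNeg c) * ρ (f ⁻¹' {(c : ℝ≥0∞)})) := by
    intro c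
    have h5 := integral_expNeg_poisson (ρ (f ⁻¹' {(c : ℝ≥0∞)})).toNNReal c
    rw [← (hmc _ (hI0 c)).map_eq, integral_map (hmc _ (hI0 c)).aemeasurable
      (measurable_expNeg_const_mul _).aestronglyMeasurable] at h5
    rw [h5, ← expNeg_ofReal (mul_nonneg (by positivity) (by linarith [expNeg_le_one (c : ℝ≥0∞)])),
      ENNReal.ofReal_mul (by positivity), mul_comm]
    congr 2
    rw [ENNReal.ofReal_coe_nnreal, ENNReal.coe_toNNReal (hf _ (hI0 c)).ne]
  rw [h3, Equiv.prod_comp e.symm (fun c : I => ∫ ω, expNeg ((c : ℝ≥0∞) *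
      pointCount (fun j => T j ω) (f ⁻¹' {(c : ℝ≥0∞)})) ∂P)]
  simp_rw [h4]
  rw [← expNeg_sum]
  congr 1
  have h6 : ∫⁻ w, ENNReal.ofReal (1 - expNeg (f w)) ∂ρ
      = (f.map fun c => ENNReal.ofReal (1 - expNeg c)).lintegral ρ := by
    rw [← SimpleFunc.lintegral_eq_lintegral]; rfl
  rw [h6, SimpleFunc.map_lintegral, Finset.sum_coe_sort I
    (fun c => ENNReal.ofReal (1 - expNeg c) * ρ (f ⁻¹' {c})), hI]
  refine Finset.sum_subset (Finset.filter_subset _ _) fun c hc hc' => ?_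
  have : c = 0 := by
    by_contra h
    exact hc' (Finset.mem_filter.2 ⟨hc, h⟩)
  simp [this]

/-- The Laplace functional of a Poisson point process on `(0, ∞)`. -/
theorem IsPoissonPoints.laplace {Ω : Type*} [MeasurableSpace Ω] {P : Measure Ω}
    [IsProbabilityMeasure P] {T : ℕ → Ω → ℝ} {ρ : Measure ℝ} (hT : IsPoissonPoints P T ρ)
    (hρ : IsLevyMeasure ρ) {h : ℝ → ℝ≥0∞} (hh : Measurable h) (h0 : h 0 = 0) :
    ∫ ω, expNeg (∑' j, h (T j ω)) ∂P
      = expNeg (∫⁻ w, ENNReal.ofReal (1 - expNeg (h w)) ∂ρ) := by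
  set s : ℕ → Set ℝ := fun n => Set.Ici (1 / ((n : ℝ) + 1)) with hs
  have hsm : ∀ n, MeasurableSet (s n) := fun n => measurableSet_Ici
  set f : ℕ → SimpleFunc ℝ ℝ≥0∞ := fun n => (SimpleFunc.eapprox h n).restrict (s n) with hf
  have hfapp : ∀ n x, f n x = (s n).indicator (SimpleFunc.eapprox h n) x := fun n x => by
    rw [hf]; simp only [SimpleFunc.restrict_apply _ (hsm n)]
  have hsmono : Monotone s := fun n m hnm => Set.Ici_subset_Ici.2 (by gcongr)
  have hfmono : Monotone fun n x => f n x := by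
    intro n m hnm x
    simp only [hfapp]
    refine (Set.indicator_le_indicator (SimpleFunc.monotone_eapprox h hnm x)).trans ?_
    exact Set.indicator_le_indicator_of_subset (hsmono hnm) (fun _ => zero_le) x
  have hflim : ∀ x, 0 ≤ x → Tendsto (fun n => f n x) atTop (𝓝 (h x)) := by
    intro x hx
    rcases hx.eq_or_lt with rfl | hx
    · have : ∀ n, f n 0 = 0 := fun n => by
        rw [hfapp, Set.indicator_of_notMem]
        simp only [hs, Set.mem_Ici, not_le]; positivity
      simp [this, h0]
    · have h1 : Tendsto (fun n => SimpleFunc.eapprox h n x) atTop (𝓝 (h x)) := by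
        rw [← SimpleFunc.iSup_eapprox_apply hh x]
        exact tendsto_atTop_iSup fun n m hnm => SimpleFunc.monotone_eapprox h hnm x
      refine h1.congr' ?_
      have h2 := tendsto_one_div_add_atTop_nhds_zero_nat (𝕜 := ℝ)
      filter_upwards [h2.eventually (gt_mem_nhds hx)] with n hn
      rw [hfapp, Set.indicator_of_mem]
      exact hn.le
  have hne : ∀ n c, c ≠ 0 → (f n) ⁻¹' {c} ⊆ s n := by
    intro n c hc x hx
    by_contra hxs
    have : f n x = 0 := by rw [hfapp, Set.indicator_of_notMem hxs]
    simp only [Set.mem_preimage, Set.mem_singleton_iff] at hx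
    exact hc (hx ▸ this)
  have key : ∀ n, ∫ ω, expNeg (∑' j, f n (T j ω)) ∂P
      = expNeg (∫⁻ w, ENNReal.ofReal (1 - expNeg (f n w)) ∂ρ) := by
    intro n
    refine hT.laplace_simpleFunc (f n) (fun c hc => ?_) (fun c hc x hx => ?_)
    · exact (measure_mono (hne n c hc)).trans_lt (hρ.measure_Ici_lt_top (by positivity))
    · have := hne n c hc hx
      simp only [hs, Set.mem_Ici] at this
      exact lt_of_lt_of_le (by positivity) this
  have hsum : ∀ (g : ℝ → ℝ≥0∞), Measurable g → ∀ ω,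
      ∑' j, g (T j ω) = ∫⁻ x, g x ∂(Measure.sum fun j => Measure.dirac (T j ω)) := by
    intro g hg ω
    rw [lintegral_sum_measure]
    simp_rw [lintegral_dirac' _ hg]
  have hL : Tendsto (fun n => ∫ ω, expNeg (∑' j, f n (T j ω)) ∂P) atTop
      (𝓝 (∫ ω, expNeg (∑' j, h (T j ω)) ∂P)) := by
    refine tendsto_integral_of_dominated_convergence (fun _ => 1) (fun n => ?_)
      (integrable_const _) (fun n => ae_of_all _ fun ω => ?_) (ae_of_all _ fun ω => ?_)
    · exact (continuous_expNeg.measurable.comp (Measurable.tsum fun j =>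
        (f n).measurable.comp (hT.measurable j))).aestronglyMeasurable
    · rw [Real.norm_of_nonneg (expNeg_nonneg _)]
      exact expNeg_le_one _
    · refine (continuous_expNeg.tendsto _).comp ?_
      simp_rw [hsum _ (f _).measurable, hsum _ hh]
      refine lintegral_tendsto_of_tendsto_of_monotone (fun n => (f n).measurable.aemeasurable)
        (ae_of_all _ fun x n m hnm => hfmono hnm x) ?_
      rw [Measure.ae_sum_iff]
      intro j
      rw [ae_dirac_eq]
      exact Filter.eventually_pure.2 (hflim _ (hT.nonneg j ω))
  have hR : Tendsto (fun n => expNeg (∫⁻ w, ENNReal.ofReal (1 - expNeg (f n w)) ∂ρ)) atTop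
      (𝓝 (expNeg (∫⁻ w, ENNReal.ofReal (1 - expNeg (h w)) ∂ρ))) := by
    refine (continuous_expNeg.tendsto _).comp ?_
    refine lintegral_tendsto_of_tendsto_of_monotone (fun n => ?_) (ae_of_all _ fun x n m hnm => ?_)
      ?_
    · exact ((continuous_expNeg.measurable.comp
        (f n).measurable).const_sub 1).ennreal_ofReal.aemeasurable
    · exact ENNReal.ofReal_le_ofReal (sub_le_sub_left (expNeg_antitone (hfmono hnm x)) _)
    · have : ∀ᵐ x ∂ρ, 0 < x := by
        rw [ae_iff]; simpa [Set.Iic] using hρ.carried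
      filter_upwards [this] with x hx
      exact (ENNReal.continuous_ofReal.tendsto _).comp (((continuous_expNeg.tendsto _).comp
        (hflim x hx.le)).const_sub 1)
  simp_rw [key] at hL
  exact tendsto_nhds_unique hL hR

/-! ### Conditional laws -/

/-- A regular version of the conditional probabilities of `Y` given a σ-algebra, which depends on
`ω` only through `X ω`, is a conditional law of `Y` given `X`. -/
theorem hasCondDistrib_of_condExp {Ω 𝓧 𝓨 : Type*} {m mΩ : MeasurableSpace Ω}
    [MeasurableSpace 𝓧] [MeasurableSpace 𝓨] {P : Measure Ω} [IsProbabilityMeasure P]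
    (hm : m ≤ mΩ) {X : Ω → 𝓧} (hX : Measurable[m] X) {Y : Ω → 𝓨} (hY : Measurable Y)
    (κ : Kernel 𝓧 𝓨) [IsMarkovKernel κ]
    (h : ∀ C, MeasurableSet C → P⟦Y ⁻¹' C | m⟧ =ᵐ[P] fun ω => (κ (X ω)).real C) :
    HasCondDistrib Y X κ P := by
  have hX' : Measurable X := hX.mono hm le_rfl
  refine ⟨(hX'.prodMk hY).aemeasurable, ?_⟩
  have := Measure.isProbabilityMeasure_map (μ := P) (hX'.prodMk hY).aemeasurable
  refine Measure.ext_prod fun {s t} hs ht => ?_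
  rw [Measure.map_apply (hX'.prodMk hY) (hs.prod ht), Measure.compProd_apply_prod hs ht,
    setLIntegral_map hs (Kernel.measurable_coe κ ht) hX']
  have hYt : MeasurableSet (Y ⁻¹' t) := hY ht
  have h1 : ∫ ω in X ⁻¹' s, (P⟦Y ⁻¹' t | m⟧) ω ∂P = ∫ ω in X ⁻¹' s, (κ (X ω)).real t ∂P :=
    integral_congr_ae (ae_restrict_of_ae (h t ht))
  rw [setIntegral_condExp hm ((integrable_const 1).indicator hYt) (hX hs),
    integral_indicator hYt, setIntegral_const, smul_eq_mul, mul_one, measureReal_def,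
    Measure.restrict_apply hYt] at h1
  have h2 : ∫⁻ ω in X ⁻¹' s, (κ (X ω)) t ∂P
      = ENNReal.ofReal (∫ ω in X ⁻¹' s, (κ (X ω)).real t ∂P) := by
    rw [ofReal_integral_eq_lintegral_ofReal]
    · simp [ofReal_measureReal]
    · refine Integrable.of_bound (C := 1)
        (((Kernel.measurable_coe κ ht).comp hX').ennreal_toReal).aestronglyMeasurable
        (ae_of_all _ fun ω => ?_)
      rw [Real.norm_of_nonneg measureReal_nonneg]
      exact measureReal_le_one
    · exact ae_of_all _ fun ω => measureReal_nonneg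
  rw [h2, ← h1, ENNReal.ofReal_toReal (measure_ne_top _ _)]
  congr 1
  rw [Set.inter_comm]
  rfl

theorem integral_comp_of_hasCondDistrib {Ω 𝓧 𝓨 E : Type*} {mΩ : MeasurableSpace Ω}
    [MeasurableSpace 𝓧] [MeasurableSpace 𝓨] {P : Measure Ω} [IsProbabilityMeasure P]
    [NormedAddCommGroup E] [NormedSpace ℝ E]
    {X : Ω → 𝓧} {Y : Ω → 𝓨} {κ : Kernel 𝓧 𝓨} [IsMarkovKernel κ]
    (h : HasCondDistrib Y X κ P) {f : 𝓧 × 𝓨 → E} (hf : StronglyMeasurable f) {C : ℝ}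
    (hb : ∀ p, ‖f p‖ ≤ C) :
    ∫ ω, f (X ω, Y ω) ∂P = ∫ ω, ∫ y, f (X ω, y) ∂κ (X ω) ∂P := by
  have hX := h.aemeasurable_fst
  have : IsProbabilityMeasure (P.map X) := Measure.isProbabilityMeasure_map hX
  rw [← integral_map (φ := fun ω => (X ω, Y ω)) h.aemeasurable hf.aestronglyMeasurable, h.map_eq,
    Measure.integral_compProd (Integrable.of_bound hf.aestronglyMeasurable C (ae_of_all _ hb)),
    integral_map hX hf.integral_kernel_prod_right'.aestronglyMeasurable]

/-- The Markov kernel `S ↦ N(0, S)`. -/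
def gaussianVec (n : ℕ) : Kernel (Matrix (Fin n) (Fin n) ℝ) (EuclideanSpace ℝ (Fin n)) where
  toFun S := multivariateGaussian 0 S
  measurable' := measurable_multivariateGaussian

instance {n : ℕ} : IsMarkovKernel (gaussianVec n) :=
  ⟨fun S => by
    change IsProbabilityMeasure (multivariateGaussian 0 S)
    infer_instance⟩

/-- The Laplace transform at `w` of `Q ζ`, where `ζ ∼ N(0, S)`. -/
def gaussianLaplace {n : ℕ} (Q : EuclideanSpace ℝ (Fin n) → ℝ) (S : Matrix (Fin n) (Fin n) ℝ)
    (w : ℝ) : ℝ :=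
  ∫ z, Real.exp (-(w * Q z)) ∂(multivariateGaussian 0 S)

section
variable {n : ℕ} {Q : EuclideanSpace ℝ (Fin n) → ℝ}

theorem measurable_gaussianLaplace (hQ : Measurable Q) :
    Measurable fun p : Matrix (Fin n) (Fin n) ℝ × ℝ => gaussianLaplace Q p.1 p.2 := by
  have h : StronglyMeasurable
      fun q : (Matrix (Fin n) (Fin n) ℝ × ℝ) × EuclideanSpace ℝ (Fin n) =>
        Real.exp (-(q.1.2 * Q q.2)) := by
    refine Measurable.stronglyMeasurable ?_
    have : Measurable fun q : (Matrix (Fin n) (Fin n) ℝ × ℝ) × EuclideanSpace ℝ (Fin n) =>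
      Q q.2 := hQ.comp measurable_snd
    fun_prop
  exact (h.integral_kernel_prod_right' (κ := (gaussianVec n).prodMkRight ℝ)).measurable

theorem gaussianLaplace_zero (S : Matrix (Fin n) (Fin n) ℝ) : gaussianLaplace Q S 0 = 1 := by
  simp [gaussianLaplace]

theorem integrable_exp_neg_mul {w : ℝ} (hw : 0 ≤ w) (hQ : Measurable Q) (hQ0 : ∀ z, 0 ≤ Q z)
    (μ : Measure (EuclideanSpace ℝ (Fin n))) [IsFiniteMeasure μ] :
    Integrable (fun z => Real.exp (-(w * Q z))) μ := by
  refine Integrable.of_bound (C := 1) (by fun_prop) (ae_of_all _ fun z => ?_)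
  rw [Real.norm_of_nonneg (Real.exp_pos _).le, Real.exp_le_one_iff]
  have := mul_nonneg hw (hQ0 z)
  linarith

theorem gaussianLaplace_le_one {w : ℝ} (hw : 0 ≤ w) (hQ0 : ∀ z, 0 ≤ Q z)
    (S : Matrix (Fin n) (Fin n) ℝ) : gaussianLaplace Q S w ≤ 1 := by
  have : gaussianLaplace Q S w ≤ ∫ _, (1 : ℝ) ∂(multivariateGaussian 0 S) := by
    refine integral_mono_of_nonneg (ae_of_all _ fun z => (Real.exp_pos _).le)
      (integrable_const _) (ae_of_all _ fun z => ?_)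
    rw [Real.exp_le_one_iff]
    have := mul_nonneg hw (hQ0 z)
    linarith
  simpa using this

theorem gaussianLaplace_pos {w : ℝ} (hw : 0 ≤ w) (hQ : Measurable Q) (hQ0 : ∀ z, 0 ≤ Q z)
    (S : Matrix (Fin n) (Fin n) ℝ) : 0 < gaussianLaplace Q S w :=
  integral_exp_pos (integrable_exp_neg_mul hw hQ hQ0 _)

theorem expNeg_ofReal_neg_log_gaussianLaplace {w : ℝ} (hw : 0 ≤ w) (hQ : Measurable Q)
    (hQ0 : ∀ z, 0 ≤ Q z) (S : Matrix (Fin n) (Fin n) ℝ) :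
    expNeg (ENNReal.ofReal (-Real.log (gaussianLaplace Q S w))) = gaussianLaplace Q S w := by
  have h1 := gaussianLaplace_pos hw hQ hQ0 S
  have h2 := gaussianLaplace_le_one hw hQ0 S
  rw [expNeg_ofReal (by have := Real.log_nonpos h1.le h2; linarith), neg_neg, Real.exp_log h1]

/-- The Laplace transform of `∑ⱼ Tⱼ Q(ζⱼ)` for Poisson points `T` and marks `ζⱼ ∼ N(0, S)`. -/
def markedLaplace (ρ : Measure ℝ) (Q : EuclideanSpace ℝ (Fin n) → ℝ)
    (S : Matrix (Fin n) (Fin n) ℝ) : ℝ :=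
  expNeg (∫⁻ w, ENNReal.ofReal (1 - gaussianLaplace Q S w) ∂ρ)

theorem tendsto_expNeg_tsum (f : ℕ → ℝ≥0∞) :
    Tendsto (fun J => ∏ j : Fin J, expNeg (f j)) atTop (𝓝 (expNeg (∑' j, f j))) := by
  have := (continuous_expNeg.tendsto _).comp (ENNReal.summable (f := f)).hasSum.tendsto_sum_nat
  refine this.congr fun J => ?_
  rw [Function.comp_apply, expNeg_sum, Finset.prod_range]

/-- Laplace transform of a marked Poisson sum, jointly with a random covariance matrix `G`: the
points `T` are independent of `G`, and given `(G, T)` the marks are iid with law `N(0, G)`. -/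
theorem integral_expNeg_marked {Ω : Type*} [MeasurableSpace Ω] {P : Measure Ω}
    [IsProbabilityMeasure P] {T : ℕ → Ω → ℝ} {ρ : Measure ℝ} (hT : IsPoissonPoints P T ρ)
    (hρ : IsLevyMeasure ρ) {G : Ω → Matrix (Fin n) (Fin n) ℝ} (hG : Measurable G)
    {ζ : ℕ → Ω → EuclideanSpace ℝ (Fin n)} (hζ : ∀ j, Measurable (ζ j))
    (hind : IndepFun (fun ω j => T j ω) G P)
    (hcond : ∀ J : ℕ, HasCondDistrib (fun ω (j : Fin J) => ζ j ω) (fun ω => (G ω, fun j => T j ω))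
      ((gaussianKernel n J).prodMkRight (ℕ → ℝ)) P)
    (hQ : Measurable Q) (hQ0 : ∀ z, 0 ≤ Q z) {F : Matrix (Fin n) (Fin n) ℝ → ℝ}
    (hF : Measurable F) (hF1 : ∀ S, |F S| ≤ 1) :
    ∫ ω, F (G ω) * expNeg (∑' j, ENNReal.ofReal (T j ω * Q (ζ j ω))) ∂P
      = ∫ ω, F (G ω) * markedLaplace ρ Q (G ω) ∂P := by
  have hTm : Measurable fun ω j => T j ω := measurable_pi_lambda _ hT.measurable
  obtain ⟨h, hh⟩ : ∃ h : Matrix (Fin n) (Fin n) ℝ → ℝ → ℝ≥0∞,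
    h = fun S w => ENNReal.ofReal (-Real.log (gaussianLaplace Q S w)) := ⟨_, rfl⟩
  have hhm : Measurable fun p : Matrix (Fin n) (Fin n) ℝ × ℝ => h p.1 p.2 := by
    rw [hh]
    exact ((measurable_gaussianLaplace hQ).log.neg).ennreal_ofReal
  have hprod1 : ∀ (J : ℕ) (f : Fin J → ℝ≥0∞), |∏ j, expNeg (f j)| ≤ 1 := by
    intro J f
    rw [abs_of_nonneg (Finset.prod_nonneg fun j _ => expNeg_nonneg _)]
    exact Finset.prod_le_one (fun j _ => expNeg_nonneg _) fun j _ => expNeg_le_one _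
  -- finitely many marks are integrated out
  have step1 : ∀ J : ℕ, ∫ ω, F (G ω) * ∏ j : Fin J, expNeg (ENNReal.ofReal (T j ω * Q (ζ j ω))) ∂P
      = ∫ ω, F (G ω) * ∏ j : Fin J, expNeg (h (G ω) (T j ω)) ∂P := by
    intro J
    let f : (Matrix (Fin n) (Fin n) ℝ × (ℕ → ℝ)) × (Fin J → EuclideanSpace ℝ (Fin n)) → ℝ :=
      fun p => F p.1.1 * ∏ j : Fin J, expNeg (ENNReal.ofReal (p.1.2 j * Q (p.2 j)))
    have hfm : Measurable f := by
      refine (hF.comp (measurable_fst.comp measurable_fst)).mul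
        (Finset.measurable_fun_prod _ fun j _ => continuous_expNeg.measurable.comp
          (Measurable.ennreal_ofReal (Measurable.mul ?_ ?_)))
      · exact (measurable_pi_apply _).comp (measurable_snd.comp measurable_fst)
      · exact hQ.comp ((measurable_pi_apply j).comp measurable_snd)
    have := integral_comp_of_hasCondDistrib (hcond J) hfm.stronglyMeasurable (C := 1) (fun p => by
      rw [Real.norm_eq_abs, abs_mul]
      exact mul_le_one₀ (hF1 _) (abs_nonneg _) (hprod1 _ _))
    refine this.trans (integral_congr_ae (ae_of_all _ fun ω => ?_))
    simp only [f]
    rw [integral_const_mul]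
    congr 1
    change ∫ y, ∏ j : Fin J, expNeg (ENNReal.ofReal (T j ω * Q (y j)))
      ∂(Measure.pi fun _ : Fin J => multivariateGaussian 0 (G ω)) = _
    rw [integral_fintype_prod_eq_prod (𝕜 := ℝ)
      (fun (j : Fin J) z => expNeg (ENNReal.ofReal (T j ω * Q z)))]
    refine Finset.prod_congr rfl fun j _ => ?_
    rw [hh, expNeg_ofReal_neg_log_gaussianLaplace (hT.nonneg j ω) hQ hQ0, gaussianLaplace]
    refine integral_congr_ae (ae_of_all _ fun z => ?_)
    exact expNeg_ofReal (mul_nonneg (hT.nonneg j ω) (hQ0 _))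
  have hF1' : ∀ (S) (r : ℝ), |r| ≤ 1 → ‖F S * r‖ ≤ 1 := fun S r hr => by
    rw [Real.norm_eq_abs, abs_mul]
    exact mul_le_one₀ (hF1 _) (abs_nonneg _) hr
  have step2 : ∫ ω, F (G ω) * expNeg (∑' j, ENNReal.ofReal (T j ω * Q (ζ j ω))) ∂P
      = ∫ ω, F (G ω) * expNeg (∑' j, h (G ω) (T j ω)) ∂P := by
    have l1 : Tendsto (fun J : ℕ => ∫ ω, F (G ω) *
        ∏ j : Fin J, expNeg (ENNReal.ofReal (T j ω * Q (ζ j ω))) ∂P) atTop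
        (𝓝 (∫ ω, F (G ω) * expNeg (∑' j, ENNReal.ofReal (T j ω * Q (ζ j ω))) ∂P)) := by
      refine tendsto_integral_of_dominated_convergence (fun _ => 1) (fun J => ?_)
        (integrable_const _) (fun J => ae_of_all _ fun ω => hF1' _ _ (hprod1 _ _))
        (ae_of_all _ fun ω => ?_)
      · have hm : ∀ j : Fin J, Measurable fun ω =>
            expNeg (ENNReal.ofReal (T j ω * Q (ζ j ω))) := fun j =>
          continuous_expNeg.measurable.comp
            (((hT.measurable j).mul (hQ.comp (hζ j))).ennreal_ofReal)
        exact ((hF.comp hG).mul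
          (Finset.measurable_fun_prod _ fun j _ => hm j)).aestronglyMeasurable
      · exact (tendsto_expNeg_tsum fun j => ENNReal.ofReal (T j ω * Q (ζ j ω))).const_mul _
    have l2 : Tendsto (fun J : ℕ => ∫ ω, F (G ω) *
        ∏ j : Fin J, expNeg (h (G ω) (T j ω)) ∂P) atTop
        (𝓝 (∫ ω, F (G ω) * expNeg (∑' j, h (G ω) (T j ω)) ∂P)) := by
      refine tendsto_integral_of_dominated_convergence (fun _ => 1) (fun J => ?_)
        (integrable_const _) (fun J => ae_of_all _ fun ω => hF1' _ _ (hprod1 _ _))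
        (ae_of_all _ fun ω => ?_)
      · have hm : ∀ j : Fin J, Measurable fun ω => expNeg (h (G ω) (T j ω)) := fun j =>
          continuous_expNeg.measurable.comp (hhm.comp (hG.prodMk (hT.measurable j)))
        exact ((hF.comp hG).mul
          (Finset.measurable_fun_prod _ fun j _ => hm j)).aestronglyMeasurable
      · exact (tendsto_expNeg_tsum fun j => h (G ω) (T j ω)).const_mul _
    simp_rw [step1] at l1
    exact tendsto_nhds_unique l1 l2
  rw [step2]
  -- the points are integrated out, for a fixed covariance matrix
  have hprod := (indepFun_iff_map_prod_eq_prod_map_map hG.aemeasurable hTm.aemeasurable).1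
    hind.symm
  have hgm : Measurable fun p : Matrix (Fin n) (Fin n) ℝ × (ℕ → ℝ) =>
      F p.1 * expNeg (∑' j, h p.1 (p.2 j)) := by
    refine (hF.comp measurable_fst).mul (continuous_expNeg.measurable.comp
      (Measurable.tsum fun j => ?_))
    exact hhm.comp (measurable_fst.prodMk ((measurable_pi_apply j).comp measurable_snd))
  have := Measure.isProbabilityMeasure_map (μ := P) hG.aemeasurable
  have := Measure.isProbabilityMeasure_map (μ := P) hTm.aemeasurable
  obtain ⟨g, hg⟩ : ∃ g : Matrix (Fin n) (Fin n) ℝ × (ℕ → ℝ) → ℝ,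
    g = fun p => F p.1 * expNeg (∑' j, h p.1 (p.2 j)) := ⟨_, rfl⟩
  rw [← hg] at hgm
  have hg1 : ∀ p, ‖g p‖ ≤ 1 := fun p => by
    rw [hg]
    exact hF1' _ _ (by rw [abs_of_nonneg (expNeg_nonneg _)]; exact expNeg_le_one _)
  have e1 : ∫ ω, F (G ω) * expNeg (∑' j, h (G ω) (T j ω)) ∂P
      = ∫ p, g p ∂((P.map G).prod (P.map fun ω j => T j ω)) := by
    rw [← hprod, integral_map (hG.prodMk hTm).aemeasurable hgm.aestronglyMeasurable, hg]
  rw [e1, integral_prod _ (Integrable.of_bound hgm.aestronglyMeasurable 1 (ae_of_all _ hg1)),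
    integral_map hG.aemeasurable hgm.stronglyMeasurable.integral_prod_right'.aestronglyMeasurable]
  refine integral_congr_ae (ae_of_all _ fun ω => ?_)
  simp only [hg]
  rw [integral_const_mul]
  congr 1
  have hhS : Measurable (h (G ω)) := hhm.comp (measurable_const.prodMk measurable_id)
  have hm : Measurable fun a : ℕ → ℝ => expNeg (∑' j, h (G ω) (a j)) :=
    continuous_expNeg.measurable.comp
      (Measurable.tsum fun j => hhS.comp (measurable_pi_apply j))
  rw [integral_map hTm.aemeasurable hm.aestronglyMeasurable,
    hT.laplace hρ hhS (by simp [hh, gaussianLaplace_zero]), markedLaplace]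
  congr 1
  have hpos : ∀ᵐ x ∂ρ, 0 < x := by
    rw [ae_iff]; simpa [Set.Iic] using hρ.carried
  refine lintegral_congr_ae ?_
  filter_upwards [hpos] with w hw
  rw [hh, expNeg_ofReal_neg_log_gaussianLaplace hw.le hQ hQ0]

end

/-! ### One step of the kernel recursion -/

/-- The linear functional `z ↦ ∑ᵢ vᵢ φ(zᵢ)` of the activations. -/
def readout {n : ℕ} (φ : ℝ → ℝ) (v z : EuclideanSpace ℝ (Fin n)) : ℝ := ∑ i, v i * φ (z i)

/-- The quadratic form `z ↦ (σv² / 2) ∑ₖ (∑ᵢ tₖᵢ φ(zᵢ))²`. A node with variance `λ` and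
pre-activations `z` contributes the factor `exp (-λ Q(z))` to the characteristic function at `t` of
the next layer. -/
def quadAct {m n : ℕ} (σv : ℝ≥0) (φ : ℝ → ℝ) (t : Fin m → EuclideanSpace ℝ (Fin n))
    (z : EuclideanSpace ℝ (Fin n)) : ℝ :=
  (σv : ℝ) ^ 2 / 2 * ∑ k, readout φ (t k) z ^ 2

/-- The contribution of the biases to the exponent of the characteristic function at `t`. -/
def biasQuad {m n : ℕ} (σb : ℝ≥0) (t : Fin m → EuclideanSpace ℝ (Fin n)) : ℝ :=
  (σb : ℝ) ^ 2 / 2 * ∑ k, (∑ i, t k i) ^ 2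

theorem continuous_readout {n : ℕ} {φ : ℝ → ℝ} (hφ : Continuous φ) (v : EuclideanSpace ℝ (Fin n)) :
    Continuous (readout φ v) := by
  unfold readout; fun_prop

theorem continuous_quadAct {m n : ℕ} (σv : ℝ≥0) {φ : ℝ → ℝ} (hφ : Continuous φ)
    (t : Fin m → EuclideanSpace ℝ (Fin n)) : Continuous (quadAct σv φ t) := by
  have := fun k => continuous_readout hφ (t k)
  unfold quadAct; fun_prop

theorem quadAct_nonneg {m n : ℕ} (σv : ℝ≥0) (φ : ℝ → ℝ) (t : Fin m → EuclideanSpace ℝ (Fin n))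
    (z : EuclideanSpace ℝ (Fin n)) : 0 ≤ quadAct σv φ t z := by
  unfold quadAct; positivity

theorem sq_readout {n : ℕ} (φ : ℝ → ℝ) (v z : EuclideanSpace ℝ (Fin n)) :
    readout φ v z ^ 2 = ∑ i, ∑ j, v i * v j * (φ (z i) * φ (z j)) := by
  rw [sq, readout, Finset.sum_mul_sum]
  refine Finset.sum_congr rfl fun i _ => Finset.sum_congr rfl fun j _ => by ring

section
variable {n : ℕ} {φ : ℝ → ℝ}

theorem integrable_sq_readout (hφ : Continuous φ)
    (henv : ∃ A B C : ℝ, 0 < A ∧ 0 < B ∧ 0 < C ∧ ∀ z : ℝ, |φ z| ≤ A + B * |z| ^ C)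
    (S : Matrix (Fin n) (Fin n) ℝ) (v : EuclideanSpace ℝ (Fin n)) :
    Integrable (fun z => readout φ v z ^ 2) (multivariateGaussian 0 S) := by
  simp_rw [sq_readout]
  exact integrable_finsetSum _ fun i _ => integrable_finsetSum _ fun j _ =>
    (integrable_mul_activation hφ henv S i j).const_mul _

theorem integral_sq_readout (hφ : Continuous φ)
    (henv : ∃ A B C : ℝ, 0 < A ∧ 0 < B ∧ 0 < C ∧ ∀ z : ℝ, |φ z| ≤ A + B * |z| ^ C)
    (S : Matrix (Fin n) (Fin n) ℝ) (v : EuclideanSpace ℝ (Fin n)) :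
    ∫ z, readout φ v z ^ 2 ∂(multivariateGaussian 0 S)
      = ∑ i, ∑ j, v i * v j * ∫ z : EuclideanSpace ℝ (Fin n), φ (z i) * φ (z j)
          ∂(multivariateGaussian 0 S) := by
  simp_rw [sq_readout]
  have h := fun i j => (integrable_mul_activation hφ henv S i j).const_mul (v i * v j)
  rw [integral_finsetSum _ fun i _ => integrable_finsetSum _ fun j _ => h i j]
  refine Finset.sum_congr rfl fun i _ => ?_
  rw [integral_finsetSum _ fun j _ => h i j]
  simp_rw [integral_const_mul]

theorem integrable_quadAct {m : ℕ} (σv : ℝ≥0) (hφ : Continuous φ)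
    (henv : ∃ A B C : ℝ, 0 < A ∧ 0 < B ∧ 0 < C ∧ ∀ z : ℝ, |φ z| ≤ A + B * |z| ^ C)
    (S : Matrix (Fin n) (Fin n) ℝ) (t : Fin m → EuclideanSpace ℝ (Fin n)) :
    Integrable (quadAct σv φ t) (multivariateGaussian 0 S) := by
  unfold quadAct
  exact (integrable_finsetSum _ fun k _ => integrable_sq_readout hφ henv S (t k)).const_mul _

theorem integral_quadAct {m : ℕ} (σv : ℝ≥0) (hφ : Continuous φ)
    (henv : ∃ A B C : ℝ, 0 < A ∧ 0 < B ∧ 0 < C ∧ ∀ z : ℝ, |φ z| ≤ A + B * |z| ^ C)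
    (S : Matrix (Fin n) (Fin n) ℝ) (t : Fin m → EuclideanSpace ℝ (Fin n)) :
    ∫ z, quadAct σv φ t z ∂(multivariateGaussian 0 S)
      = (σv : ℝ) ^ 2 / 2 * ∑ k, ∫ z, readout φ (t k) z ^ 2 ∂(multivariateGaussian 0 S) := by
  unfold quadAct
  rw [integral_const_mul, integral_finsetSum _ fun k _ => integrable_sq_readout hφ henv S (t k)]

/-- The moments in the recursion can be computed under the law of the whole vector of inputs. -/
theorem activationMoment_eq {X : Type*} (hφ : Continuous φ) {k : X → X → ℝ} {x : Fin n → X}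
    (hS : (gramMatrix k x).PosSemidef) (i j : Fin n) :
    activationMoment φ k (x i) (x j)
      = ∫ z : EuclideanSpace ℝ (Fin n), φ (z i) * φ (z j)
          ∂(multivariateGaussian 0 (gramMatrix k x)) := by
  have h1 : gramMatrix k ![x i, x j] = (gramMatrix k x).submatrix ![i, j] ![i, j] := by
    ext r s
    fin_cases r <;> fin_cases s <;> rfl
  have h2 : ∀ (f : Fin 2 → Fin n), Measurable (fun z : EuclideanSpace ℝ (Fin n) =>
      (WithLp.toLp 2 fun i => z (f i) : EuclideanSpace ℝ (Fin 2))) := fun f => by fun_prop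
  rw [activationMoment, h1, ← map_multivariateGaussian_comp hS,
    integral_map (h2 _).aemeasurable (by fun_prop)]
  rfl

section
variable {X : Type*} {σb σv : ℝ≥0} {a : ℝ} {k k' : X → X → ℝ} {x : Fin n → X}
    {T : ℕ → ℝ} {z : ℕ → X → ℝ}

theorem dotProduct_gramMatrix_mulVec (k : X → X → ℝ) (x : Fin n → X) (v : Fin n → ℝ) :
    v ⬝ᵥ (gramMatrix k x).mulVec v = ∑ i, ∑ j, v i * v j * k (x i) (x j) := by
  simp only [dotProduct, Matrix.mulVec, gramMatrix, Matrix.of_apply, Finset.mul_sum]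
  refine Finset.sum_congr rfl fun i _ => Finset.sum_congr rfl fun j _ => by ring

/-- The recursion in terms of quadratic forms. -/
theorem hasSum_quadForm (hφ : Continuous φ)
    (henv : ∃ A B C : ℝ, 0 < A ∧ 0 < B ∧ 0 < C ∧ ∀ z : ℝ, |φ z| ≤ A + B * |z| ^ C)
    (hS : (gramMatrix k x).PosSemidef)
    (hrec : ∀ i j, HasSum (fun r => (σv : ℝ) ^ 2 * (T r * φ (z r (x i)) * φ (z r (x j))))
      (k' (x i) (x j) - (σb : ℝ) ^ 2
        - (σv : ℝ) ^ 2 * (a * activationMoment φ k (x i) (x j))))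
    (v : EuclideanSpace ℝ (Fin n)) :
    HasSum (fun r => (σv : ℝ) ^ 2 * (T r * readout φ v (WithLp.toLp 2 fun i => z r (x i)) ^ 2))
      ((v : Fin n → ℝ) ⬝ᵥ (gramMatrix k' x).mulVec v - (σb : ℝ) ^ 2 * (∑ i, v i) ^ 2
        - (σv : ℝ) ^ 2 *
          (a * ∫ y, readout φ v y ^ 2 ∂(multivariateGaussian 0 (gramMatrix k x)))) := by
  have h := hasSum_sum (s := Finset.univ) fun i _ => hasSum_sum (s := Finset.univ) fun j _ =>
    (hrec i j).mul_left (v i * v j)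
  have e1 : (fun r => (σv : ℝ) ^ 2 * (T r *
      readout φ v (WithLp.toLp 2 fun i => z r (x i)) ^ 2))
      = fun r => ∑ i, ∑ j, v i * v j * ((σv : ℝ) ^ 2 * (T r * φ (z r (x i)) * φ (z r (x j)))) := by
    ext r
    rw [sq_readout]
    simp only [Finset.mul_sum]
    refine Finset.sum_congr rfl fun i _ => Finset.sum_congr rfl fun j _ => by ring
  rw [e1]
  refine Eq.mpr (congrArg (fun s => HasSum _ s) ?_) h
  · rw [integral_sq_readout hφ henv, dotProduct_gramMatrix_mulVec, sq (∑ i, v i),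
      Finset.sum_mul_sum]
    simp only [Finset.mul_sum, ← Finset.sum_sub_distrib, activationMoment_eq hφ hS]
    refine Finset.sum_congr rfl fun i _ => Finset.sum_congr rfl fun j _ => by ring

/-- The right-hand side of the recursion is a sum of squares, hence positive semidefinite. -/
theorem posSemidef_of_recursion (hφ : Continuous φ)
    (henv : ∃ A B C : ℝ, 0 < A ∧ 0 < B ∧ 0 < C ∧ ∀ z : ℝ, |φ z| ≤ A + B * |z| ^ C)
    (ha : 0 ≤ a) (hT : ∀ r, 0 ≤ T r) (hS : (gramMatrix k x).PosSemidef)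
    (hrec : ∀ i j, HasSum (fun r => (σv : ℝ) ^ 2 * (T r * φ (z r (x i)) * φ (z r (x j))))
      (k' (x i) (x j) - (σb : ℝ) ^ 2
        - (σv : ℝ) ^ 2 * (a * activationMoment φ k (x i) (x j)))) :
    (gramMatrix k' x).PosSemidef := by
  refine Matrix.PosSemidef.of_dotProduct_mulVec_nonneg ?_ fun v => ?_
  · ext i j
    have h1 := hrec i j
    have h2 := hrec j i
    have h3 : (fun r => (σv : ℝ) ^ 2 * (T r * φ (z r (x i)) * φ (z r (x j))))
        = fun r => (σv : ℝ) ^ 2 * (T r * φ (z r (x j)) * φ (z r (x i))) := by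
      ext r; ring
    rw [h3] at h1
    have h4 := h1.unique h2
    rw [activationMoment_eq hφ hS, activationMoment_eq hφ hS] at h4
    simp only [gramMatrix, Matrix.conjTranspose_apply, Matrix.of_apply, star_trivial]
    have h5 : ∫ z : EuclideanSpace ℝ (Fin n), φ (z i) * φ (z j)
          ∂(multivariateGaussian 0 (gramMatrix k x))
        = ∫ z : EuclideanSpace ℝ (Fin n), φ (z j) * φ (z i)
          ∂(multivariateGaussian 0 (gramMatrix k x)) := by
      simp_rw [mul_comm]
    rw [h5] at h4
    linarith
  · have h := (hasSum_quadForm hφ henv hS hrec (WithLp.toLp 2 v)).nonneg fun r =>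
      mul_nonneg (sq_nonneg _) (mul_nonneg (hT r) (sq_nonneg _))
    have h2 : 0 ≤ ∫ y, readout φ (WithLp.toLp 2 v) y ^ 2
        ∂(multivariateGaussian 0 (gramMatrix k x)) := integral_nonneg fun _ => sq_nonneg _
    simp only [star_trivial]
    have h3 : 0 ≤ (σb : ℝ) ^ 2 * (∑ i, (WithLp.toLp 2 v : EuclideanSpace ℝ (Fin n)) i) ^ 2 := by
      positivity
    have h4 : 0 ≤ (σv : ℝ) ^ 2 * (a * ∫ y, readout φ (WithLp.toLp 2 v) y ^ 2
        ∂(multivariateGaussian 0 (gramMatrix k x))) := by positivity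
    have h5 := add_nonneg (add_nonneg h h4) h3
    simpa using h5

/-- The characteristic function of `N(0, Σ)`, for the covariance matrix `Σ` of the next layer,
splits into the contributions of the biases, of the drift and of the Poisson points. -/
theorem exp_neg_quadForm_of_recursion {m : ℕ} (hφ : Continuous φ)
    (henv : ∃ A B C : ℝ, 0 < A ∧ 0 < B ∧ 0 < C ∧ ∀ z : ℝ, |φ z| ≤ A + B * |z| ^ C)
    (hT : ∀ r, 0 ≤ T r) (hS : (gramMatrix k x).PosSemidef)
    (hrec : ∀ i j, HasSum (fun r => (σv : ℝ) ^ 2 * (T r * φ (z r (x i)) * φ (z r (x j))))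
      (k' (x i) (x j) - (σb : ℝ) ^ 2
        - (σv : ℝ) ^ 2 * (a * activationMoment φ k (x i) (x j))))
    (t : Fin m → EuclideanSpace ℝ (Fin n)) :
    Real.exp (-(∑ l, (t l : Fin n → ℝ) ⬝ᵥ (gramMatrix k' x).mulVec (t l)) / 2)
      = Real.exp (-biasQuad σb t) *
        (Real.exp (-(a * ∫ y, quadAct σv φ t y ∂(multivariateGaussian 0 (gramMatrix k x)))) *
          expNeg (∑' r, ENNReal.ofReal (T r *
            quadAct σv φ t (WithLp.toLp 2 fun i => z r (x i))))) := by
  have h := (hasSum_sum (s := Finset.univ) fun l _ =>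
    hasSum_quadForm hφ henv hS hrec (t l)).mul_left (1 / 2)
  have h1 : (fun r => 1 / 2 * ∑ l, (σv : ℝ) ^ 2 *
      (T r * readout φ (t l) (WithLp.toLp 2 fun i => z r (x i)) ^ 2))
      = fun r => T r * quadAct σv φ t (WithLp.toLp 2 fun i => z r (x i)) := by
    ext r
    simp only [quadAct, Finset.mul_sum]
    refine Finset.sum_congr rfl fun l _ => by ring
  rw [h1] at h
  have h0 : ∀ r, 0 ≤ T r * quadAct σv φ t (WithLp.toLp 2 fun i => z r (x i)) := fun r =>
    mul_nonneg (hT r) (quadAct_nonneg _ _ _ _)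
  rw [← ENNReal.ofReal_tsum_of_nonneg h0 h.summable, expNeg_ofReal (tsum_nonneg h0), h.tsum_eq,
    ← Real.exp_add, ← Real.exp_add, integral_quadAct σv hφ henv, biasQuad]
  congr 1
  simp only [Finset.sum_sub_distrib, ← Finset.mul_sum]
  ring

end
end

/-! ### Mixtures of Gaussian laws -/

theorem measurable_gramMatrix {X : Type*} {n : ℕ} (x : Fin n → X) :
    Measurable fun k : X → X → ℝ => gramMatrix k x := by
  refine measurable_pi_lambda (fun k : X → X → ℝ => (gramMatrix k x : Fin n → Fin n → ℝ))
    fun i => measurable_pi_lambda _ fun j => ?_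
  exact (measurable_pi_apply (x j)).comp (measurable_pi_apply (X := fun _ : X => X → ℝ) (x i))

theorem measurable_iidGaussian {X : Type*} {n : ℕ} (x : Fin n → X) (m : ℕ) :
    Measurable fun k : X → X → ℝ => iidGaussian k x m :=
  (gaussianKernel n m).measurable.comp (measurable_gramMatrix x)

instance {X : Type*} {n : ℕ} (k : X → X → ℝ) (x : Fin n → X) (m : ℕ) :
    IsProbabilityMeasure (iidGaussian k x m) := by
  unfold iidGaussian; infer_instance

theorem measurable_activationMoment {X : Type*} {φ : ℝ → ℝ} (hφ : Continuous φ) (x x' : X) :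
    Measurable fun k : X → X → ℝ => activationMoment φ k x x' := by
  have h : StronglyMeasurable fun u : EuclideanSpace ℝ (Fin 2) => φ (u 0) * φ (u 1) :=
    (by fun_prop : Continuous fun u : EuclideanSpace ℝ (Fin 2) =>
      φ (u 0) * φ (u 1)).stronglyMeasurable
  exact (h.integral_kernel (κ := gaussianVec 2)).measurable.comp (measurable_gramMatrix ![x, x'])

section
variable {Ω X : Type*} [MeasurableSpace Ω] {P : Measure Ω} [IsProbabilityMeasure P]
  {K : Ω → X → X → ℝ} {n : ℕ}

theorem isProbabilityMeasure_bind_iidGaussian (hK : Measurable K) (x : Fin n → X) (m : ℕ) :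
    IsProbabilityMeasure (P.bind fun ω => iidGaussian (K ω) x m) := by
  refine isProbabilityMeasure_bind ((measurable_iidGaussian x m).comp hK).aemeasurable ?_
  exact ae_of_all _ fun ω => (inferInstance : IsProbabilityMeasure (iidGaussian (K ω) x m))

theorem integral_bind_iidGaussian (hK : Measurable K) (x : Fin n → X) (m : ℕ)
    {E : Type*} [NormedAddCommGroup E] [NormedSpace ℝ E]
    {f : (Fin m → EuclideanSpace ℝ (Fin n)) → E} (hf : StronglyMeasurable f) {C : ℝ}
    (hb : ∀ y, ‖f y‖ ≤ C) :
    ∫ y, f y ∂(P.bind fun ω => iidGaussian (K ω) x m)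
      = ∫ ω, ∫ y, f y ∂(iidGaussian (K ω) x m) ∂P := by
  let κ : Kernel Ω (Fin m → EuclideanSpace ℝ (Fin n)) :=
    (gaussianKernel n m).comap _ ((measurable_gramMatrix x).comp hK)
  have h1 : P.bind (fun ω => iidGaussian (K ω) x m) = (P ⊗ₘ κ).map Prod.snd := by
    rw [← Measure.snd, Measure.snd_compProd]; rfl
  have h2 : Integrable (fun p : Ω × (Fin m → EuclideanSpace ℝ (Fin n)) => f p.2) (P ⊗ₘ κ) :=
    Integrable.of_bound (hf.comp_measurable measurable_snd).aestronglyMeasurable C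
      (ae_of_all _ fun p => hb _)
  rw [h1, integral_map measurable_snd.aemeasurable hf.aestronglyMeasurable,
    Measure.integral_compProd h2]
  rfl

theorem norm_exp_ofReal_mul_I_le (r : ℝ) : ‖Complex.exp ((r : ℂ) * Complex.I)‖ ≤ 1 :=
  (Complex.norm_exp_ofReal_mul_I r).le

theorem continuous_jointChar {m : ℕ} (t : Fin m → EuclideanSpace ℝ (Fin n)) :
    Continuous fun x : Fin m → EuclideanSpace ℝ (Fin n) =>
      Complex.exp ((∑ k, inner ℝ (x k) (t k) : ℝ) * Complex.I) := by
  fun_prop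

theorem jointCharFun_bind_iidGaussian (hK : Measurable K) (x : Fin n → X) {m : ℕ}
    (hS : ∀ᵐ ω ∂P, (gramMatrix (K ω) x).PosSemidef) (t : Fin m → EuclideanSpace ℝ (Fin n)) :
    jointCharFun (P.bind fun ω => iidGaussian (K ω) x m) t
      = (∫ ω, Real.exp (-(∑ k, (t k : Fin n → ℝ) ⬝ᵥ (gramMatrix (K ω) x).mulVec (t k)) / 2) ∂P
          : ℝ) := by
  rw [jointCharFun, integral_bind_iidGaussian hK x m (continuous_jointChar t).stronglyMeasurable
    (fun y => norm_exp_ofReal_mul_I_le _), ← integral_complex_ofReal]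
  refine integral_congr_ae ?_
  filter_upwards [hS] with ω hω
  exact jointCharFun_pi_multivariateGaussian hω t

end

/-! ### Solutions of the kernel recursion -/

/-- The covariance kernel of the first layer. -/
def inputKernel (d : ℕ) (σb σv : ℝ≥0) (x x' : EuclideanSpace ℝ (Fin d)) : ℝ :=
  (σb : ℝ) ^ 2 + (σv : ℝ) ^ 2 * (inner ℝ x x' / d)

theorem isCovKernel_inputKernel (d : ℕ) (σb σv : ℝ≥0) : IsCovKernel (inputKernel d σb σv) := by
  intro n x
  refine Matrix.PosSemidef.of_dotProduct_mulVec_nonneg ?_ fun v => ?_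
  · ext i j
    simp [gramMatrix, inputKernel, real_inner_comm]
  · rw [star_trivial, dotProduct_gramMatrix_mulVec]
    have h : ∑ i, ∑ j, v i * v j * inputKernel d σb σv (x i) (x j)
        = (σb : ℝ) ^ 2 * (∑ i, v i) ^ 2
          + (σv : ℝ) ^ 2 / d * inner ℝ (∑ i, v i • x i) (∑ i, v i • x i) := by
      simp only [sum_inner, inner_sum, real_inner_smul_left, real_inner_smul_right]
      rw [sq (∑ i, v i), Finset.sum_mul_sum]
      simp only [Finset.mul_sum, ← Finset.sum_add_distrib, inputKernel]
      refine Finset.sum_congr rfl fun i _ => Finset.sum_congr rfl fun j _ => by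
        rw [real_inner_comm]; ring
    rw [h]
    have := real_inner_self_nonneg (x := ∑ i, v i • x i)
    positivity

section
variable {L d : ℕ} {Ω : Type*} [MeasurableSpace Ω] {P : Measure Ω} [IsProbabilityMeasure P]
  {σb σv : ℝ≥0} {φ : ℝ → ℝ} {a : Fin L → ℝ} {ρ : Fin L → Measure ℝ}
  {K : Fin (L + 1) → Ω → EuclideanSpace ℝ (Fin d) → EuclideanSpace ℝ (Fin d) → ℝ}
  {T : Fin L → ℕ → Ω → ℝ} {ζ : Fin L → ℕ → Ω → EuclideanSpace ℝ (Fin d) → ℝ}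

theorem kernelSigma_le_historySigma
    (K : Fin (L + 1) → Ω → EuclideanSpace ℝ (Fin d) → EuclideanSpace ℝ (Fin d) → ℝ)
    (l : Fin (L + 1)) : kernelSigma (K l) ≤ historySigma K l :=
  le_iSup₂_of_le (f := fun i (_ : i ∈ Set.Iic l) => kernelSigma (K i)) l (Set.mem_Iic.2 le_rfl)
    le_rfl

theorem IsKernelRecursion.historySigma_le (h : IsKernelRecursion P σb σv φ a ρ K T ζ)
    (l : Fin (L + 1)) : historySigma K l ≤ ‹MeasurableSpace Ω› :=
  iSup₂_le fun i _ => (h.measurable_K i).comap_le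

theorem IsKernelRecursion.measurable_points (h : IsKernelRecursion P σb σv φ a ρ K T ζ)
    (i : Fin L) : Measurable fun ω j => T i j ω :=
  measurable_pi_lambda _ (h.poisson i).measurable

theorem IsKernelRecursion.ae_recursion (h : IsKernelRecursion P σb σv φ a ρ K T ζ) (i : Fin L)
    {n : ℕ} (x : Fin n → EuclideanSpace ℝ (Fin d)) :
    ∀ᵐ ω ∂P, ∀ r s, HasSum
      (fun j => (σv : ℝ) ^ 2 * (T i j ω * φ (ζ i j ω (x r)) * φ (ζ i j ω (x s))))
      (K i.succ ω (x r) (x s) - (σb : ℝ) ^ 2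
        - (σv : ℝ) ^ 2 * (a i * activationMoment φ (K i.castSucc ω) (x r) (x s))) :=
  ae_all_iff.2 fun r => ae_all_iff.2 fun s => h.recursion i (x r) (x s)

theorem IsKernelRecursion.ae_posSemidef (h : IsKernelRecursion P σb σv φ a ρ K T ζ)
    (hφ : Continuous φ)
    (henv : ∃ A B C : ℝ, 0 < A ∧ 0 < B ∧ 0 < C ∧ ∀ z : ℝ, |φ z| ≤ A + B * |z| ^ C)
    (ha : ∀ i, 0 ≤ a i) {n : ℕ} (x : Fin n → EuclideanSpace ℝ (Fin d)) (l : Fin (L + 1)) :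
    ∀ᵐ ω ∂P, (gramMatrix (K l ω) x).PosSemidef := by
  induction l using Fin.induction with
  | zero =>
    refine ae_of_all _ fun ω => ?_
    have : K 0 ω = inputKernel d σb σv := by
      ext x x'; exact h.init ω x x'
    rw [this]
    exact isCovKernel_inputKernel d σb σv n x
  | succ i ih =>
    filter_upwards [ih, h.ae_recursion i x] with ω h1 h2
    exact posSemidef_of_recursion hφ henv (ha i) (fun r => (h.poisson i).nonneg r ω) h1 h2

theorem IsKernelRecursion.indepFun (h : IsKernelRecursion P σb σv φ a ρ K T ζ) (i : Fin L)
    {𝓖 : Type*} [MeasurableSpace 𝓖] {G : Ω → 𝓖} (hG : Measurable[historySigma K i.castSucc] G) :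
    IndepFun (fun ω j => T i j ω) G P := by
  rw [IndepFun_iff_Indep]
  exact indep_of_indep_of_le_right (h.indep i) hG.comap_le

theorem measurable_gramMatrix_kernelSigma {n : ℕ}
    (K : Fin (L + 1) → Ω → EuclideanSpace ℝ (Fin d) → EuclideanSpace ℝ (Fin d) → ℝ)
    (x : Fin n → EuclideanSpace ℝ (Fin d)) (l : Fin (L + 1)) :
    Measurable[kernelSigma (K l)] fun ω => gramMatrix (K l ω) x :=
  (measurable_gramMatrix x).comp (comap_measurable (K l))

/-- The Gaussian processes at finitely many inputs, given the covariance matrix and the points. -/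
theorem IsKernelRecursion.hasCondDistrib (h : IsKernelRecursion P σb σv φ a ρ K T ζ) (i : Fin L)
    {n : ℕ} (x : Fin n → EuclideanSpace ℝ (Fin d)) (J : ℕ) :
    HasCondDistrib
      (fun ω (j : Fin J) => (WithLp.toLp 2 fun r => ζ i j ω (x r) : EuclideanSpace ℝ (Fin n)))
      (fun ω => (gramMatrix (K i.castSucc ω) x, fun j => T i j ω))
      ((gaussianKernel n J).prodMkRight (ℕ → ℝ)) P := by
  refine hasCondDistrib_of_condExp (m := historySigma K i.castSucc ⊔
    MeasurableSpace.comap (fun ω j => T i j ω) MeasurableSpace.pi) ?_ ?_ ?_ _ ?_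
  · exact sup_le (h.historySigma_le _) (h.measurable_points i).comap_le
  · refine Measurable.prodMk ?_ ?_
    · exact (measurable_gramMatrix_kernelSigma K x i.castSucc).mono
        ((kernelSigma_le_historySigma K _).trans le_sup_left) le_rfl
    · exact (comap_measurable (fun ω j => T i j ω)).mono le_sup_right le_rfl
  · refine measurable_pi_lambda _ fun j => (WithLp.measurable_toLp 2 _).comp
      (measurable_pi_lambda _ fun r => (measurable_pi_apply _).comp (h.measurable_ζ i j))
  · intro C hC
    exact h.gaussian i J n x C hC

/-- The characteristic function of the limit law at layer `i + 2`, in terms of the random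
covariance kernel of layer `i + 1`. -/
theorem IsKernelRecursion.jointCharFun_succ (h : IsKernelRecursion P σb σv φ a ρ K T ζ)
    (hφ : Continuous φ)
    (henv : ∃ A B C : ℝ, 0 < A ∧ 0 < B ∧ 0 < C ∧ ∀ z : ℝ, |φ z| ≤ A + B * |z| ^ C)
    (ha : ∀ i, 0 ≤ a i) (hρ : ∀ i, IsLevyMeasure (ρ i)) (i : Fin L)
    {n : ℕ} (x : Fin n → EuclideanSpace ℝ (Fin d)) {m : ℕ}
    (t : Fin m → EuclideanSpace ℝ (Fin n)) :
    jointCharFun (P.bind fun ω => iidGaussian (K i.succ ω) x m) t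
      = (Real.exp (-biasQuad σb t) * ∫ ω,
          Real.exp (-(a i * ∫ y, quadAct σv φ t y
            ∂(multivariateGaussian 0 (gramMatrix (K i.castSucc ω) x)))) *
          markedLaplace (ρ i) (quadAct σv φ t) (gramMatrix (K i.castSucc ω) x) ∂P : ℝ) := by
  rw [jointCharFun_bind_iidGaussian (h.measurable_K _) x (h.ae_posSemidef hφ henv ha x i.succ)]
  congr 1
  let F : Matrix (Fin n) (Fin n) ℝ → ℝ := fun S =>
    Real.exp (-(a i * ∫ y, quadAct σv φ t y ∂(multivariateGaussian 0 S)))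
  have hF : Measurable F := by
    have := ((continuous_quadAct σv hφ t).stronglyMeasurable.integral_kernel
      (κ := gaussianVec n)).measurable
    exact Real.measurable_exp.comp ((this.const_mul (a i)).neg)
  have hF1 : ∀ S, |F S| ≤ 1 := fun S => by
    rw [abs_of_pos (Real.exp_pos _), Real.exp_le_one_iff]
    have : 0 ≤ ∫ y, quadAct σv φ t y ∂(multivariateGaussian 0 S) :=
      integral_nonneg fun y => quadAct_nonneg σv φ t y
    have := mul_nonneg (ha i) this
    linarith
  have hm : Measurable[historySigma K i.castSucc] fun ω => gramMatrix (K i.castSucc ω) x :=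
    (measurable_gramMatrix_kernelSigma K x i.castSucc).mono
      (kernelSigma_le_historySigma K _) le_rfl
  have key := integral_expNeg_marked (h.poisson i) (hρ i)
    (G := fun ω => gramMatrix (K i.castSucc ω) x)
    (ζ := fun j ω => (WithLp.toLp 2 fun r => ζ i j ω (x r) : EuclideanSpace ℝ (Fin n)))
    ((measurable_gramMatrix x).comp (h.measurable_K _))
    (fun j => (WithLp.measurable_toLp 2 _).comp
      (measurable_pi_lambda _ fun r => (measurable_pi_apply _).comp (h.measurable_ζ i j)))
    (h.indepFun i hm) (h.hasCondDistrib i x) (continuous_quadAct σv hφ t).measurable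
    (quadAct_nonneg σv φ t) hF hF1
  rw [← key, ← integral_const_mul]
  refine integral_congr_ae ?_
  filter_upwards [h.ae_posSemidef hφ henv ha x i.castSucc, h.ae_recursion i x] with ω h1 h2
  exact exp_neg_quadForm_of_recursion hφ henv (fun r => (h.poisson i).nonneg r ω) h1 h2 t

end

/-! ### The Markov property -/

/-- Two functions with equal integrals over a π-system have equal integrals over the σ-algebra which
it generates. -/
theorem setIntegral_eq_of_generateFrom {Ω : Type*} {m mΩ : MeasurableSpace Ω} {P : Measure Ω}
    (hm : m ≤ mΩ) {C : Set (Set Ω)} (hC : m = MeasurableSpace.generateFrom C) (hpi : IsPiSystem C)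
    {F G : Ω → ℝ} (hF : Integrable F P) (hG : Integrable G P) (h : ∫ ω, F ω ∂P = ∫ ω, G ω ∂P)
    (hbasic : ∀ D ∈ C, ∫ ω in D, F ω ∂P = ∫ ω in D, G ω ∂P) {D : Set Ω}
    (hD : MeasurableSet[m] D) : ∫ ω in D, F ω ∂P = ∫ ω in D, G ω ∂P := by
  induction D, hD using MeasurableSpace.induction_on_inter hC hpi with
  | empty => simp
  | basic D hD => exact hbasic D hD
  | compl D hD ih =>
    have h1 := integral_add_compl (hm D hD) hF
    have h2 := integral_add_compl (hm D hD) hG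
    linarith
  | iUnion f hd hf ih =>
    rw [integral_iUnion (fun i => hm _ (hf i)) hd hF.integrableOn,
      integral_iUnion (fun i => hm _ (hf i)) hd hG.integrableOn]
    exact tsum_congr ih

theorem integral_mul_condExp {Ω : Type*} {m mΩ : MeasurableSpace Ω} {P : Measure Ω}
    [IsProbabilityMeasure P] (hm : m ≤ mΩ) {F Y : Ω → ℝ} (hF : StronglyMeasurable[m] F)
    {C : ℝ} (hFC : ∀ ω, ‖F ω‖ ≤ C) (hY : Integrable Y P) :
    ∫ ω, F ω * (P[Y|m]) ω ∂P = ∫ ω, F ω * Y ω ∂P := by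
  have h := condExp_mul_of_stronglyMeasurable_left hF
    (hY.bdd_mul (hF.mono hm).aestronglyMeasurable (ae_of_all _ hFC)) hY
  rw [← integral_condExp hm (f := fun ω => F ω * Y ω)]
  exact (integral_congr_ae h).symm

theorem setIntegral_eq_integral_indicator_one_mul {Ω : Type*} {mΩ : MeasurableSpace Ω}
    {P : Measure Ω} {A : Set Ω} (hA : MeasurableSet A) (F : Ω → ℝ) :
    ∫ ω in A, F ω ∂P = ∫ ω, A.indicator (fun _ => (1 : ℝ)) ω * F ω ∂P := by
  rw [← integral_indicator hA]
  congr 1 with ω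
  by_cases h : ω ∈ A <;> simp [h]

theorem norm_indicator_one_le {Ω : Type*} (A : Set Ω) (ω : Ω) :
    ‖A.indicator (fun _ => (1 : ℝ)) ω‖ ≤ 1 := by
  by_cases h : ω ∈ A <;> simp [h]

theorem indicator_inter_one {Ω : Type*} (A B : Set Ω) (ω : Ω) :
    (A ∩ B).indicator (fun _ => (1 : ℝ)) ω
      = A.indicator (fun _ => 1) ω * B.indicator (fun _ => 1) ω := by
  by_cases h1 : ω ∈ A <;> by_cases h2 : ω ∈ B <;> simp [h1, h2]

/-- Truncation to the unit interval. -/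
def clampUnit (r : ℝ) : ℝ := max 0 (min r 1)

theorem continuous_clampUnit : Continuous clampUnit := by unfold clampUnit; fun_prop

theorem norm_clampUnit_le (r : ℝ) : ‖clampUnit r‖ ≤ 1 := by
  rw [clampUnit, Real.norm_of_nonneg (le_max_left _ _)]
  exact max_le zero_le_one (min_le_right _ _)

/-- Truncation gives a version of a conditional probability which is bounded everywhere. -/
theorem clampUnit_condExp_indicator {Ω : Type*} {m mΩ : MeasurableSpace Ω}
    {P : Measure Ω} [IsProbabilityMeasure P] (hm : m ≤ mΩ) {E : Set Ω} (hE : MeasurableSet E) :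
    (fun ω => clampUnit ((P⟦E | m⟧) ω)) =ᵐ[P] P⟦E | m⟧ := by
  have h0 : 0 ≤ᵐ[P] P⟦E | m⟧ :=
    condExp_nonneg (ae_of_all _ fun ω => Set.indicator_nonneg (fun _ _ => zero_le_one) ω)
  have h1 : P⟦E | m⟧ ≤ᵐ[P] P[fun _ => (1 : ℝ) | m] :=
    condExp_mono ((integrable_const 1).indicator hE) (integrable_const 1) (ae_of_all _ fun ω =>
      Set.indicator_le_self' (fun _ _ => zero_le_one) ω)
  rw [condExp_const hm] at h1
  filter_upwards [h0, h1] with ω (h0 : 0 ≤ _) h1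
  rw [clampUnit, min_eq_left h1, max_eq_right h0]

/-- A criterion for `D` and `m₂` to be conditionally independent given `m₁ ≤ m₂`. -/
theorem condExp_indicator_eq_of_setIntegral {Ω : Type*} {m₁ m₂ mΩ : MeasurableSpace Ω}
    {P : Measure Ω} [IsProbabilityMeasure P] (h₁₂ : m₁ ≤ m₂) (h₂ : m₂ ≤ mΩ) {D : Set Ω}
    (hD : MeasurableSet D)
    (h : ∀ A, MeasurableSet[m₂] A →
      ∫ ω in D, A.indicator (fun _ => (1 : ℝ)) ω ∂P = ∫ ω in D, (P⟦A | m₁⟧) ω ∂P) :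
    P⟦D | m₂⟧ =ᵐ[P] P⟦D | m₁⟧ := by
  symm
  have hDi : Integrable (D.indicator fun _ => (1 : ℝ)) P := (integrable_const 1).indicator hD
  refine ae_eq_condExp_of_forall_setIntegral_eq h₂ hDi
    (fun _ _ _ => integrable_condExp.integrableOn)
    (fun A hA _ => ?_) (stronglyMeasurable_condExp.mono h₁₂).aestronglyMeasurable
  have hA' := h₂ A hA
  have hAi : Integrable (A.indicator fun _ => (1 : ℝ)) P := (integrable_const 1).indicator hA'
  have hcA := fun (E : Set Ω) (hE : MeasurableSet E) =>
    clampUnit_condExp_indicator (P := P) (h₁₂.trans h₂) hE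
  have e1 : ∫ ω in A, (P⟦D | m₁⟧) ω ∂P
      = ∫ ω, clampUnit ((P⟦D | m₁⟧) ω) * A.indicator (fun _ => (1 : ℝ)) ω ∂P := by
    rw [setIntegral_eq_integral_indicator_one_mul hA']
    refine integral_congr_ae ?_
    filter_upwards [hcA D hD] with ω hω
    rw [hω, mul_comm]
  have e2 : ∫ ω, clampUnit ((P⟦D | m₁⟧) ω) * A.indicator (fun _ => (1 : ℝ)) ω ∂P
      = ∫ ω, clampUnit ((P⟦A | m₁⟧) ω) * D.indicator (fun _ => (1 : ℝ)) ω ∂P := by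
    rw [← integral_mul_condExp (h₁₂.trans h₂) (continuous_clampUnit.comp_stronglyMeasurable
        stronglyMeasurable_condExp) (fun ω => norm_clampUnit_le _) hAi,
      ← integral_mul_condExp (h₁₂.trans h₂) (continuous_clampUnit.comp_stronglyMeasurable
        stronglyMeasurable_condExp) (fun ω => norm_clampUnit_le _) hDi]
    refine integral_congr_ae ?_
    filter_upwards [hcA D hD, hcA A hA'] with ω h1 h2
    rw [h1, h2, mul_comm]
  have e3 : ∫ ω, clampUnit ((P⟦A | m₁⟧) ω) * D.indicator (fun _ => (1 : ℝ)) ω ∂P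
      = ∫ ω in D, (P⟦A | m₁⟧) ω ∂P := by
    rw [setIntegral_eq_integral_indicator_one_mul hD]
    refine integral_congr_ae ?_
    filter_upwards [hcA A hA'] with ω h1
    rw [h1, mul_comm]
  rw [e1, e2, e3, ← h A hA, setIntegral_eq_integral_indicator_one_mul hD,
    setIntegral_eq_integral_indicator_one_mul hA']
  simp only [mul_comm]

/-- Every measurable cylinder in `ℝ^(ℕ × X)` is given by a condition on the values of the first
`J` functions at finitely many points. -/
theorem exists_eq_preimage_of_mem_measurableCylinders {X : Type*} {u : Set (ℕ × X → ℝ)}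
    (hu : u ∈ measurableCylinders fun _ : ℕ × X => ℝ) :
    ∃ (J n : ℕ) (x : Fin n → X) (C : Set (Fin J → EuclideanSpace ℝ (Fin n))), MeasurableSet C ∧
      u = (fun (z : ℕ × X → ℝ) (j : Fin J) =>
        (WithLp.toLp 2 fun r => z (j, x r) : EuclideanSpace ℝ (Fin n))) ⁻¹' C := by
  classical
  obtain ⟨s, S, hS, rfl⟩ := (mem_measurableCylinders u).1 hu
  let J := s.sup Prod.fst + 1
  let E := s.image Prod.snd
  have hJ : ∀ q : s, q.1.1 < J := fun q => Nat.lt_succ_of_le (Finset.le_sup q.2 (f := Prod.fst))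
  have hE : ∀ q : s, q.1.2 ∈ E := fun q => Finset.mem_image_of_mem _ q.2
  let r : s → Fin E.card := fun q => E.equivFin ⟨q.1.2, hE q⟩
  let G : (Fin J → EuclideanSpace ℝ (Fin E.card)) → s → ℝ := fun y q => y ⟨q.1.1, hJ q⟩ (r q)
  refine ⟨J, E.card, fun k => (E.equivFin.symm k).1, G ⁻¹' S, ?_, ?_⟩
  · refine (measurable_pi_lambda _ fun q => ?_) hS
    exact ((EuclideanSpace.proj (𝕜 := ℝ) (r q)).continuous.measurable).comp (measurable_pi_apply _)
  · ext z
    simp only [mem_cylinder, Set.mem_preimage]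
    have : s.restrict z = G fun j => WithLp.toLp 2 fun k => z (j, (E.equivFin.symm k).1) := by
      ext q
      simp [G, r]
    rw [this]

theorem isCountablySpanning_measurableCylinders {ι : Type*} :
    IsCountablySpanning (measurableCylinders fun _ : ι => ℝ) :=
  ⟨fun _ => Set.univ, fun _ => univ_mem_measurableCylinders _, Set.iUnion_const _⟩

section
variable {L d : ℕ} {Ω : Type*} [MeasurableSpace Ω] {P : Measure Ω} [IsProbabilityMeasure P]
  {σb σv : ℝ≥0} {φ : ℝ → ℝ} {a : Fin L → ℝ} {ρ : Fin L → Measure ℝ}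
  {K : Fin (L + 1) → Ω → EuclideanSpace ℝ (Fin d) → EuclideanSpace ℝ (Fin d) → ℝ}
  {T : Fin L → ℕ → Ω → ℝ} {ζ : Fin L → ℕ → Ω → EuclideanSpace ℝ (Fin d) → ℝ}

/-- Everything that enters the computation of the kernel of the next layer. -/
def stepData
    (K : Fin (L + 1) → Ω → EuclideanSpace ℝ (Fin d) → EuclideanSpace ℝ (Fin d) → ℝ)
    (T : Fin L → ℕ → Ω → ℝ) (ζ : Fin L → ℕ → Ω → EuclideanSpace ℝ (Fin d) → ℝ) (i : Fin L)
    (ω : Ω) : (EuclideanSpace ℝ (Fin d) → EuclideanSpace ℝ (Fin d) → ℝ) × (ℕ → ℝ) ×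
      (ℕ × EuclideanSpace ℝ (Fin d) → ℝ) :=
  (K i.castSucc ω, fun j => T i j ω, fun q => ζ i q.1 ω q.2)

theorem IsKernelRecursion.measurable_stepData (h : IsKernelRecursion P σb σv φ a ρ K T ζ)
    (i : Fin L) : Measurable (stepData K T ζ i) :=
  (h.measurable_K _).prodMk ((h.measurable_points i).prodMk
    (measurable_pi_lambda _ fun q => (measurable_pi_apply q.2).comp (h.measurable_ζ i q.1)))

/-- For an event defined by the current kernel, the points and the Gaussian processes at finitely
many inputs, the points and the processes are integrated out: the result involves the past only
through `F` and the current kernel. -/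
theorem IsKernelRecursion.setIntegral_cylinder (h : IsKernelRecursion P σb σv φ a ρ K T ζ)
    (i : Fin L) {F : Ω → ℝ} (hF : StronglyMeasurable[historySigma K i.castSucc] F) {c : ℝ}
    (hFc : ∀ ω, ‖F ω‖ ≤ c)
    {S : Set (EuclideanSpace ℝ (Fin d) → EuclideanSpace ℝ (Fin d) → ℝ)} (hS : MeasurableSet S)
    {B : Set (ℕ → ℝ)} (hB : MeasurableSet B) {J n : ℕ} (x : Fin n → EuclideanSpace ℝ (Fin d))
    {C : Set (Fin J → EuclideanSpace ℝ (Fin n))} (hC : MeasurableSet C) :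
    ∫ ω in stepData K T ζ i ⁻¹' (S ×ˢ B ×ˢ ((fun (z : ℕ × EuclideanSpace ℝ (Fin d) → ℝ)
        (j : Fin J) => (WithLp.toLp 2 fun r => z (j, x r) : EuclideanSpace ℝ (Fin n))) ⁻¹' C)),
        F ω ∂P
      = P.real ((fun ω j => T i j ω) ⁻¹' B) *
        ∫ ω, F ω * ((K i.castSucc ⁻¹' S).indicator (fun _ => (1 : ℝ)) ω *
          (iidGaussian (K i.castSucc ω) x J).real C) ∂P := by
  set Y := fun ω (j : Fin J) =>
    (WithLp.toLp 2 fun r => ζ i j ω (x r) : EuclideanSpace ℝ (Fin n))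
  have hY : Measurable Y := measurable_pi_lambda _ fun j => (WithLp.measurable_toLp 2 _).comp
    (measurable_pi_lambda _ fun r => (measurable_pi_apply _).comp (h.measurable_ζ i j))
  have hH := h.historySigma_le i.castSucc
  have hT := (h.measurable_points i).comap_le
  have hSm : MeasurableSet[historySigma K i.castSucc] (K i.castSucc ⁻¹' S) :=
    kernelSigma_le_historySigma K _ _ ⟨S, hS, rfl⟩
  have hBm : MeasurableSet[MeasurableSpace.comap (fun ω j => T i j ω) MeasurableSpace.pi]
      ((fun ω j => T i j ω) ⁻¹' B) := ⟨B, hB, rfl⟩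
  set IS := (K i.castSucc ⁻¹' S).indicator (fun _ => (1 : ℝ))
  set IB := ((fun ω j => T i j ω) ⁻¹' B).indicator (fun _ => (1 : ℝ))
  set g := fun ω => (iidGaussian (K i.castSucc ω) x J).real C
  have hg : StronglyMeasurable[historySigma K i.castSucc] g := by
    have h1 : Measurable fun k : EuclideanSpace ℝ (Fin d) → EuclideanSpace ℝ (Fin d) → ℝ =>
        (iidGaussian k x J).real C :=
      ((Measure.measurable_coe hC).comp (measurable_iidGaussian x J)).ennreal_toReal
    exact ((h1.comp (comap_measurable (K i.castSucc))).mono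
      (kernelSigma_le_historySigma K _) le_rfl).stronglyMeasurable
  have hIS : StronglyMeasurable[historySigma K i.castSucc] IS :=
    stronglyMeasurable_const.indicator hSm
  have hIB : StronglyMeasurable[MeasurableSpace.comap (fun ω j => T i j ω) MeasurableSpace.pi] IB :=
    stronglyMeasurable_const.indicator hBm
  have e1 : ∫ ω in stepData K T ζ i ⁻¹' (S ×ˢ B ×ˢ ((fun (z : ℕ × EuclideanSpace ℝ (Fin d) → ℝ)
        (j : Fin J) => (WithLp.toLp 2 fun r => z (j, x r) : EuclideanSpace ℝ (Fin n))) ⁻¹' C)),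
        F ω ∂P
      = ∫ ω, (F ω * (IS ω * IB ω)) * (Y ⁻¹' C).indicator (fun _ => (1 : ℝ)) ω ∂P := by
    have hset : stepData K T ζ i ⁻¹' (S ×ˢ B ×ˢ ((fun (z : ℕ × EuclideanSpace ℝ (Fin d) → ℝ)
        (j : Fin J) => (WithLp.toLp 2 fun r => z (j, x r) : EuclideanSpace ℝ (Fin n))) ⁻¹' C))
        = K i.castSucc ⁻¹' S ∩ (((fun ω j => T i j ω) ⁻¹' B) ∩ (Y ⁻¹' C)) := rfl
    rw [hset, setIntegral_eq_integral_indicator_one_mul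
      ((hH _ hSm).inter ((hT _ hBm).inter (hY hC)))]
    congr 1 with ω
    rw [indicator_inter_one, indicator_inter_one]
    ring
  have hF1 : StronglyMeasurable[historySigma K i.castSucc ⊔
      MeasurableSpace.comap (fun ω j => T i j ω) MeasurableSpace.pi] F :=
    hF.mono le_sup_left
  have hIS1 : StronglyMeasurable[historySigma K i.castSucc ⊔
      MeasurableSpace.comap (fun ω j => T i j ω) MeasurableSpace.pi] IS :=
    hIS.mono le_sup_left
  have hIB1 : StronglyMeasurable[historySigma K i.castSucc ⊔
      MeasurableSpace.comap (fun ω j => T i j ω) MeasurableSpace.pi] IB :=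
    hIB.mono le_sup_right
  have hF' : StronglyMeasurable[historySigma K i.castSucc ⊔
      MeasurableSpace.comap (fun ω j => T i j ω) MeasurableSpace.pi]
      fun ω => F ω * (IS ω * IB ω) := hF1.mul (hIS1.mul hIB1)
  have hb : ∀ ω, ‖F ω * (IS ω * IB ω)‖ ≤ c := fun ω => by
    rw [norm_mul, norm_mul]
    have h1 := norm_indicator_one_le (K i.castSucc ⁻¹' S) ω
    have h2 := norm_indicator_one_le ((fun ω j => T i j ω) ⁻¹' B) ω
    have h3 : ‖IS ω‖ * ‖IB ω‖ ≤ 1 := mul_le_one₀ h1 (norm_nonneg _) h2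
    calc ‖F ω‖ * (‖IS ω‖ * ‖IB ω‖) ≤ ‖F ω‖ * 1 :=
          mul_le_mul_of_nonneg_left h3 (norm_nonneg _)
      _ ≤ c := by simpa using hFc ω
  have e2 : ∫ ω, (F ω * (IS ω * IB ω)) * (Y ⁻¹' C).indicator (fun _ => (1 : ℝ)) ω ∂P
      = ∫ ω, IB ω * (F ω * (IS ω * g ω)) ∂P := by
    rw [← integral_mul_condExp (sup_le hH hT) hF' hb ((integrable_const 1).indicator (hY hC))]
    refine integral_congr_ae ?_
    filter_upwards [h.gaussian i J n x C hC] with ω hω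
    have : (P⟦Y ⁻¹' C | historySigma K i.castSucc ⊔
        MeasurableSpace.comap (fun ω j => T i j ω) MeasurableSpace.pi⟧) ω = g ω := hω
    rw [this]; ring
  have hind : IndepFun IB (fun ω => F ω * (IS ω * g ω)) P := by
    rw [IndepFun_iff_Indep]
    exact indep_of_indep_of_le_left (indep_of_indep_of_le_right (h.indep i)
      (hF.mul (hIS.mul hg)).measurable.comap_le) hIB.measurable.comap_le
  rw [e1, e2, hind.integral_fun_mul_eq_mul_integral (hIB.mono hT).aestronglyMeasurable
    ((hF.mul (hIS.mul hg)).mono hH).aestronglyMeasurable]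
  congr 1
  exact integral_indicator_one (hT _ hBm)

/-- Up to a null event, the kernel of the next layer is a function of the kernel of the current
layer, of the points, and of the Gaussian processes. -/
theorem IsKernelRecursion.exists_ae_eq_stepData (h : IsKernelRecursion P σb σv φ a ρ K T ζ)
    (hφ : Continuous φ) (i : Fin L)
    {S : Set (EuclideanSpace ℝ (Fin d) → EuclideanSpace ℝ (Fin d) → ℝ)} (hS : MeasurableSet S) :
    ∃ D, MeasurableSet[MeasurableSpace.comap (stepData K T ζ i) inferInstance] D ∧
      K i.succ ⁻¹' S =ᵐ[P] D := by
  have hrec := h.recursion i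
  let 𝓜 := MeasurableSpace.comap (stepData K T ζ i) inferInstance
  have hstep : Measurable[𝓜] (stepData K T ζ i) := comap_measurable _
  have hK : Measurable[𝓜] (K i.castSucc) := measurable_fst.comp hstep
  have hT : ∀ j, Measurable[𝓜] (T i j) := fun j =>
    (measurable_pi_apply j).comp ((measurable_fst.comp measurable_snd).comp hstep)
  have hζ : ∀ j x, Measurable[𝓜] fun ω => ζ i j ω x := fun j x =>
    (measurable_pi_apply (X := fun _ : ℕ × EuclideanSpace ℝ (Fin d) => ℝ) (j, x)).comp
      ((measurable_snd.comp measurable_snd).comp hstep)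
  have hmain : Measurable[eventuallyMeasurableSpace 𝓜 (ae P)] (K i.succ) := by
    refine @measurable_pi_lambda _ _ _ (eventuallyMeasurableSpace 𝓜 (ae P)) _ _ fun x =>
      @measurable_pi_lambda _ _ _ (eventuallyMeasurableSpace 𝓜 (ae P)) _ _ fun x' => ?_
    have hM : Measurable[𝓜] fun ω => (σb : ℝ) ^ 2
        + (σv : ℝ) ^ 2 * (a i * activationMoment φ (K i.castSucc ω) x x') :=
      ((((measurable_activationMoment hφ x x').comp hK).const_mul _).const_mul _).const_add _
    have hsum : ∀ N : ℕ, Measurable[𝓜] fun ω => ∑ j ∈ Finset.range N,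
        (σv : ℝ) ^ 2 * (T i j ω * φ (ζ i j ω x) * φ (ζ i j ω x')) := fun N =>
      Finset.measurable_fun_sum _ fun j _ => (((hT j).mul (hφ.measurable.comp (hζ j x))).mul
        (hφ.measurable.comp (hζ j x'))).const_mul _
    refine Measurable.eventuallyMeasurable_of_eventuallyEq (m := 𝓜)
      (f := fun ω => ((σb : ℝ) ^ 2
        + (σv : ℝ) ^ 2 * (a i * activationMoment φ (K i.castSucc ω) x x')) +
        limsup (fun N => ∑ j ∈ Finset.range N,
          (σv : ℝ) ^ 2 * (T i j ω * φ (ζ i j ω x) * φ (ζ i j ω x'))) atTop)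
      (hM.add (Measurable.limsup hsum)) ?_
    filter_upwards [hrec x x'] with ω hω
    rw [hω.tendsto_sum_nat.limsup_eq]
    ring
  exact hmain hS

/-- Given the kernel of the current layer, the data of the next step is conditionally
independent of the past. -/
theorem IsKernelRecursion.markov (h : IsKernelRecursion P σb σv φ a ρ K T ζ) (hφ : Continuous φ)
    (i : Fin L)
    {S : Set (EuclideanSpace ℝ (Fin d) → EuclideanSpace ℝ (Fin d) → ℝ)} (hS : MeasurableSet S) :
    P⟦K i.succ ⁻¹' S | historySigma K i.castSucc⟧
      =ᵐ[P] P⟦K i.succ ⁻¹' S | kernelSigma (K i.castSucc)⟧ := by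
  have hle := kernelSigma_le_historySigma K i.castSucc
  have hH := h.historySigma_le i.castSucc
  refine condExp_indicator_eq_of_setIntegral hle hH (h.measurable_K _ hS) fun A hA => ?_
  obtain ⟨D, hD, hDe⟩ := h.exists_ae_eq_stepData hφ i hS
  rw [setIntegral_congr_set hDe, setIntegral_congr_set hDe]
  have hAi : Integrable (A.indicator fun _ => (1 : ℝ)) P :=
    (integrable_const 1).indicator (hH A hA)
  have hgen : (inferInstance : MeasurableSpace
      ((EuclideanSpace ℝ (Fin d) → EuclideanSpace ℝ (Fin d) → ℝ) × (ℕ → ℝ) ×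
        (ℕ × EuclideanSpace ℝ (Fin d) → ℝ)))
      = MeasurableSpace.generateFrom (Set.image2 (· ×ˢ ·) {S | MeasurableSet S}
        (Set.image2 (· ×ˢ ·) {B | MeasurableSet B}
          (measurableCylinders fun _ : ℕ × EuclideanSpace ℝ (Fin d) => ℝ))) := by
    have h1 := generateFrom_eq_prod (α := ℕ → ℝ) MeasurableSpace.generateFrom_measurableSet
      (generateFrom_measurableCylinders (α := fun _ : ℕ × EuclideanSpace ℝ (Fin d) => ℝ))
      isCountablySpanning_measurableSet isCountablySpanning_measurableCylinders
    exact (generateFrom_eq_prod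
      (α := EuclideanSpace ℝ (Fin d) → EuclideanSpace ℝ (Fin d) → ℝ)
      MeasurableSpace.generateFrom_measurableSet h1 isCountablySpanning_measurableSet
      (isCountablySpanning_measurableSet.prod isCountablySpanning_measurableCylinders)).symm
  have hpi : IsPiSystem (Set.image2 (· ×ˢ ·)
      {S : Set (EuclideanSpace ℝ (Fin d) → EuclideanSpace ℝ (Fin d) → ℝ) | MeasurableSet S}
      (Set.image2 (· ×ˢ ·) {B : Set (ℕ → ℝ) | MeasurableSet B}
        (measurableCylinders fun _ : ℕ × EuclideanSpace ℝ (Fin d) => ℝ))) :=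
    MeasurableSpace.isPiSystem_measurableSet.prod
      (MeasurableSpace.isPiSystem_measurableSet.prod isPiSystem_measurableCylinders)
  have hcA := clampUnit_condExp_indicator (P := P) (hle.trans hH) (hH A hA)
  refine setIntegral_eq_of_generateFrom
    (m := MeasurableSpace.comap (stepData K T ζ i) inferInstance)
    (h.measurable_stepData i).comap_le
    (C := {s | ∃ t ∈ _, stepData K T ζ i ⁻¹' t = s}) ?_ (hpi.comap (stepData K T ζ i)) hAi
    integrable_condExp (integral_condExp (hle.trans hH)).symm ?_ hD
  · rw [hgen, MeasurableSpace.comap_generateFrom]; rfl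
  rintro _ ⟨_, ⟨S', hS', _, ⟨B, hB, u, hu, rfl⟩, rfl⟩, rfl⟩
  obtain ⟨J, n, x, C, hC, rfl⟩ := exists_eq_preimage_of_mem_measurableCylinders hu
  rw [← integral_congr_ae (ae_restrict_of_ae hcA)]
  have hmeas : StronglyMeasurable[kernelSigma (K i.castSucc)]
      fun ω => clampUnit ((P⟦A | kernelSigma (K i.castSucc)⟧) ω) :=
    continuous_clampUnit.comp_stronglyMeasurable stronglyMeasurable_condExp
  rw [h.setIntegral_cylinder i (stronglyMeasurable_const.indicator hA)
      (norm_indicator_one_le A) hS' hB x hC,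
    h.setIntegral_cylinder i (hmeas.mono hle) (fun ω => norm_clampUnit_le _) hS' hB x hC]
  congr 1
  have hg : StronglyMeasurable[kernelSigma (K i.castSucc)] fun ω =>
      (K i.castSucc ⁻¹' S').indicator (fun _ => (1 : ℝ)) ω *
        (iidGaussian (K i.castSucc ω) x J).real C := by
    have h1 : Measurable fun k : EuclideanSpace ℝ (Fin d) → EuclideanSpace ℝ (Fin d) → ℝ =>
        (iidGaussian k x J).real C :=
      ((Measure.measurable_coe hC).comp (measurable_iidGaussian x J)).ennreal_toReal
    have h2 : MeasurableSet[kernelSigma (K i.castSucc)] (K i.castSucc ⁻¹' S') := ⟨S', hS', rfl⟩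
    exact (stronglyMeasurable_const.indicator h2).mul
      (h1.comp (comap_measurable (K i.castSucc))).stronglyMeasurable
  have hgb : ∀ ω, ‖(K i.castSucc ⁻¹' S').indicator (fun _ => (1 : ℝ)) ω *
      (iidGaussian (K i.castSucc ω) x J).real C‖ ≤ 1 := fun ω => by
    rw [norm_mul, Real.norm_of_nonneg measureReal_nonneg]
    exact mul_le_one₀ (norm_indicator_one_le _ ω) measureReal_nonneg measureReal_le_one
  rw [integral_congr_ae (g := fun ω => ((K i.castSucc ⁻¹' S').indicator (fun _ => (1 : ℝ)) ω *
    (iidGaussian (K i.castSucc ω) x J).real C) * (P⟦A | kernelSigma (K i.castSucc)⟧) ω)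
    (f := fun ω => clampUnit ((P⟦A | kernelSigma (K i.castSucc)⟧) ω) * _)
    (hcA.mono fun ω hω => by simp only [hω]; ring), integral_mul_condExp (hle.trans hH) hg hgb hAi]
  simp only [mul_comm]

end

/-! ### Laplace transforms of null arrays -/

/-- The Laplace transform of a measure on the line. -/
def mixLaplace (μ : Measure ℝ) (s : ℝ) : ℝ := ∫ w, Real.exp (-(s * w)) ∂μ

theorem ae_nonneg_of_measure_Iio {μ : Measure ℝ} (hμ : μ (Set.Iio 0) = 0) : ∀ᵐ w ∂μ, 0 ≤ w := by
  rw [ae_iff]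
  simpa [Set.Iio] using hμ

theorem exp_neg_mul_le_one {s w : ℝ} (hs : 0 ≤ s) (hw : 0 ≤ w) : Real.exp (-(s * w)) ≤ 1 := by
  rw [Real.exp_le_one_iff]
  have := mul_nonneg hs hw
  linarith

section
variable {μ : Measure ℝ} [IsProbabilityMeasure μ]

theorem integrable_exp_neg_mul_of_nonneg (hμ : μ (Set.Iio 0) = 0) {s : ℝ} (hs : 0 ≤ s) :
    Integrable (fun w => Real.exp (-(s * w))) μ := by
  refine Integrable.of_bound (C := 1) (by fun_prop) ?_
  filter_upwards [ae_nonneg_of_measure_Iio hμ] with w hw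
  rw [Real.norm_of_nonneg (Real.exp_pos _).le]
  exact exp_neg_mul_le_one hs hw

theorem mixLaplace_nonneg (μ : Measure ℝ) (s : ℝ) : 0 ≤ mixLaplace μ s :=
  integral_nonneg fun _ => (Real.exp_pos _).le

theorem mixLaplace_le_one (hμ : μ (Set.Iio 0) = 0) {s : ℝ} (hs : 0 ≤ s) : mixLaplace μ s ≤ 1 := by
  have h : mixLaplace μ s ≤ ∫ _, (1 : ℝ) ∂μ := by
    refine integral_mono_ae (integrable_exp_neg_mul_of_nonneg hμ hs) (integrable_const _) ?_
    filter_upwards [ae_nonneg_of_measure_Iio hμ] with w hw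
    exact exp_neg_mul_le_one hs hw
  simpa using h

theorem measurable_mixLaplace (μ : Measure ℝ) [SFinite μ] : Measurable (mixLaplace μ) := by
  have h : StronglyMeasurable fun p : ℝ × ℝ => Real.exp (-(p.1 * p.2)) :=
    (by fun_prop : Measurable _).stronglyMeasurable
  exact h.integral_prod_right.measurable

theorem one_sub_exp_neg_mul_le {s w : ℝ} (hs : 0 ≤ s) (hw : 0 ≤ w) :
    1 - Real.exp (-(s * w)) ≤ (1 + s) * (1 - Real.exp (-w)) := by
  have h1 : 0 ≤ 1 - Real.exp (-w) := by
    have : Real.exp (-w) ≤ 1 := Real.exp_le_one_iff.2 (by linarith)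
    linarith
  have h2 : Real.exp (-((1 + s) * w)) ≤ Real.exp (-(s * w)) :=
    Real.exp_le_exp.2 (by nlinarith)
  have h3 := one_add_mul_self_le_rpow_one_add (s := Real.exp (-w) - 1)
    (by have := Real.exp_pos (-w); linarith) (p := 1 + s) (by linarith)
  rw [add_sub_cancel, ← Real.exp_mul, show -w * (1 + s) = -((1 + s) * w) by ring] at h3
  linarith

/-- A domination in `s`, which turns the convergence at `s = 1` into a uniform bound. -/
theorem one_sub_mixLaplace_le (hμ : μ (Set.Iio 0) = 0) {s : ℝ} (hs : 0 ≤ s) :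
    1 - mixLaplace μ s ≤ (1 + s) * (1 - mixLaplace μ 1) := by
  have e : ∀ r, 0 ≤ r → 1 - mixLaplace μ r = ∫ w, (1 - Real.exp (-(r * w))) ∂μ := fun r hr => by
    rw [integral_sub (integrable_const _) (integrable_exp_neg_mul_of_nonneg hμ hr)]
    simp [mixLaplace]
  rw [e s hs, e 1 zero_le_one, ← integral_const_mul]
  refine integral_mono_ae ((integrable_const _).sub (integrable_exp_neg_mul_of_nonneg hμ hs))
    (((integrable_const _).sub (integrable_exp_neg_mul_of_nonneg hμ zero_le_one)).const_mul _) ?_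
  filter_upwards [ae_nonneg_of_measure_Iio hμ] with w hw
  simpa using one_sub_exp_neg_mul_le hs hw

end

theorem integral_iidSumLaw {q : ℕ} (μ : ProbabilityMeasure ℝ) {f : ℝ → ℝ} (hf : Continuous f)
    (s : ℝ) (h : ∀ w, 0 ≤ w → f w = Real.exp (-(s * w))) (hμ : (μ : Measure ℝ) (Set.Iio 0) = 0) :
    ∫ w, f w ∂(iidSumLaw q μ : Measure ℝ) = mixLaplace μ s ^ q := by
  rw [iidSumLaw, ProbabilityMeasure.toMeasure_map, ProbabilityMeasure.toMeasure_pi,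
    integral_map (by fun_prop) hf.aestronglyMeasurable]
  have hae : ∀ᵐ v ∂(Measure.pi fun _ : Fin q => (μ : Measure ℝ)), ∀ j, 0 ≤ v j := by
    refine ae_all_iff.2 fun j => ?_
    exact (Measure.quasiMeasurePreserving_eval (μ := fun _ : Fin q => (μ : Measure ℝ)) j).ae
      (ae_nonneg_of_measure_Iio hμ)
  have h1 : ∫ v, f (∑ j, v j) ∂(Measure.pi fun _ : Fin q => (μ : Measure ℝ))
      = ∫ v : Fin q → ℝ, ∏ j, Real.exp (-(s * v j))
          ∂(Measure.pi fun _ : Fin q => (μ : Measure ℝ)) := by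
    refine integral_congr_ae ?_
    filter_upwards [hae] with v hv
    rw [h _ (Finset.sum_nonneg fun j _ => hv j), ← Real.exp_sum, Finset.mul_sum,
      Finset.sum_neg_distrib]
  rw [h1, integral_fintype_prod_eq_pow (𝕜 := ℝ) (fun w => Real.exp (-(s * w))), Fintype.card_fin]
  rfl

/-- The Laplace exponent of the law `ID(a, ρ)`. -/
def levyExponent (a : ℝ) (ρ : Measure ℝ) (s : ℝ) : ℝ :=
  s * a + ∫ w, (1 - Real.exp (-(w * s))) ∂ρ

section
variable {a : ℝ} {ρ : Measure ℝ} {Λ : ProbabilityMeasure ℝ} {μ : ℕ+ → ProbabilityMeasure ℝ}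

/-- Convergence in distribution of the sums, in terms of Laplace transforms. -/
theorem tendsto_mixLaplace_pow (hΛ : IsIDLaw a ρ Λ)
    (hμ : ∀ q, (μ q : Measure ℝ) (Set.Iio 0) = 0)
    (hlim : Tendsto (fun q : ℕ+ => iidSumLaw q (μ q)) atTop (𝓝 Λ)) {s : ℝ} (hs : 0 ≤ s) :
    Tendsto (fun q : ℕ+ => mixLaplace (μ q) s ^ (q : ℕ)) atTop
      (𝓝 (Real.exp (-levyExponent a ρ s))) := by
  have hc : Continuous fun w : ℝ => Real.exp (-(s * max w 0)) := by fun_prop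
  let f : BoundedContinuousFunction ℝ ℝ := BoundedContinuousFunction.ofNormedAddCommGroup
    (fun w => Real.exp (-(s * max w 0))) hc 1 fun w => by
      rw [Real.norm_of_nonneg (Real.exp_pos _).le]
      exact exp_neg_mul_le_one hs (le_max_right _ _)
  have h := (ProbabilityMeasure.tendsto_iff_forall_integral_tendsto.1 hlim) f
  have e : ∫ w, f w ∂(Λ : Measure ℝ) = Real.exp (-levyExponent a ρ s) := by
    rw [show -levyExponent a ρ s = -(s * a) - ∫ w, (1 - Real.exp (-(w * s))) ∂ρ by
      rw [levyExponent]; ring, ← hΛ.laplace s hs]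
    refine integral_congr_ae ?_
    filter_upwards [ae_nonneg_of_measure_Iio hΛ.carried] with w hw
    simp [f, max_eq_left hw]
  rw [e] at h
  refine h.congr fun q => ?_
  exact integral_iidSumLaw (μ q) hc s (fun w hw => by rw [max_eq_left hw]) (hμ q)

theorem tendsto_mul_one_sub_of_tendsto_pow {x : ℕ+ → ℝ} (h0 : ∀ q, 0 ≤ x q) (h1 : ∀ q, x q ≤ 1)
    {c : ℝ} (h : Tendsto (fun q : ℕ+ => x q ^ (q : ℕ)) atTop (𝓝 (Real.exp (-c)))) :
    Tendsto (fun q : ℕ+ => (q : ℝ) * (1 - x q)) atTop (𝓝 c) := by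
  have hlog : Tendsto (fun q : ℕ+ => -Real.log (x q ^ (q : ℕ))) atTop (𝓝 c) := by
    have := ((Real.continuousAt_log (Real.exp_pos (-c)).ne').tendsto.comp h).neg
    simpa using this
  have hpos : ∀ᶠ q : ℕ+ in atTop, 0 < x q := by
    filter_upwards [h.eventually (lt_mem_nhds (Real.exp_pos (-c)))] with q hq
    refine lt_of_le_of_ne (h0 q) fun h => ?_
    rw [← h, zero_pow q.ne_zero] at hq
    exact lt_irrefl _ hq
  have hq : Tendsto (fun q : ℕ+ => ((q : ℕ) : ℝ)) atTop atTop :=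
    tendsto_natCast_atTop_atTop.comp tendsto_PNat_val_atTop_atTop
  -- `q (1 - x) ≤ -q log x`
  have hup : ∀ᶠ q : ℕ+ in atTop, (q : ℝ) * (1 - x q) ≤ -Real.log (x q ^ (q : ℕ)) := by
    filter_upwards [hpos] with q hq
    rw [Real.log_pow]
    have := Real.log_le_sub_one_of_pos hq
    have hq' : (0 : ℝ) < (q : ℕ) := by exact_mod_cast q.pos
    nlinarith
  -- `q (1 - x) ≥ -x q log x`
  have hlow : ∀ᶠ q : ℕ+ in atTop, x q * -Real.log (x q ^ (q : ℕ)) ≤ (q : ℝ) * (1 - x q) := by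
    filter_upwards [hpos] with q hq
    rw [Real.log_pow]
    have h2 := Real.one_sub_inv_le_log_of_pos hq
    have h3 : x q * (1 - (x q)⁻¹) ≤ x q * Real.log (x q) := mul_le_mul_of_nonneg_left h2 hq.le
    rw [mul_sub, mul_inv_cancel₀ hq.ne'] at h3
    have hq' : (0 : ℝ) < (q : ℕ) := by exact_mod_cast q.pos
    nlinarith
  have hx : Tendsto x atTop (𝓝 1) := by
    have h2 : Tendsto (fun q : ℕ+ => -Real.log (x q ^ (q : ℕ)) / (q : ℕ)) atTop (𝓝 0) :=
      hlog.div_atTop hq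
    have h3 : Tendsto (fun q : ℕ+ => 1 - x q) atTop (𝓝 0) := by
      refine tendsto_of_tendsto_of_tendsto_of_le_of_le' tendsto_const_nhds h2
        (Eventually.of_forall fun q => by have := h1 q; simpa using this) ?_
      filter_upwards [hup] with q hq
      have hq' : (0 : ℝ) < (q : ℕ) := by exact_mod_cast q.pos
      rw [le_div_iff₀ hq', mul_comm]
      exact hq
    simpa using h3.const_sub 1
  refine tendsto_of_tendsto_of_tendsto_of_le_of_le' ?_ hlog hlow hup
  simpa using hx.mul hlog

theorem tendsto_mul_one_sub_mixLaplace (hΛ : IsIDLaw a ρ Λ)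
    (hμ : ∀ q, (μ q : Measure ℝ) (Set.Iio 0) = 0)
    (hlim : Tendsto (fun q : ℕ+ => iidSumLaw q (μ q)) atTop (𝓝 Λ)) {s : ℝ} (hs : 0 ≤ s) :
    Tendsto (fun q : ℕ+ => (q : ℝ) * (1 - mixLaplace (μ q) s)) atTop (𝓝 (levyExponent a ρ s)) :=
  tendsto_mul_one_sub_of_tendsto_pow (fun _ => mixLaplace_nonneg _ s)
    (fun q => mixLaplace_le_one (hμ q) hs) (tendsto_mixLaplace_pow hΛ hμ hlim hs)

theorem tendsto_one_sub_div_pow {v : ℕ+ → ℝ} {c : ℝ} (h : Tendsto v atTop (𝓝 c)) :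
    Tendsto (fun q : ℕ+ => (1 - v q / (q : ℕ)) ^ (q : ℕ)) atTop (𝓝 (Real.exp (-c))) := by
  have h1 : Tendsto Nat.toPNat' atTop atTop := by
    refine tendsto_atTop.2 fun b => ?_
    filter_upwards [eventually_ge_atTop (b : ℕ)] with n hn
    have : 0 < n := b.pos.trans_le hn
    rw [← PNat.coe_le_coe, Nat.toPNat'_coe, if_pos this]
    exact hn
  have h2 := Real.tendsto_one_add_pow_exp_of_tendsto (g := fun n => -v n.toPNat' / n) (t := -c) (by
    refine (h.comp h1).neg.congr' ?_
    filter_upwards [eventually_gt_atTop 0] with n hn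
    have : (n : ℝ) ≠ 0 := by exact_mod_cast hn.ne'
    simp only [Function.comp_apply]
    field_simp)
  refine (h2.comp tendsto_PNat_val_atTop_atTop).congr fun q => ?_
  simp only [Function.comp_apply, PNat.coe_toPNat', neg_div, sub_eq_add_neg]

/-- The limit of the contribution of a layer of independent nodes, for fixed law `N` of the
pre-activations of a node. -/
theorem tendsto_integral_mixLaplace_pow {E : Type*} [MeasurableSpace E] {N : Measure E}
    [IsProbabilityMeasure N] {Q : E → ℝ} (hQ : Measurable Q) (hQ0 : ∀ y, 0 ≤ Q y)
    (hQi : Integrable Q N) (hΛ : IsIDLaw a ρ Λ)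
    (hμ : ∀ q, (μ q : Measure ℝ) (Set.Iio 0) = 0)
    (hlim : Tendsto (fun q : ℕ+ => iidSumLaw q (μ q)) atTop (𝓝 Λ)) :
    Tendsto (fun q : ℕ+ => (∫ y, mixLaplace (μ q) (Q y) ∂N) ^ (q : ℕ)) atTop
      (𝓝 (Real.exp (-∫ y, levyExponent a ρ (Q y) ∂N))) := by
  have hmeas : ∀ q, Measurable fun y => mixLaplace (μ q) (Q y) := fun q =>
    (measurable_mixLaplace (μ q)).comp hQ
  have hint : ∀ q, Integrable (fun y => mixLaplace (μ q) (Q y)) N := fun q =>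
    Integrable.of_bound (C := 1) (hmeas q).aestronglyMeasurable (ae_of_all _ fun y => by
      rw [Real.norm_of_nonneg (mixLaplace_nonneg _ _)]
      exact mixLaplace_le_one (hμ q) (hQ0 y))
  have h1 : Tendsto (fun q : ℕ+ => ∫ y, (q : ℝ) * (1 - mixLaplace (μ q) (Q y)) ∂N) atTop
      (𝓝 (∫ y, levyExponent a ρ (Q y) ∂N)) := by
    have hb := tendsto_mul_one_sub_mixLaplace hΛ hμ hlim zero_le_one
    refine tendsto_integral_filter_of_dominated_convergence
      (fun y => (1 + Q y) * (levyExponent a ρ 1 + 1))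
      (Eventually.of_forall fun q =>
        (((hmeas q).const_sub 1).const_mul _).aestronglyMeasurable) ?_
      (((integrable_const 1).add hQi).mul_const _)
      (ae_of_all _ fun y => tendsto_mul_one_sub_mixLaplace hΛ hμ hlim (hQ0 y))
    filter_upwards [hb.eventually (gt_mem_nhds (lt_add_one _))] with q hq
    refine ae_of_all _ fun y => ?_
    have hq0 : (0 : ℝ) ≤ (q : ℕ) := Nat.cast_nonneg _
    have h2 := one_sub_mixLaplace_le (hμ q) (hQ0 y)
    have h3 := mixLaplace_le_one (hμ q) (hQ0 y)
    rw [Real.norm_of_nonneg (mul_nonneg hq0 (by linarith))]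
    calc (q : ℝ) * (1 - mixLaplace (μ q) (Q y))
        ≤ q * ((1 + Q y) * (1 - mixLaplace (μ q) 1)) := mul_le_mul_of_nonneg_left h2 hq0
      _ = (1 + Q y) * (q * (1 - mixLaplace (μ q) 1)) := by ring
      _ ≤ _ := mul_le_mul_of_nonneg_left hq.le (by have := hQ0 y; linarith)
  refine (tendsto_one_sub_div_pow h1).congr fun q => ?_
  congr 1
  have hq0 : ((q : ℕ) : ℝ) ≠ 0 := by exact_mod_cast q.ne_zero
  rw [integral_const_mul, mul_div_cancel_left₀ _ hq0, integral_sub (integrable_const _) (hint q)]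
  simp

theorem IsLevyMeasure.sigmaFinite (hρ : IsLevyMeasure ρ) : SigmaFinite ρ := by
  refine ⟨⟨⟨fun n => Set.Iic 0 ∪ Set.Ici (1 / ((n : ℝ) + 1)), fun _ => trivial, fun n => ?_, ?_⟩⟩⟩
  · refine (measure_union_le _ _).trans_lt (ENNReal.add_lt_top.2 ⟨?_, ?_⟩)
    · rw [hρ.carried]; exact ENNReal.zero_lt_top
    · exact hρ.measure_Ici_lt_top (by positivity)
  · refine Set.eq_univ_of_forall fun x => Set.mem_iUnion.2 ?_
    rcases le_or_gt x 0 with hx | hx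
    · exact ⟨0, Or.inl hx⟩
    · obtain ⟨n, hn⟩ := exists_nat_one_div_lt hx
      exact ⟨n, Or.inr hn.le⟩

theorem IsLevyMeasure.ae_pos (hρ : IsLevyMeasure ρ) : ∀ᵐ w ∂ρ, 0 < w := by
  rw [ae_iff]
  simpa [Set.Iic] using hρ.carried

theorem IsLevyMeasure.lintegral_one_sub_exp_le (hρ : IsLevyMeasure ρ) {s : ℝ} (hs : 0 ≤ s) :
    ∫⁻ w, ENNReal.ofReal (1 - Real.exp (-(w * s))) ∂ρ
      ≤ ENNReal.ofReal (1 + s) * ∫⁻ w, ENNReal.ofReal (min 1 w) ∂ρ := by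
  rw [← lintegral_const_mul _ (by fun_prop)]
  refine lintegral_mono_ae ?_
  filter_upwards [hρ.ae_pos] with w hw
  rw [← ENNReal.ofReal_mul (by linarith)]
  refine ENNReal.ofReal_le_ofReal ?_
  rw [mul_comm w s]
  refine (one_sub_exp_neg_mul_le hs hw.le).trans
    (mul_le_mul_of_nonneg_left (le_min ?_ ?_) (by linarith))
  · have := Real.exp_pos (-w); linarith
  · have := Real.add_one_le_exp (-w); linarith

theorem levyExponent_eq (hρ : IsLevyMeasure ρ) {s : ℝ} (hs : 0 ≤ s) :
    levyExponent a ρ s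
      = s * a + (∫⁻ w, ENNReal.ofReal (1 - Real.exp (-(w * s))) ∂ρ).toReal := by
  rw [levyExponent, integral_eq_lintegral_of_nonneg_ae _ (by fun_prop)]
  filter_upwards [hρ.ae_pos] with w hw
  have := exp_neg_mul_le_one hw.le hs
  simpa using this

/-- The Laplace functional of the Poisson process with independent Gaussian marks is obtained by
interchanging the integrals over the mean measure and over the law of the marks. -/
theorem exp_neg_integral_levyExponent {n : ℕ} {S : Matrix (Fin n) (Fin n) ℝ}
    {Q : EuclideanSpace ℝ (Fin n) → ℝ} (hQ : Measurable Q) (hQ0 : ∀ y, 0 ≤ Q y)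
    (hQi : Integrable Q (multivariateGaussian 0 S)) (hρ : IsLevyMeasure ρ) :
    Real.exp (-∫ y, levyExponent a ρ (Q y) ∂(multivariateGaussian 0 S))
      = Real.exp (-(a * ∫ y, Q y ∂(multivariateGaussian 0 S))) * markedLaplace ρ Q S := by
  have := hρ.sigmaFinite
  set N : Measure (EuclideanSpace ℝ (Fin n)) := multivariateGaussian 0 S
  let ψ : EuclideanSpace ℝ (Fin n) → ℝ≥0∞ := fun y =>
    ∫⁻ w, ENNReal.ofReal (1 - Real.exp (-(w * Q y))) ∂ρ
  have hmeas : Measurable fun p : EuclideanSpace ℝ (Fin n) × ℝ =>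
      ENNReal.ofReal (1 - Real.exp (-(p.2 * Q p.1))) := by
    have : Measurable fun p : EuclideanSpace ℝ (Fin n) × ℝ => Q p.1 := hQ.comp measurable_fst
    fun_prop
  have hψ : Measurable ψ := hmeas.lintegral_prod_right'
  have hψt : ∀ y, ψ y < ∞ := fun y =>
    (hρ.lintegral_one_sub_exp_le (hQ0 y)).trans_lt
      (ENNReal.mul_lt_top ENNReal.ofReal_lt_top hρ.lintegral_lt_top)
  have hfin : ∫⁻ y, ψ y ∂N < ∞ := by
    refine (lintegral_mono fun y => hρ.lintegral_one_sub_exp_le (hQ0 y)).trans_lt ?_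
    rw [lintegral_mul_const _ (by fun_prop)]
    refine ENNReal.mul_lt_top ?_ hρ.lintegral_lt_top
    have h1 : Integrable (fun y => 1 + Q y) N := (integrable_const 1).add hQi
    exact h1.lintegral_lt_top
  have hψi : Integrable (fun y => (ψ y).toReal) N :=
    integrable_toReal_of_lintegral_ne_top hψ.aemeasurable hfin.ne
  have e1 : ∫ y, levyExponent a ρ (Q y) ∂N = a * ∫ y, Q y ∂N + (∫⁻ y, ψ y ∂N).toReal := by
    simp_rw [fun y => levyExponent_eq (a := a) hρ (hQ0 y)]
    rw [integral_add (hQi.mul_const _) hψi, integral_mul_const, mul_comm a,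
      integral_toReal hψ.aemeasurable (ae_of_all _ hψt)]
  have e2 : ∫⁻ y, ψ y ∂N = ∫⁻ w, ENNReal.ofReal (1 - gaussianLaplace Q S w) ∂ρ := by
    rw [lintegral_lintegral_swap hmeas.aemeasurable]
    refine lintegral_congr_ae ?_
    filter_upwards [hρ.ae_pos] with w hw
    have hi := integrable_exp_neg_mul hw.le hQ hQ0 N
    have hi' : Integrable (fun y => 1 - Real.exp (-(w * Q y))) N := (integrable_const 1).sub hi
    rw [← ofReal_integral_eq_lintegral_ofReal hi'
      (ae_of_all _ fun y => by have := exp_neg_mul_le_one hw.le (hQ0 y); simpa using this),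
      integral_sub (integrable_const 1) hi]
    simp [gaussianLaplace, N]
  rw [e1, neg_add, Real.exp_add, markedLaplace, ← e2]
  congr 1
  rw [← expNeg_ofReal ENNReal.toReal_nonneg, ENNReal.ofReal_toReal hfin.ne]

end

/-! ### One layer of the network -/

section
variable {q m n : ℕ}

/-- The pre-activations of a layer with `m` nodes, as a function of the pre-activations of the
previous layer, of its node variances, and of the Gaussian factors and biases. -/
def layerMap (φ : ℝ → ℝ) (m : ℕ) (u : (Fin q → EuclideanSpace ℝ (Fin n)) × (Fin q → ℝ) ×
    (((Fin q × Fin m) ⊕ Fin m) → ℝ)) : Fin m → EuclideanSpace ℝ (Fin n) :=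
  fun k => WithLp.toLp 2 fun r =>
    ∑ j, Real.sqrt (u.2.1 j) * u.2.2 (Sum.inl (j, k)) * φ (u.1 j r) + u.2.2 (Sum.inr k)

theorem continuous_layerMap {φ : ℝ → ℝ} (hφ : Continuous φ) :
    Continuous (layerMap φ m : _ × (Fin q → ℝ) × _ → Fin m → EuclideanSpace ℝ (Fin n)) := by
  refine continuous_pi fun k => (PiLp.continuous_toLp 2 _).comp (continuous_pi fun r => ?_)
  fun_prop

/-- The law of the Gaussian factors and biases of a layer. -/
def gaussianParams (σb σv : ℝ≥0) (q m : ℕ) :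
    ProbabilityMeasure (((Fin q × Fin m) ⊕ Fin m) → ℝ) :=
  ProbabilityMeasure.pi (Sum.elim (fun _ => ⟨gaussianReal 0 (σv ^ 2), inferInstance⟩)
    fun _ => ⟨gaussianReal 0 (σb ^ 2), inferInstance⟩)

/-- The law of the pre-activations of a layer, when the pre-activations of the previous layer
have law `ν` and its node variances are iid with law `μ`. -/
def layerStep {φ : ℝ → ℝ} (hφ : Continuous φ) (σb σv : ℝ≥0) (μ : ProbabilityMeasure ℝ)
    (ν : ProbabilityMeasure (Fin q → EuclideanSpace ℝ (Fin n))) (m : ℕ) :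
    ProbabilityMeasure (Fin m → EuclideanSpace ℝ (Fin n)) :=
  (ν.prod ((ProbabilityMeasure.pi fun _ => μ).prod (gaussianParams σb σv q m))).map
    (continuous_layerMap (m := m) hφ).measurable.aemeasurable

theorem continuous_layerStep {φ : ℝ → ℝ} (hφ : Continuous φ) (σb σv : ℝ≥0)
    (μ : ProbabilityMeasure ℝ) (m : ℕ) :
    Continuous fun ν : ProbabilityMeasure (Fin q → EuclideanSpace ℝ (Fin n)) =>
      layerStep hφ σb σv μ ν m :=
  (ProbabilityMeasure.continuous_map (continuous_layerMap hφ)).comp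
    (ProbabilityMeasure.continuous_prod.comp (continuous_id.prodMk continuous_const))

theorem integral_exp_linear_pi_gaussianReal {ι : Type*} [Fintype ι] (v : ι → ℝ≥0) (c : ι → ℝ) :
    ∫ w : ι → ℝ, Complex.exp ((∑ s, w s * c s : ℝ) * Complex.I)
        ∂(Measure.pi fun s => gaussianReal 0 (v s))
      = (Real.exp (-∑ s, v s * c s ^ 2 / 2) : ℝ) := by
  have h : ∀ w : ι → ℝ, Complex.exp ((∑ s, w s * c s : ℝ) * Complex.I)
      = ∏ s, Complex.exp ((w s * c s : ℝ) * Complex.I) := fun w => by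
    rw [← Complex.exp_sum, ← Finset.sum_mul]
    push_cast
    rfl
  simp_rw [h]
  rw [integral_fintype_prod_eq_prod (𝕜 := ℂ)
    fun s (y : ℝ) => Complex.exp ((y * c s : ℝ) * Complex.I)]
  have h2 : ∀ s, ∫ y, Complex.exp ((y * c s : ℝ) * Complex.I) ∂(gaussianReal 0 (v s))
      = (Real.exp (-(v s * c s ^ 2 / 2)) : ℝ) := fun s => by
    have h3 := charFun_gaussianReal (μ := 0) (v := v s) (c s)
    rw [charFun_apply_real] at h3
    have h4 : ∀ y : ℝ, ((y * c s : ℝ) : ℂ) * Complex.I = c s * y * Complex.I := fun y => by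
      push_cast; ring
    simp_rw [h4]
    rw [h3]
    push_cast
    congr 1
    ring
  simp_rw [h2]
  rw [← Complex.ofReal_prod, ← Real.exp_sum, Finset.sum_neg_distrib]

theorem sum_inner_layerMap (φ : ℝ → ℝ) (u : (Fin q → EuclideanSpace ℝ (Fin n)) × (Fin q → ℝ) ×
    (((Fin q × Fin m) ⊕ Fin m) → ℝ)) (t : Fin m → EuclideanSpace ℝ (Fin n)) :
    ∑ k, inner ℝ (layerMap φ m u k) (t k)
      = ∑ s, u.2.2 s * Sum.elim (fun jk : Fin q × Fin m =>
          Real.sqrt (u.2.1 jk.1) * readout φ (t jk.2) (u.1 jk.1)) (fun k => ∑ r, t k r) s := by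
  rw [Fintype.sum_sum_type, Fintype.sum_prod_type, Finset.sum_comm, ← Finset.sum_add_distrib]
  refine Finset.sum_congr rfl fun k _ => ?_
  rw [PiLp.inner_apply]
  simp only [layerMap, Sum.elim_inl, Sum.elim_inr, readout]
  simp only [RCLike.inner_apply, conj_trivial]
  simp only [mul_add, Finset.sum_add_distrib, Finset.mul_sum]
  rw [Finset.sum_comm]
  congr 1
  · refine Finset.sum_congr rfl fun j _ => Finset.sum_congr rfl fun r _ => by ring
  · refine Finset.sum_congr rfl fun r _ => by ring

/-- The Gaussian factors and the biases are integrated out. -/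
theorem integral_layerMap_gaussianParams (φ : ℝ → ℝ) (σb σv : ℝ≥0)
    (z : Fin q → EuclideanSpace ℝ (Fin n)) (w : Fin q → ℝ) (t : Fin m → EuclideanSpace ℝ (Fin n)) :
    ∫ y, Complex.exp ((∑ k, inner ℝ (layerMap φ m (z, w, y) k) (t k) : ℝ)
        * Complex.I) ∂(gaussianParams σb σv q m : Measure (((Fin q × Fin m) ⊕ Fin m) → ℝ))
      = (Real.exp (-biasQuad σb t)
          * ∏ j, Real.exp (-(quadAct σv φ t (z j) * Real.sqrt (w j) ^ 2)) : ℝ) := by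
  simp_rw [sum_inner_layerMap]
  have hpi : (gaussianParams σb σv q m : Measure (((Fin q × Fin m) ⊕ Fin m) → ℝ))
      = Measure.pi fun s => gaussianReal 0
        ((Sum.elim (fun _ => σv ^ 2) (fun _ => σb ^ 2) : (Fin q × Fin m) ⊕ Fin m → ℝ≥0) s) := by
    rw [gaussianParams, ProbabilityMeasure.toMeasure_pi]
    congr 1
    funext s
    rcases s with s | s <;> rfl
  rw [hpi, integral_exp_linear_pi_gaussianReal, ← Real.exp_sum, ← Real.exp_add,
    Fintype.sum_sum_type, Fintype.sum_prod_type]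
  congr 2
  simp only [Sum.elim_inl, Sum.elim_inr, biasQuad, quadAct, Finset.sum_neg_distrib,
    Finset.mul_sum, Finset.sum_mul]
  rw [neg_add, add_comm]
  congr 2
  · refine Finset.sum_congr rfl fun k _ => by push_cast; ring
  · refine Finset.sum_congr rfl fun j _ => Finset.sum_congr rfl fun k _ => by push_cast; ring

/-- Given the previous layer, the pre-activations are mixtures of Gaussian vectors; the node
variances enter through their Laplace transform at `quadAct`. -/
theorem jointCharFun_layerStep {φ : ℝ → ℝ} (hφ : Continuous φ) (σb σv : ℝ≥0)
    {μ : ProbabilityMeasure ℝ} (hμ : (μ : Measure ℝ) (Set.Iio 0) = 0)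
    (ν : ProbabilityMeasure (Fin q → EuclideanSpace ℝ (Fin n)))
    (t : Fin m → EuclideanSpace ℝ (Fin n)) :
    jointCharFun (layerStep hφ σb σv μ ν m : Measure (Fin m → EuclideanSpace ℝ (Fin n))) t
      = (Real.exp (-biasQuad σb t) *
          ∫ z, ∏ j, mixLaplace μ (quadAct σv φ t (z j)) ∂ν.toMeasure : ℝ) := by
  have hc := continuous_layerMap (q := q) (m := m) (n := n) hφ
  have hc' : Continuous fun u : (Fin q → EuclideanSpace ℝ (Fin n)) × (Fin q → ℝ) ×
      (((Fin q × Fin m) ⊕ Fin m) → ℝ) =>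
      Complex.exp ((∑ k, inner ℝ (layerMap φ m u k) (t k) : ℝ) * Complex.I) := by
    have := fun k => (continuous_apply k).comp hc
    simp only [Function.comp_def] at this
    fun_prop
  have hint : ∀ (M : Measure ((Fin q → EuclideanSpace ℝ (Fin n)) × (Fin q → ℝ) ×
      (((Fin q × Fin m) ⊕ Fin m) → ℝ))) [IsFiniteMeasure M], Integrable (fun u =>
      Complex.exp ((∑ k, inner ℝ (layerMap φ m u k) (t k) : ℝ) * Complex.I)) M := fun M _ =>
    Integrable.of_bound hc'.aestronglyMeasurable 1 (ae_of_all _ fun u =>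
      norm_exp_ofReal_mul_I_le _)
  have hint2 : ∀ (z : Fin q → EuclideanSpace ℝ (Fin n)) (M : Measure ((Fin q → ℝ) ×
      (((Fin q × Fin m) ⊕ Fin m) → ℝ))) [IsFiniteMeasure M], Integrable (fun u =>
      Complex.exp ((∑ k, inner ℝ (layerMap φ m (z, u) k) (t k) : ℝ) * Complex.I)) M :=
    fun z M _ => Integrable.of_bound
      (hc'.comp (by fun_prop : Continuous fun u => (z, u))).aestronglyMeasurable 1
      (ae_of_all _ fun u => norm_exp_ofReal_mul_I_le _)
  rw [layerStep, jointCharFun, ProbabilityMeasure.toMeasure_map,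
    integral_map hc.measurable.aemeasurable (continuous_jointChar t).aestronglyMeasurable,
    ProbabilityMeasure.toMeasure_prod, integral_prod _ (hint _), ← integral_const_mul,
    ← integral_complex_ofReal]
  refine integral_congr_ae (ae_of_all _ fun z => ?_)
  simp only
  rw [ProbabilityMeasure.toMeasure_prod, integral_prod _ (hint2 z _)]
  simp_rw [integral_layerMap_gaussianParams]
  rw [integral_complex_ofReal, integral_const_mul]
  congr 2
  rw [ProbabilityMeasure.toMeasure_pi, integral_fintype_prod_eq_prod (𝕜 := ℝ)
    fun j (w : ℝ) => Real.exp (-(quadAct σv φ t (z j) * Real.sqrt w ^ 2))]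
  refine Finset.prod_congr rfl fun j _ => ?_
  refine integral_congr_ae ?_
  filter_upwards [ae_nonneg_of_measure_Iio hμ] with w hw
  rw [Real.sq_sqrt hw]

/-- One layer of large width, with conditionally Gaussian pre-activations in the previous layer. -/
theorem tendsto_layerStep {Ω X : Type*} [MeasurableSpace Ω] {P : Measure Ω}
    [IsProbabilityMeasure P]
    {K : Ω → X → X → ℝ} (hK : Measurable K) (x : Fin n → X) {φ : ℝ → ℝ} (hφ : Continuous φ)
    (henv : ∃ A B C : ℝ, 0 < A ∧ 0 < B ∧ 0 < C ∧ ∀ z : ℝ, |φ z| ≤ A + B * |z| ^ C)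
    (σb σv : ℝ≥0) {a : ℝ} {ρ : Measure ℝ} (hρ : IsLevyMeasure ρ)
    {Λ : ProbabilityMeasure ℝ} (hΛ : IsIDLaw a ρ Λ) {μ : ℕ+ → ProbabilityMeasure ℝ}
    (hμ : ∀ q, (μ q : Measure ℝ) (Set.Iio 0) = 0)
    (hlim : Tendsto (fun q : ℕ+ => iidSumLaw q (μ q)) atTop (𝓝 Λ))
    {ν : ∀ q, ProbabilityMeasure (Fin q → EuclideanSpace ℝ (Fin n))}
    (hν : ∀ q, (ν q).toMeasure = P.bind fun ω => iidGaussian (K ω) x q)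
    {ν' : ProbabilityMeasure (Fin m → EuclideanSpace ℝ (Fin n))}
    (hν' : ∀ t, jointCharFun (ν' : Measure (Fin m → EuclideanSpace ℝ (Fin n))) t
      = (Real.exp (-biasQuad σb t) * ∫ ω,
          Real.exp (-(a * ∫ y, quadAct σv φ t y ∂(multivariateGaussian 0 (gramMatrix (K ω) x)))) *
          markedLaplace ρ (quadAct σv φ t) (gramMatrix (K ω) x) ∂P : ℝ)) :
    Tendsto (fun q : ℕ+ => layerStep hφ σb σv (μ q) (ν q) m) atTop (𝓝 ν') := by
  refine tendsto_of_tendsto_jointCharFun fun t => ?_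
  have hQ := (continuous_quadAct σv hφ t).measurable
  have hQ0 := quadAct_nonneg σv φ t
  have hmix : ∀ q : ℕ+, Measurable fun y => mixLaplace (μ q) (quadAct σv φ t y) := fun q =>
    (measurable_mixLaplace (μ q)).comp hQ
  have hmix1 : ∀ (q : ℕ+) y, ‖mixLaplace (μ q) (quadAct σv φ t y)‖ ≤ 1 := fun q y => by
    rw [Real.norm_of_nonneg (mixLaplace_nonneg _ _)]
    exact mixLaplace_le_one (hμ q) (hQ0 y)
  have e : ∀ q : ℕ+, ∫ z, ∏ j, mixLaplace (μ q) (quadAct σv φ t (z j)) ∂(ν q).toMeasure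
      = ∫ ω, (∫ y, mixLaplace (μ q) (quadAct σv φ t y)
          ∂(multivariateGaussian 0 (gramMatrix (K ω) x))) ^ (q : ℕ) ∂P := by
    intro q
    have hprod : Measurable fun z : Fin q → EuclideanSpace ℝ (Fin n) =>
        ∏ j, mixLaplace (μ q) (quadAct σv φ t (z j)) :=
      Finset.measurable_fun_prod _ fun j _ => (hmix q).comp (measurable_pi_apply j)
    rw [hν q, integral_bind_iidGaussian hK x q hprod.stronglyMeasurable (C := 1) fun y => by
      rw [norm_prod]
      exact Finset.prod_le_one (fun _ _ => norm_nonneg _) fun j _ => hmix1 q _]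
    refine integral_congr_ae (ae_of_all _ fun ω => ?_)
    simp only [iidGaussian]
    rw [integral_fintype_prod_eq_pow (𝕜 := ℝ) fun y => mixLaplace (μ q) (quadAct σv φ t y),
      Fintype.card_fin]
  have hlimω : ∀ ω, Tendsto (fun q : ℕ+ => (∫ y, mixLaplace (μ q) (quadAct σv φ t y)
      ∂(multivariateGaussian 0 (gramMatrix (K ω) x))) ^ (q : ℕ)) atTop
      (𝓝 (Real.exp (-(a * ∫ y, quadAct σv φ t y
        ∂(multivariateGaussian 0 (gramMatrix (K ω) x)))) *
        markedLaplace ρ (quadAct σv φ t) (gramMatrix (K ω) x))) := fun ω => by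
    have hi := integrable_quadAct σv hφ henv (gramMatrix (K ω) x) t
    rw [← exp_neg_integral_levyExponent hQ hQ0 hi hρ]
    exact tendsto_integral_mixLaplace_pow hQ hQ0 hi hΛ hμ hlim
  have hmain : Tendsto (fun q : ℕ+ => ∫ ω, (∫ y, mixLaplace (μ q) (quadAct σv φ t y)
          ∂(multivariateGaussian 0 (gramMatrix (K ω) x))) ^ (q : ℕ) ∂P) atTop
      (𝓝 (∫ ω, Real.exp (-(a * ∫ y, quadAct σv φ t y
          ∂(multivariateGaussian 0 (gramMatrix (K ω) x)))) *
          markedLaplace ρ (quadAct σv φ t) (gramMatrix (K ω) x) ∂P)) := by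
    refine tendsto_integral_filter_of_dominated_convergence (fun _ => 1)
      (Eventually.of_forall fun q => ?_) (Eventually.of_forall fun q => ae_of_all _ fun ω => ?_)
      (integrable_const _) (ae_of_all _ hlimω)
    · have h1 : StronglyMeasurable fun S : Matrix (Fin n) (Fin n) ℝ =>
          ∫ y, mixLaplace (μ q) (quadAct σv φ t y) ∂(multivariateGaussian 0 S) :=
        (hmix q).stronglyMeasurable.integral_kernel (κ := gaussianVec n)
      exact (((h1.measurable.comp (measurable_gramMatrix x)).comp hK).pow_const
        _).aestronglyMeasurable
    · rw [norm_pow]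
      refine pow_le_one₀ (norm_nonneg _) ?_
      refine (norm_integral_le_of_norm_le_const (C := 1) (ae_of_all _ (hmix1 q))).trans ?_
      simp
  simp_rw [hν', jointCharFun_layerStep hφ σb σv (hμ _), e]
  exact (Complex.continuous_ofReal.tendsto _).comp (hmain.const_mul _)

end

/-! ### Iterated limits -/

theorem IteratedTendsto.map {E F : Type*} [TopologicalSpace E] [TopologicalSpace F] {G : E → F}
    (hG : Continuous G) : ∀ {L : ℕ} {f : (Fin L → ℕ+) → E} {e : E}, IteratedTendsto L f e →
      IteratedTendsto L (fun p => G (f p)) (G e)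
  | 0, _, _, h => congrArg G h
  | _ + 1, _, _, ⟨g, hg, h⟩ =>
    ⟨fun k => G (g k), (hG.tendsto _).comp hg, h.mono fun _ hk => IteratedTendsto.map hG hk⟩

/-- Further variables, of which only the size matters, do not affect an iterated limit. -/
theorem IteratedTendsto.extend {E : Type*} [TopologicalSpace E] {l L : ℕ} (hl : l ≤ L) (m : ℕ)
    {f₀ : (Fin l → ℕ+) → E} {e : E} (h : IteratedTendsto l f₀ e) {f : (Fin L → ℕ+) → E}
    (hf : ∀ p : Fin L → ℕ+, (∀ i : Fin L, l ≤ i → m ≤ p i) →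
      f p = f₀ fun i => p (Fin.castLE hl i)) :
    IteratedTendsto L f e := by
  induction L, hl using Nat.le_induction with
  | base =>
    have : f = f₀ := funext fun p => hf p fun i hi => absurd i.2 (by omega)
    rwa [this]
  | succ L hl ih =>
    refine ⟨fun _ => e, tendsto_const_nhds, ?_⟩
    filter_upwards [eventually_ge_atTop (Nat.toPNat' m)] with k hk
    refine ih fun p hp => ?_
    rw [hf]
    · congr 1
      funext i
      exact Fin.snoc_castSucc (α := fun _ => ℕ+) k p (Fin.castLE hl i)
    · intro i
      refine Fin.lastCases (fun _ => ?_) (fun i hi => ?_) i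
      · rw [Fin.snoc_last]
        rcases Nat.eq_zero_or_pos m with rfl | hm
        · exact Nat.zero_le _
        · rw [← PNat.coe_le_coe, Nat.toPNat'_coe, if_pos hm] at hk
          exact hk
      · rw [Fin.snoc_castSucc]
        exact hp i hi

/-! ### The laws of the network -/

section
variable {n : ℕ} {φ : ℝ → ℝ}

/-- The law of the first `m` nodes of layer `l + 1` in a network with hidden widths `p`, computed
layer by layer from the laws `ν₀ m` at the first layer. -/
def netLaw (hφ : Continuous φ) (σb σv : ℝ≥0)
    (ν₀ : ∀ m, ProbabilityMeasure (Fin m → EuclideanSpace ℝ (Fin n))) :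
    (l : ℕ) → (Fin l → ℕ+ → ProbabilityMeasure ℝ) → (Fin l → ℕ+) → (m : ℕ) →
      ProbabilityMeasure (Fin m → EuclideanSpace ℝ (Fin n))
  | 0, _, _, m => ν₀ m
  | l + 1, μ, p, m => layerStep hφ σb σv (μ (Fin.last l) (p (Fin.last l)))
      (netLaw hφ σb σv ν₀ l (fun i => μ i.castSucc) (fun i => p i.castSucc) (p (Fin.last l))) m

theorem netLaw_succ (hφ : Continuous φ) (σb σv : ℝ≥0)
    (ν₀ : ∀ m, ProbabilityMeasure (Fin m → EuclideanSpace ℝ (Fin n))) {l : ℕ}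
    (μ : Fin (l + 1) → ℕ+ → ProbabilityMeasure ℝ) {p : Fin (l + 1) → ℕ+} {p' : Fin l → ℕ+}
    {k : ℕ+} (hk : p (Fin.last l) = k) (hp : (fun i => p i.castSucc) = p') (m : ℕ) :
    netLaw hφ σb σv ν₀ (l + 1) μ p m
      = layerStep hφ σb σv (μ (Fin.last l) k)
          (netLaw hφ σb σv ν₀ l (fun i => μ i.castSucc) p' k) m := by
  subst hk hp; rfl

end

/-- For an independent family, a random variable `Z` which is a function of the members in `S`,
and two disjoint subfamilies outside `S`, are independent. -/
theorem map_prodMk_of_iIndepFun {Ω ι ι₁ ι₂ F : Type*} [MeasurableSpace Ω] {P : Measure Ω}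
    [IsProbabilityMeasure P] [Finite ι] [Fintype ι₁] [Fintype ι₂] [MeasurableSpace F]
    {X : ι → Ω → ℝ} (hX : ∀ i, AEMeasurable (X i) P) (h : iIndepFun X P) (S : Finset ι)
    {f : ι₁ → ι} {g : ι₂ → ι} (hfg : Function.Injective (Sum.elim f g))
    (hS : ∀ s, Sum.elim f g s ∉ S) {Z : Ω → F} (hZ : AEMeasurable Z P)
    (hZS : Measurable[MeasurableSpace.comap (fun ω (s : S) => X s ω) MeasurableSpace.pi] Z) :
    P.map (fun ω => (Z ω, (fun j => X (f j) ω), fun j => X (g j) ω))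
      = (P.map Z).prod ((Measure.pi fun j => P.map (X (f j))).prod
          (Measure.pi fun j => P.map (X (g j)))) := by
  classical
  have hf : Function.Injective f := fun i j hij => Sum.inl_injective (hfg (by simpa using hij))
  have hg : Function.Injective g := fun i j hij => Sum.inr_injective (hfg (by simpa using hij))
  have hpi₁ : AEMeasurable (fun ω j => X (f j) ω) P := aemeasurable_pi_lambda _ fun j => hX _
  have hpi₂ : AEMeasurable (fun ω j => X (g j) ω) P := aemeasurable_pi_lambda _ fun j => hX _
  have h1 : IndepFun (fun ω j => X (f j) ω) (fun ω j => X (g j) ω) P := by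
    have hd : Disjoint (Finset.univ.image f) (Finset.univ.image g) := by
      rw [Finset.disjoint_left]
      intro s hs hs'
      obtain ⟨i, -, rfl⟩ := Finset.mem_image.1 hs
      obtain ⟨j, -, hj⟩ := Finset.mem_image.1 hs'
      have := hfg (a₁ := Sum.inr j) (a₂ := Sum.inl i) (by simpa using hj)
      simp at this
    have := iIndepFun.indepFun_finset₀ _ _ hd h hX
    exact this.comp
      (φ := fun (v : ↥(Finset.univ.image f) → ℝ) (j : ι₁) =>
        v ⟨f j, Finset.mem_image_of_mem f (Finset.mem_univ j)⟩)
      (ψ := fun (v : ↥(Finset.univ.image g) → ℝ) (j : ι₂) =>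
        v ⟨g j, Finset.mem_image_of_mem g (Finset.mem_univ j)⟩)
      (by fun_prop) (by fun_prop)
  have h2 : IndepFun Z (fun ω => ((fun j => X (f j) ω), fun j => X (g j) ω)) P := by
    have hd : Disjoint S (Finset.univ.image (Sum.elim f g)) := by
      rw [Finset.disjoint_right]
      intro s hs
      obtain ⟨i, -, rfl⟩ := Finset.mem_image.1 hs
      exact hS i
    have h3 := iIndepFun.indepFun_finset₀ _ _ hd h hX
    have h4 := h3.comp (φ := id)
      (ψ := fun (v : ↥(Finset.univ.image (Sum.elim f g)) → ℝ) =>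
        ((fun j => v ⟨f j, Finset.mem_image_of_mem (Sum.elim f g) (Finset.mem_univ (Sum.inl j))⟩),
          fun j => v ⟨g j, Finset.mem_image_of_mem (Sum.elim f g) (Finset.mem_univ (Sum.inr j))⟩))
        measurable_id (by fun_prop)
    rw [IndepFun_iff_Indep] at h4 ⊢
    exact indep_of_indep_of_le_left h4 hZS.comap_le
  rw [(indepFun_iff_map_prod_eq_prod_map_map hZ (hpi₁.prodMk hpi₂)).1 h2,
    (indepFun_iff_map_prod_eq_prod_map_map hpi₁ hpi₂).1 h1,
    (iIndepFun_iff_map_fun_eq_pi_map fun j => hX _).1 (h.precomp hf),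
    (iIndepFun_iff_map_fun_eq_pi_map fun j => hX _).1 (h.precomp hg)]

section
variable {L d dout n : ℕ} {Ω : Type*} [MeasurableSpace Ω] {σb σv : ℝ≥0}
  {μ : Fin L → ℕ+ → ProbabilityMeasure ℝ} {p : Fin L → ℕ+} {P : Measure Ω}
  {lam : Fin L → ℕ → Ω → ℝ} {V : Fin (L + 1) → ℕ → ℕ → Ω → ℝ} {B : Fin (L + 1) → ℕ → Ω → ℝ}
  {φ : ℝ → ℝ}

theorem layerWidth_castSucc_succ (d dout : ℕ) (p : Fin L → ℕ+) (i : Fin L) :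
    layerWidth d dout p i.castSucc.succ = p i := by
  rw [layerWidth, Fin.cons_succ, Fin.snoc_castSucc]

theorem layerWidth_succ_castSucc (d dout : ℕ) (p : Fin L → ℕ+) (i : Fin L) :
    layerWidth d dout p i.succ.castSucc = p i :=
  layerWidth_castSucc_succ d dout p i

theorem layerWidth_last (d dout : ℕ) (p : Fin L → ℕ+) :
    layerWidth d dout p (Fin.last L).succ = dout := by
  rw [layerWidth, Fin.cons_succ, Fin.snoc_last]

/-- The layer at which a parameter enters, numbered from `0`. -/
def paramLayer (d dout : ℕ) (p : Fin L → ℕ+) :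
    ((Σ i : Fin L, Fin (p i)) ⊕
      (Σ i : Fin (L + 1),
        Fin (layerWidth d dout p i.castSucc) × Fin (layerWidth d dout p i.succ)) ⊕
      (Σ i : Fin (L + 1), Fin (layerWidth d dout p i.succ))) → ℕ
  | Sum.inl ⟨i, _⟩ => i + 1
  | Sum.inr (Sum.inl ⟨i, _⟩) => i
  | Sum.inr (Sum.inr ⟨i, _⟩) => i

theorem IsNetwork.aemeasurable_networkParams (h : IsNetwork d dout σb σv μ p P lam V B) :
    ∀ s, AEMeasurable (networkParams d dout p lam V B s) P
  | Sum.inl ⟨i, j⟩ => h.aemeasurable_lam i j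
  | Sum.inr (Sum.inl ⟨i, j, k⟩) => h.aemeasurable_V i j k
  | Sum.inr (Sum.inr ⟨i, k⟩) => h.aemeasurable_B i k

/-- The pre-activations of a layer are functions of the parameters of this layer and of the
previous ones. -/
theorem measurable_preact_comap (hφ : Continuous φ) (lam : Fin L → ℕ → Ω → ℝ)
    (V : Fin (L + 1) → ℕ → ℕ → Ω → ℝ) (B : Fin (L + 1) → ℕ → Ω → ℝ)
    (x : EuclideanSpace ℝ (Fin d)) (l : Fin (L + 1)) {k : ℕ}
    (hk : k < layerWidth d dout p l.succ)
    (S : Finset ((Σ i : Fin L, Fin (p i)) ⊕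
      (Σ i : Fin (L + 1),
        Fin (layerWidth d dout p i.castSucc) × Fin (layerWidth d dout p i.succ)) ⊕
      (Σ i : Fin (L + 1), Fin (layerWidth d dout p i.succ))))
    (hS : ∀ s, paramLayer d dout p s ≤ l → s ∈ S) :
    Measurable[MeasurableSpace.comap (fun ω (s : S) => networkParams d dout p lam V B s ω)
      MeasurableSpace.pi] (preact φ p lam V B x l k) := by
  have hmeas : ∀ s ∈ S, Measurable[MeasurableSpace.comap
      (fun ω (s : S) => networkParams d dout p lam V B s ω) MeasurableSpace.pi]
      (networkParams d dout p lam V B s) := fun s hs =>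
    (measurable_pi_apply (X := fun _ : S => ℝ) ⟨s, hs⟩).comp
      (comap_measurable (fun ω (s : S) => networkParams d dout p lam V B s ω))
  induction l using Fin.induction generalizing k with
  | zero =>
    refine Measurable.add (Finset.measurable_fun_sum _ fun j _ =>
      (Measurable.const_mul ?_ _).mul_const _) ?_
    · exact hmeas (Sum.inr (Sum.inl ⟨0, ⟨j, j.2⟩, ⟨k, hk⟩⟩)) (hS _ le_rfl)
    · exact hmeas (Sum.inr (Sum.inr ⟨0, ⟨k, hk⟩⟩)) (hS _ le_rfl)
  | succ i ih =>
    refine Measurable.add (Finset.measurable_fun_sum _ fun j hj =>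
      (Measurable.mul (Measurable.sqrt ?_) ?_).mul (hφ.measurable.comp ?_)) ?_
    · exact hmeas (Sum.inl ⟨i, ⟨j, Finset.mem_range.1 hj⟩⟩) (hS _ le_rfl)
    · exact hmeas (Sum.inr (Sum.inl ⟨i.succ, ⟨j, by
        rw [layerWidth_succ_castSucc]; exact Finset.mem_range.1 hj⟩, ⟨k, hk⟩⟩)) (hS _ le_rfl)
    · refine ih ?_ fun s hs => hS s (hs.trans ?_)
      · rw [layerWidth_castSucc_succ]; exact Finset.mem_range.1 hj
      · simp
    · exact hmeas (Sum.inr (Sum.inr ⟨i.succ, ⟨k, hk⟩⟩)) (hS _ le_rfl)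

theorem measurable_outputs_of_preact {Ω : Type*} {mΩ : MeasurableSpace Ω}
    {lam : Fin L → ℕ → Ω → ℝ} {V : Fin (L + 1) → ℕ → ℕ → Ω → ℝ} {B : Fin (L + 1) → ℕ → Ω → ℝ}
    {x : Fin n → EuclideanSpace ℝ (Fin d)} {l : Fin (L + 1)} {m : ℕ}
    (h : ∀ (k : Fin m) r, Measurable (preact φ p lam V B (x r) l k)) :
    Measurable (outputs φ p lam V B x l m) :=
  measurable_pi_lambda _ fun k => (WithLp.measurable_toLp 2 (Fin n → ℝ)).comp
    (measurable_pi_lambda _ fun r => h k r)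

variable [IsProbabilityMeasure P]

/-- The parameters of a layer are independent of the pre-activations of the previous layer. -/
theorem IsNetwork.outputsLaw_succ (h : IsNetwork d dout σb σv μ p P lam V B) (hφ : Continuous φ)
    (x : Fin n → EuclideanSpace ℝ (Fin d)) (i : Fin L) {m : ℕ}
    (hm : m ≤ layerWidth d dout p i.succ.succ) :
    outputsLaw h hφ x i.succ m
      = layerStep hφ σb σv (μ i (p i)) (outputsLaw h hφ x i.castSucc (p i)) m := by
  classical
  let f : Fin (p i) → ((Σ i : Fin L, Fin (p i)) ⊕
      (Σ i : Fin (L + 1),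
        Fin (layerWidth d dout p i.castSucc) × Fin (layerWidth d dout p i.succ)) ⊕
      (Σ i : Fin (L + 1), Fin (layerWidth d dout p i.succ))) := fun j => Sum.inl ⟨i, j⟩
  let g : (Fin (p i) × Fin m) ⊕ Fin m → ((Σ i : Fin L, Fin (p i)) ⊕
      (Σ i : Fin (L + 1),
        Fin (layerWidth d dout p i.castSucc) × Fin (layerWidth d dout p i.succ)) ⊕
      (Σ i : Fin (L + 1), Fin (layerWidth d dout p i.succ))) :=
    Sum.elim (fun jk => Sum.inr (Sum.inl ⟨i.succ,
        Fin.cast (layerWidth_succ_castSucc d dout p i).symm jk.1, Fin.castLE hm jk.2⟩))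
      fun k => Sum.inr (Sum.inr ⟨i.succ, Fin.castLE hm k⟩)
  have hfg : Function.Injective (Sum.elim f g) := by
    rintro (j | ⟨j, k⟩ | k) (j' | ⟨j', k'⟩ | k') hjk <;>
      simp [f, g, Fin.ext_iff] at hjk ⊢ <;> exact hjk
  let S := Finset.univ.filter fun s => paramLayer d dout p s ≤ (i.castSucc : Fin (L + 1))
  have hS : ∀ s, Sum.elim f g s ∉ S := by
    intro s hs
    have := (Finset.mem_filter.1 hs).2
    rcases s with j | ⟨j, k⟩ | k <;> simp [f, g, paramLayer] at this
  have hZS : Measurable[MeasurableSpace.comap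
      (fun ω (s : S) => networkParams d dout p lam V B s ω) MeasurableSpace.pi]
      (outputs φ p lam V B x i.castSucc (p i)) := by
    refine measurable_outputs_of_preact fun k r => ?_
    refine measurable_preact_comap hφ lam V B (x r) i.castSucc ?_ S fun s hs => by
      simpa [S] using hs
    rw [layerWidth_castSucc_succ]
    exact k.2
  have key := map_prodMk_of_iIndepFun h.aemeasurable_networkParams h.indep S hfg hS
    (h.aemeasurable_outputs hφ x i.castSucc (p i)) hZS
  have hlam : ∀ j, P.map (networkParams d dout p lam V B (f j)) = (μ i (p i) : Measure ℝ) :=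
    fun j => (h.law_lam i j).map_eq
  have hVB : ∀ s, P.map (networkParams d dout p lam V B (g s))
      = (Sum.elim (fun _ => ⟨gaussianReal 0 (σv ^ 2), inferInstance⟩)
          (fun _ => ⟨gaussianReal 0 (σb ^ 2), inferInstance⟩) :
          (Fin (p i) × Fin m) ⊕ Fin m → ProbabilityMeasure ℝ) s := by
    rintro (⟨j, k⟩ | k)
    · exact (h.law_V i.succ (Fin.cast (layerWidth_succ_castSucc d dout p i).symm j)
        (Fin.castLE hm k)).map_eq
    · exact (h.law_B i.succ (Fin.castLE hm k)).map_eq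
  simp_rw [hlam, hVB] at key
  have hX := h.aemeasurable_networkParams
  have hae : AEMeasurable (fun ω => (outputs φ p lam V B x i.castSucc (p i) ω,
      (fun j => networkParams d dout p lam V B (f j) ω),
      fun s => networkParams d dout p lam V B (g s) ω)) P :=
    (h.aemeasurable_outputs hφ x i.castSucc (p i)).prodMk
      ((aemeasurable_pi_lambda _ fun j => hX _).prodMk (aemeasurable_pi_lambda _ fun j => hX _))
  refine Subtype.ext ?_
  change P.map _
    = (layerStep hφ σb σv (μ i (p i)) (outputsLaw h hφ x i.castSucc (p i)) m).toMeasure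
  rw [layerStep, ProbabilityMeasure.toMeasure_map, ProbabilityMeasure.toMeasure_prod,
    ProbabilityMeasure.toMeasure_prod, ProbabilityMeasure.toMeasure_pi, gaussianParams,
    ProbabilityMeasure.toMeasure_pi]
  change _ = Measure.map (layerMap φ m) ((P.map _).prod _)
  rw [← key, AEMeasurable.map_map_of_aemeasurable
    (continuous_layerMap hφ).measurable.aemeasurable hae]
  congr 1
  funext ω k
  simp only [outputs, layerMap, Function.comp_apply]
  congr 1
  funext r
  change ∑ j ∈ Finset.range (p i), Real.sqrt (lam i j ω) * V i.succ j k ω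
    * φ (preact φ p lam V B (x r) i.castSucc j ω) + B i.succ k ω = _
  rw [Finset.sum_range]
  rfl

theorem IsNetwork.outputsLaw_zero (h : IsNetwork d dout σb σv μ p P lam V B) (hφ : Continuous φ)
    (x : Fin n → EuclideanSpace ℝ (Fin d)) {m : ℕ}
    (hm : m ≤ layerWidth d dout p (0 : Fin (L + 1)).succ) :
    (outputsLaw h hφ x 0 m : Measure (Fin m → EuclideanSpace ℝ (Fin n)))
      = iidGaussian (inputKernel d σb σv) x m := by
  refine ext_of_jointCharFun fun t => ?_
  let g : (Fin d × Fin m) ⊕ Fin m → ((Σ i : Fin L, Fin (p i)) ⊕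
      (Σ i : Fin (L + 1),
        Fin (layerWidth d dout p i.castSucc) × Fin (layerWidth d dout p i.succ)) ⊕
      (Σ i : Fin (L + 1), Fin (layerWidth d dout p i.succ))) :=
    Sum.elim (fun jk => Sum.inr (Sum.inl ⟨0, ⟨jk.1, jk.1.2⟩, Fin.castLE hm jk.2⟩))
      fun k => Sum.inr (Sum.inr ⟨0, Fin.castLE hm k⟩)
  have hg : Function.Injective g := by
    rintro (⟨j, k⟩ | k) (⟨j', k'⟩ | k') hjk
    · have := eq_of_heq (Sigma.mk.inj (Sum.inl_injective (Sum.inr_injective hjk))).2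
      simp only [Prod.ext_iff, Fin.ext_iff, Sum.inl.injEq] at this ⊢
      exact this
    · exact absurd (Sum.inr_injective hjk) Sum.inl_ne_inr
    · exact absurd (Sum.inr_injective hjk) Sum.inr_ne_inl
    · have := eq_of_heq (Sigma.mk.inj (Sum.inr_injective (Sum.inr_injective hjk))).2
      simp only [Fin.ext_iff, Sum.inr.injEq] at this ⊢
      exact this
  have hX := h.aemeasurable_networkParams
  have key := (iIndepFun_iff_map_fun_eq_pi_map fun j => hX _).1 (h.indep.precomp hg)
  have hVB : ∀ s, P.map (networkParams d dout p lam V B (g s))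
      = (Sum.elim (fun _ => ⟨gaussianReal 0 (σv ^ 2), inferInstance⟩)
          (fun _ => ⟨gaussianReal 0 (σb ^ 2), inferInstance⟩) :
          (Fin d × Fin m) ⊕ Fin m → ProbabilityMeasure ℝ) s := by
    rintro (⟨j, k⟩ | k)
    · exact (h.law_V 0 ⟨j, j.2⟩ (Fin.castLE hm k)).map_eq
    · exact (h.law_B 0 (Fin.castLE hm k)).map_eq
  simp_rw [hVB] at key
  rw [← ProbabilityMeasure.toMeasure_pi] at key
  -- the first layer is a layer of identity nodes with variances `1 / d`
  let z : Fin d → EuclideanSpace ℝ (Fin n) := fun j => WithLp.toLp 2 fun r => x r j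
  have hout : outputs φ p lam V B x 0 m = fun ω => layerMap id m
      (z, (fun _ => 1 / (d : ℝ)), fun s => networkParams d dout p lam V B (g s) ω) := rfl
  have hc : Continuous fun y : (Fin d × Fin m) ⊕ Fin m → ℝ =>
      layerMap id m (z, (fun _ => 1 / (d : ℝ)), y) :=
    (continuous_layerMap continuous_id).comp (by fun_prop)
  have h1 : (outputsLaw h hφ x 0 m : Measure (Fin m → EuclideanSpace ℝ (Fin n)))
      = (gaussianParams σb σv d m : Measure _).map
        fun y => layerMap id m (z, (fun _ => 1 / (d : ℝ)), y) := by
    change P.map _ = _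
    rw [hout, gaussianParams, ← key, AEMeasurable.map_map_of_aemeasurable
      hc.measurable.aemeasurable (aemeasurable_pi_lambda _ fun s => hX _)]
    rfl
  rw [h1, jointCharFun, integral_map hc.measurable.aemeasurable
    (continuous_jointChar t).aestronglyMeasurable, integral_layerMap_gaussianParams, iidGaussian,
    jointCharFun_pi_multivariateGaussian (isCovKernel_inputKernel d σb σv n x), ← Real.exp_sum,
    ← Real.exp_add]
  congr 2
  have e1 : ∀ k, (t k : Fin n → ℝ) ⬝ᵥ (gramMatrix (inputKernel d σb σv) x).mulVec (t k)
      = (σb : ℝ) ^ 2 * (∑ r, t k r) ^ 2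
        + (σv : ℝ) ^ 2 / d * ∑ c, (∑ r, t k r * x r c) ^ 2 := by
    intro k
    rw [dotProduct_gramMatrix_mulVec]
    have h2 : ∀ c, (∑ r, t k r * x r c) ^ 2
        = ∑ r, ∑ s, t k r * t k s * (x r c * x s c) := fun c => by
      rw [sq, Finset.sum_mul_sum]
      refine Finset.sum_congr rfl fun r _ => Finset.sum_congr rfl fun s _ => by ring
    simp_rw [h2]
    rw [Finset.sum_comm (s := (Finset.univ : Finset (Fin d))), sq (∑ r, t k r),
      Finset.sum_mul_sum, Finset.mul_sum, Finset.mul_sum, ← Finset.sum_add_distrib]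
    refine Finset.sum_congr rfl fun r _ => ?_
    rw [Finset.sum_comm (s := (Finset.univ : Finset (Fin d))), Finset.mul_sum, Finset.mul_sum,
      ← Finset.sum_add_distrib]
    refine Finset.sum_congr rfl fun s _ => ?_
    rw [inputKernel, PiLp.inner_apply, ← Finset.mul_sum]
    simp only [RCLike.inner_apply, conj_trivial]
    simp_rw [mul_comm (x s _)]
    ring
  have h0 : Real.sqrt (1 / (d : ℝ)) ^ 2 = 1 / d := Real.sq_sqrt (by positivity)
  simp_rw [e1, h0]
  have e2 : ∀ j, quadAct σv id t (z j) = (σv : ℝ) ^ 2 / 2 * ∑ k, (∑ r, t k r * x r j) ^ 2 :=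
    fun j => rfl
  simp_rw [e2]
  rw [Finset.sum_neg_distrib, ← Finset.sum_mul, ← Finset.mul_sum,
    Finset.sum_comm (s := (Finset.univ : Finset (Fin d))), Finset.sum_add_distrib,
    ← Finset.mul_sum, ← Finset.mul_sum, biasQuad]
  ring

/-- The law of the outputs of a network is computed layer by layer. -/
theorem IsNetwork.outputsLaw_eq_netLaw (h : IsNetwork d dout σb σv μ p P lam V B)
    (hφ : Continuous φ) (x : Fin n → EuclideanSpace ℝ (Fin d))
    {ν₀ : ∀ m, ProbabilityMeasure (Fin m → EuclideanSpace ℝ (Fin n))}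
    (hν₀ : ∀ m, (ν₀ m).toMeasure = iidGaussian (inputKernel d σb σv) x m) :
    ∀ (l : ℕ) (hl : l < L + 1) (m : ℕ), m ≤ layerWidth d dout p (Fin.succ ⟨l, hl⟩) →
      outputsLaw h hφ x ⟨l, hl⟩ m = netLaw hφ σb σv ν₀ l
        (fun i => μ (Fin.castLE (Nat.lt_succ_iff.1 hl) i))
        (fun i => p (Fin.castLE (Nat.lt_succ_iff.1 hl) i)) m := by
  intro l
  induction l with
  | zero =>
    intro hl m hm
    refine Subtype.ext ?_
    exact (h.outputsLaw_zero hφ x hm).trans (hν₀ m).symm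
  | succ l ih =>
    intro hl m hm
    have hl' : l < L := by omega
    have h1 := h.outputsLaw_succ hφ x ⟨l, hl'⟩ hm
    have h2 := ih (by omega) (p ⟨l, hl'⟩) (layerWidth_castSucc_succ d dout p ⟨l, hl'⟩).ge
    exact h1.trans (congrArg (fun ν => layerStep hφ σb σv (μ ⟨l, hl'⟩ (p ⟨l, hl'⟩)) ν m) h2)

end

section
variable {L d n : ℕ} {Ω : Type*} [MeasurableSpace Ω] {P : Measure Ω} [IsProbabilityMeasure P]
  {σb σv : ℝ≥0} {φ : ℝ → ℝ} {a : Fin L → ℝ} {ρ : Fin L → Measure ℝ}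
  {K : Fin (L + 1) → Ω → EuclideanSpace ℝ (Fin d) → EuclideanSpace ℝ (Fin d) → ℝ}
  {T : Fin L → ℕ → Ω → ℝ} {ζ : Fin L → ℕ → Ω → EuclideanSpace ℝ (Fin d) → ℝ}

/-- The mixture of Gaussian laws which is the limit of the laws of `m` nodes of layer `l + 1`. -/
def IsKernelRecursion.limitLaw (h : IsKernelRecursion P σb σv φ a ρ K T ζ)
    (x : Fin n → EuclideanSpace ℝ (Fin d)) (l : Fin (L + 1)) (m : ℕ) :
    ProbabilityMeasure (Fin m → EuclideanSpace ℝ (Fin n)) :=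
  ⟨P.bind fun ω => iidGaussian (K l ω) x m,
    isProbabilityMeasure_bind_iidGaussian (h.measurable_K l) x m⟩

theorem IsKernelRecursion.limitLaw_zero (h : IsKernelRecursion P σb σv φ a ρ K T ζ)
    (x : Fin n → EuclideanSpace ℝ (Fin d)) (m : ℕ) :
    (h.limitLaw x 0 m).toMeasure = iidGaussian (inputKernel d σb σv) x m := by
  have : K 0 = fun _ => inputKernel d σb σv := by
    ext ω x x'; exact h.init ω x x'
  change P.bind _ = _
  rw [this, Measure.bind_const]
  simp

/-- Induction over the layers. The outermost limit is that of the last hidden layer, applied to the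
limit law of the layer before; the inner limits pass through the continuous map `layerStep`. -/
theorem IsKernelRecursion.iteratedTendsto_netLaw (h : IsKernelRecursion P σb σv φ a ρ K T ζ)
    (hφ : Continuous φ)
    (henv : ∃ A B C : ℝ, 0 < A ∧ 0 < B ∧ 0 < C ∧ ∀ z : ℝ, |φ z| ≤ A + B * |z| ^ C)
    (ha : ∀ i, 0 ≤ a i) (hρ : ∀ i, IsLevyMeasure (ρ i))
    {μ : Fin L → ℕ+ → ProbabilityMeasure ℝ} (hμ : ∀ i q, (μ i q : Measure ℝ) (Set.Iio 0) = 0)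
    (hlim : ∀ i, ∃ Λ : ProbabilityMeasure ℝ, IsIDLaw (a i) (ρ i) Λ ∧
      Tendsto (fun q : ℕ+ => iidSumLaw q (μ i q)) atTop (𝓝 Λ))
    (x : Fin n → EuclideanSpace ℝ (Fin d)) :
    ∀ (l : ℕ) (hl : l < L + 1) (m : ℕ), IteratedTendsto l
      (fun p => netLaw hφ σb σv (h.limitLaw x 0) l
        (fun i => μ (Fin.castLE (Nat.lt_succ_iff.1 hl) i)) p m) (h.limitLaw x ⟨l, hl⟩ m) := by
  intro l
  induction l with
  | zero => exact fun hl m => rfl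
  | succ l ih =>
    intro hl m
    have hl' : l < L := by omega
    obtain ⟨Λ, hΛ, hΛlim⟩ := hlim ⟨l, hl'⟩
    refine ⟨fun k => layerStep hφ σb σv (μ ⟨l, hl'⟩ k) (h.limitLaw x (Fin.castSucc ⟨l, hl'⟩) k) m,
      ?_, Eventually.of_forall fun k => ?_⟩
    · exact tendsto_layerStep (h.measurable_K (Fin.castSucc ⟨l, hl'⟩)) x hφ henv σb σv
        (hρ ⟨l, hl'⟩) hΛ (hμ ⟨l, hl'⟩) hΛlim (fun q => rfl)
        fun t => h.jointCharFun_succ hφ henv ha hρ ⟨l, hl'⟩ x t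
    · have h1 := (ih (by omega) k).map (continuous_layerStep hφ σb σv (μ ⟨l, hl'⟩ k) m)
      have h2 : (fun q : Fin l → ℕ+ => netLaw hφ σb σv (h.limitLaw x 0) (l + 1)
          (fun i => μ (Fin.castLE (Nat.lt_succ_iff.1 hl) i)) (Fin.snoc q k) m)
          = fun q => layerStep hφ σb σv (μ ⟨l, hl'⟩ k) (netLaw hφ σb σv (h.limitLaw x 0) l
            (fun i => μ (Fin.castLE (by omega) i)) q k) m := by
        funext q
        exact netLaw_succ hφ σb σv _ _ (Fin.snoc_last (α := fun _ => ℕ+) k q)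
          (funext fun i => Fin.snoc_castSucc (α := fun _ => ℕ+) k q i) m
      rw [h2]
      exact h1

end

/-! ### Gaussian processes on an arbitrary index set -/

section
variable {ι : Type*} {P : ∀ J : Finset ι, Measure (J → ℝ)} [∀ J, IsProbabilityMeasure (P J)]

/-- Continuity at `∅` of the content of a projective family: a decreasing sequence of cylinders
whose contents stay away from `0` contains cylinders over compact sets with the finite intersection
property, and limits along an ultrafilter, taken coordinate by coordinate, give a common point. -/
theorem tendsto_projectiveFamilyContent_zero
    (hP : IsProjectiveMeasureFamily (α := fun _ : ι => ℝ) P)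
    ⦃A : ℕ → Set (ι → ℝ)⦄ (hA : ∀ n, A n ∈ measurableCylinders fun _ : ι => ℝ)
    (hanti : Antitone A) (hinter : ⋂ n, A n = ∅) :
    Tendsto (fun n => projectiveFamilyContent hP (A n)) atTop (𝓝 0) := by
  set M := projectiveFamilyContent hP
  have hmono : Antitone fun n => M (A n) := fun i j hij =>
    projectiveFamilyContent_mono hP (hA j) (hA i) (hanti hij)
  have hlim := tendsto_atTop_iInf hmono
  by_contra hne
  have hε : (⨅ n, M (A n)) ≠ 0 := fun h => hne (h ▸ hlim)
  choose s S hS hAS using fun n => (mem_measurableCylinders _).1 (hA n)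
  obtain ⟨δ, hδ, hδsum⟩ := ENNReal.exists_pos_sum_of_countable' hε ℕ
  choose C hCS hC hCδ using fun n =>
    (hS n).exists_isCompact_sdiff_lt (μ := P (s n)) (measure_ne_top _ _) (hδ n).ne'
  have hCm : ∀ n, MeasurableSet (C n) := fun n => (hC n).isClosed.measurableSet
  have hdiff : ∀ n, A n \ cylinder (s n) (C n) = cylinder (s n) (S n \ C n) := fun n => by
    rw [hAS n, sdiff_cylinder_same]
  -- finitely many of the compact cylinders have a common point
  have hfin : ∀ n, ∃ x : ι → ℝ, ∀ k ≤ n, x ∈ cylinder (s k) (C k) := by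
    intro n
    by_contra! hcon
    have hsub : A n ⊆ ⋃ k ∈ Finset.range (n + 1), (A k \ cylinder (s k) (C k)) := by
      intro x hx
      obtain ⟨k, hk, hxk⟩ := hcon x
      exact Set.mem_biUnion (Finset.mem_coe.2 (Finset.mem_range.2 (Nat.lt_succ_of_le hk)))
        ⟨hanti hk hx, hxk⟩
    have hmem : ∀ k, A k \ cylinder (s k) (C k) ∈ measurableCylinders fun _ : ι => ℝ := fun k => by
      rw [hdiff]; exact cylinder_mem_measurableCylinders _ _ ((hS k).diff (hCm k))
    have h1 : M (A n) ≤ ∑ k ∈ Finset.range (n + 1), M (A k \ cylinder (s k) (C k)) :=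
      (projectiveFamilyContent_mono hP (hA n)
        (isSetRing_measurableCylinders.biUnion_mem _ fun k _ => hmem k) hsub).trans
        (addContent_biUnion_le isSetRing_measurableCylinders fun k _ => hmem k)
    have h2 : ∑ k ∈ Finset.range (n + 1), M (A k \ cylinder (s k) (C k)) ≤ ∑' k, δ k := by
      refine (Finset.sum_le_sum fun k _ => ?_).trans (ENNReal.sum_le_tsum _)
      rw [hdiff, projectiveFamilyContent_cylinder hP ((hS k).diff (hCm k))]
      exact (hCδ k).le
    exact absurd ((iInf_le _ n).trans (h1.trans h2)) (not_le.2 hδsum)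
  choose x hx using hfin
  let U := hyperfilter ℕ
  have hcomp : ∀ k, ∃ c ∈ C k, Tendsto (fun n => (s k).restrict (x n)) U (𝓝 c) := by
    intro k
    refine (hC k).ultrafilter_le_nhds (U.map fun n => (s k).restrict (x n)) ?_
    rw [Ultrafilter.coe_map, le_principal_iff, mem_map]
    refine Nat.hyperfilter_le_atTop ?_
    filter_upwards [eventually_ge_atTop k] with n hn
    exact hx n k hn
  choose c hcC hc using hcomp
  classical
  let y : ι → ℝ := fun i => if h : ∃ k, i ∈ s k then c h.choose ⟨i, h.choose_spec⟩ else 0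
  have hy : ∀ k, (s k).restrict y = c k := by
    intro k
    ext i
    have h : ∃ k, i.1 ∈ s k := ⟨k, i.2⟩
    have h1 := (tendsto_pi_nhds.1 (hc k)) i
    have h2 := (tendsto_pi_nhds.1 (hc h.choose)) ⟨i, h.choose_spec⟩
    have h3 : y i = c h.choose ⟨i, h.choose_spec⟩ := dif_pos h
    rw [Finset.restrict, h3]
    exact tendsto_nhds_unique h2 h1
  have : y ∈ ⋂ n, A n := Set.mem_iInter.2 fun k => by
    rw [hAS k, mem_cylinder, hy k]
    exact hCS k (hcC k)
  rw [hinter] at this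
  exact this

theorem isSigmaSubadditive_projectiveFamilyContent
    (hP : IsProjectiveMeasureFamily (α := fun _ : ι => ℝ) P) :
    (projectiveFamilyContent hP).IsSigmaSubadditive :=
  isSigmaSubadditive_of_addContent_iUnion_eq_tsum isSetRing_measurableCylinders
    fun _ hf hfU hd => addContent_iUnion_eq_sum_of_tendsto_zero isSetRing_measurableCylinders
      (projectiveFamilyContent hP) (fun _ _ => projectiveFamilyContent_ne_top hP)
      (tendsto_projectiveFamilyContent_zero hP) hf hfU hd

/-- Kolmogorov's extension theorem for real-valued processes. -/
theorem exists_isProjectiveLimit (hP : IsProjectiveMeasureFamily (α := fun _ : ι => ℝ) P) :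
    ∃ Q : Measure (ι → ℝ), IsProjectiveLimit (α := fun _ : ι => ℝ) Q P := by
  refine ⟨(projectiveFamilyContent hP).measure isSetSemiring_measurableCylinders
    generateFrom_measurableCylinders.ge (isSigmaSubadditive_projectiveFamilyContent hP),
    fun I => ?_⟩
  ext t ht
  rw [Measure.map_apply (Finset.measurable_restrict I) ht, AddContent.measure_eq, ← cylinder,
    projectiveFamilyContent_cylinder hP ht]
  · exact generateFrom_measurableCylinders.symm
  · exact cylinder_mem_measurableCylinders _ _ ht

end

section
variable {X : Type*}

open scoped Classical in
/-- The centred Gaussian law on `ℝ^J` with covariance `k`. -/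
def gaussianFamily (k : X → X → ℝ) (J : Finset X) : Measure (J → ℝ) :=
  (multivariateGaussian 0 (Matrix.of fun i j : J => k i j)).map WithLp.ofLp

instance (k : X → X → ℝ) (J : Finset X) : IsProbabilityMeasure (gaussianFamily k J) :=
  Measure.isProbabilityMeasure_map (by fun_prop)

theorem IsCovKernel.posSemidef {k : X → X → ℝ} (hk : IsCovKernel k) (J : Finset X) :
    (Matrix.of fun i j : J => k i j).PosSemidef := by
  have h := (hk J.card fun r => (J.equivFin.symm r).1).submatrix J.equivFin
  convert h using 1
  ext i j
  simp [gramMatrix]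

theorem gaussianFamily_map {k : X → X → ℝ} (hk : IsCovKernel k) (J : Finset X) {κ : Type*}
    [Fintype κ] [DecidableEq κ] (f : κ → J) :
    (gaussianFamily k J).map (fun z => WithLp.toLp 2 fun r => z (f r))
      = multivariateGaussian 0 (Matrix.of fun r s => k (f r) (f s)) := by
  classical
  rw [gaussianFamily, Measure.map_map (by fun_prop) (by fun_prop)]
  convert map_multivariateGaussian_comp (hk.posSemidef J) f using 1
  · rfl
  · rfl

theorem isProjectiveMeasureFamily_gaussianFamily {k : X → X → ℝ} (hk : IsCovKernel k) :
    IsProjectiveMeasureFamily (α := fun _ : X => ℝ) (gaussianFamily k) := by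
  classical
  intro I J hJI
  have h := gaussianFamily_map hk I fun j : J => ⟨j.1, hJI j.2⟩
  have h2 : gaussianFamily k J = ((gaussianFamily k I).map
      (fun z => (WithLp.toLp 2 fun r : J => z ⟨r.1, hJI r.2⟩ : EuclideanSpace ℝ J))).map
        WithLp.ofLp := by
    rw [h, gaussianFamily]
  rw [h2, Measure.map_map (by fun_prop) (by fun_prop)]
  rfl

/-- The law of the centred Gaussian process with covariance kernel `k`. -/
def gaussianProcess {k : X → X → ℝ} (hk : IsCovKernel k) : Measure (X → ℝ) :=
  (exists_isProjectiveLimit (isProjectiveMeasureFamily_gaussianFamily hk)).choose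

theorem isProjectiveLimit_gaussianProcess {k : X → X → ℝ} (hk : IsCovKernel k) :
    IsProjectiveLimit (α := fun _ : X => ℝ) (gaussianProcess hk) (gaussianFamily k) :=
  (exists_isProjectiveLimit (isProjectiveMeasureFamily_gaussianFamily hk)).choose_spec

instance {k : X → X → ℝ} (hk : IsCovKernel k) : IsProbabilityMeasure (gaussianProcess hk) :=
  (isProjectiveLimit_gaussianProcess hk).isProbabilityMeasure

theorem gaussianProcess_map {k : X → X → ℝ} (hk : IsCovKernel k) {n : ℕ} (x : Fin n → X) :
    (gaussianProcess hk).map (fun z => WithLp.toLp 2 fun r => z (x r))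
      = multivariateGaussian 0 (gramMatrix k x) := by
  classical
  let J := Finset.univ.image x
  let f : Fin n → J := fun r => ⟨x r, Finset.mem_image_of_mem x (Finset.mem_univ r)⟩
  have h := gaussianFamily_map hk J f
  rw [← isProjectiveLimit_gaussianProcess hk J, Measure.map_map (by fun_prop) (by fun_prop)] at h
  exact h

/-- The law of a sequence of independent centred Gaussian processes with covariance kernel `k`. -/
def gaussianProcesses {k : X → X → ℝ} (hk : IsCovKernel k) : Measure (ℕ → X → ℝ) :=
  Measure.infinitePi fun _ => gaussianProcess hk

instance {k : X → X → ℝ} (hk : IsCovKernel k) : IsProbabilityMeasure (gaussianProcesses hk) := by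
  unfold gaussianProcesses; infer_instance

theorem gaussianProcesses_map {k : X → X → ℝ} (hk : IsCovKernel k) {n : ℕ} (x : Fin n → X)
    (m : ℕ) :
    (gaussianProcesses hk).map
        (fun z (j : Fin m) => (WithLp.toLp 2 fun r => z j (x r) : EuclideanSpace ℝ (Fin n)))
      = iidGaussian k x m := by
  have hm : Measurable fun z : X → ℝ =>
      (WithLp.toLp 2 fun r => z (x r) : EuclideanSpace ℝ (Fin n)) := by fun_prop
  have h1 := (iIndepFun_infinitePi (P := fun _ : ℕ => gaussianProcess hk)
    (X := fun _ z => (WithLp.toLp 2 fun r => z (x r) : EuclideanSpace ℝ (Fin n)))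
    fun _ => hm).precomp (Fin.val_injective (n := m))
  have h2 := (iIndepFun_iff_map_fun_eq_pi_map fun j : Fin m =>
    (hm.comp (measurable_pi_apply (X := fun _ : ℕ => X → ℝ) j.1)).aemeasurable).1 h1
  refine h2.trans ?_
  rw [iidGaussian]
  congr 1
  funext j
  rw [← Measure.map_map hm (measurable_pi_apply j.1)]
  exact (congrArg _ (measurePreserving_eval_infinitePi (fun _ : ℕ => gaussianProcess hk)
    j.1).map_eq).trans (gaussianProcess_map hk x)

theorem measurable_gaussianProcesses :
    Measurable fun k : {k : X → X → ℝ // IsCovKernel k} => gaussianProcesses k.2 := by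
  let e := MeasurableEquiv.curry ℕ X ℝ
  have hinst : ∀ k : {k : X → X → ℝ // IsCovKernel k},
      IsProbabilityMeasure ((gaussianProcesses k.2).map e.symm) := fun k =>
    Measure.isProbabilityMeasure_map e.symm.measurable.aemeasurable
  have h : Measurable fun k : {k : X → X → ℝ // IsCovKernel k} =>
      (gaussianProcesses k.2).map e.symm := by
    refine Measurable.measure_of_isPiSystem_of_isProbabilityMeasure
      generateFrom_measurableCylinders.symm isPiSystem_measurableCylinders fun u hu => ?_
    obtain ⟨J, n, x, C, hC, rfl⟩ := exists_eq_preimage_of_mem_measurableCylinders hu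
    have hm : Measurable fun (z : ℕ × X → ℝ) (j : Fin J) =>
        (WithLp.toLp 2 fun r => z (j, x r) : EuclideanSpace ℝ (Fin n)) := by fun_prop
    have h1 : ∀ k : {k : X → X → ℝ // IsCovKernel k},
        (gaussianProcesses k.2).map e.symm ((fun (z : ℕ × X → ℝ) (j : Fin J) =>
          (WithLp.toLp 2 fun r => z (j, x r) : EuclideanSpace ℝ (Fin n))) ⁻¹' C)
        = iidGaussian k.1 x J C := fun k => by
      rw [← Measure.map_apply hm hC, Measure.map_map hm e.symm.measurable,
        ← gaussianProcesses_map k.2 x J]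
      rfl
    simp_rw [h1]
    exact (Measure.measurable_coe hC).comp
      ((measurable_iidGaussian x J).comp measurable_subtype_coe)
  have h2 : (fun k : {k : X → X → ℝ // IsCovKernel k} => gaussianProcesses k.2)
      = fun k => ((gaussianProcesses k.2).map e.symm).map e := by
    funext k
    rw [MeasurableEquiv.map_map_symm]
  rw [h2]
  exact (Measure.measurable_map e e.measurable).comp h

/-- The Markov kernel which maps `k` to the law of a sequence of independent centred Gaussian
processes with covariance kernel `k`. -/
def gaussianProcessesKernel (X : Type*) :
    Kernel {k : X → X → ℝ // IsCovKernel k} (ℕ → X → ℝ) where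
  toFun k := gaussianProcesses k.2
  measurable' := measurable_gaussianProcesses

instance : IsMarkovKernel (gaussianProcessesKernel X) :=
  ⟨fun k => inferInstanceAs (IsProbabilityMeasure (gaussianProcesses k.2))⟩

end

/-! ### Laws determined by their moments -/

section
variable {ι : Type*} [Fintype ι]

theorem abs_prod_pow_le_one {y : ι → ℝ} (hy : ∀ i, |y i| ≤ 1) (k : ι → ℕ) :
    ‖∏ i, y i ^ k i‖ ≤ 1 := by
  rw [norm_prod]
  refine Finset.prod_le_one (fun i _ => norm_nonneg _) fun i _ => ?_
  rw [norm_pow]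
  exact pow_le_one₀ (norm_nonneg _) (hy i)

theorem continuous_prod_pow (k : ι → ℕ) : Continuous fun y : ι → ℝ => ∏ i, y i ^ k i :=
  continuous_finsetProd _ fun i _ => (continuous_apply i).pow _

theorem integral_linear_pow {μ : Measure (ι → ℝ)} [IsFiniteMeasure μ]
    (hμ : ∀ᵐ y ∂μ, ∀ i, |y i| ≤ 1) [DecidableEq ι] (t : ι → ℝ) (N : ℕ) :
    ∫ y, (∑ i, t i * y i) ^ N ∂μ
      = ∑ k ∈ (Finset.univ : Finset ι).piAntidiag N,
          (Nat.multinomial Finset.univ k * ∏ i, t i ^ k i) * ∫ y, ∏ i, y i ^ k i ∂μ := by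
  have hint : ∀ k : ι → ℕ, Integrable (fun y : ι → ℝ => ∏ i, y i ^ k i) μ := fun k =>
    Integrable.of_bound (C := 1) (continuous_prod_pow k).aestronglyMeasurable
      (hμ.mono fun y hy => abs_prod_pow_le_one hy k)
  simp_rw [← integral_const_mul]
  rw [← integral_finsetSum _ fun k _ => (hint k).const_mul _]
  congr 1 with y
  rw [Finset.sum_pow_eq_sum_piAntidiag]
  refine Finset.sum_congr rfl fun k _ => ?_
  simp_rw [mul_pow, Finset.prod_mul_distrib, mul_assoc]

theorem hasSum_charFun_of_bounded {μ : Measure (ι → ℝ)} [IsFiniteMeasure μ]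
    (hμ : ∀ᵐ y ∂μ, ∀ i, |y i| ≤ 1) (t : ι → ℝ) :
    HasSum (fun N : ℕ => Complex.I ^ N / (N.factorial : ℂ) *
        ((∫ y, (∑ i, t i * y i) ^ N ∂μ : ℝ) : ℂ))
      (∫ y, Complex.exp ((∑ i, t i * y i : ℝ) * Complex.I) ∂μ) := by
  have h := hasSum_integral_of_dominated_convergence (μ := μ)
    (F := fun (N : ℕ) (y : ι → ℝ) => ((∑ i, t i * y i : ℝ) * Complex.I) ^ N / (N.factorial : ℂ))
    (f := fun y => Complex.exp ((∑ i, t i * y i : ℝ) * Complex.I))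
    (fun N _ => (∑ i, |t i|) ^ N / (N.factorial : ℝ))
    (fun N => Continuous.aestronglyMeasurable (by fun_prop)) ?_ ?_ ?_ ?_
  · convert! h using 2 with N
    rw [← integral_complex_ofReal, ← integral_const_mul]
    congr 1 with y
    push_cast
    rw [mul_pow]
    ring
  · intro N
    filter_upwards [hμ] with y hy
    rw [norm_div, norm_pow, norm_mul, Complex.norm_I, mul_one, Complex.norm_real,
      Complex.norm_natCast]
    gcongr
    refine (norm_sum_le _ _).trans (Finset.sum_le_sum fun i _ => ?_)
    rw [norm_mul]
    exact mul_le_of_le_one_right (norm_nonneg _) (hy i)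
  · exact ae_of_all _ fun _ => Real.summable_pow_div_factorial _
  · exact integrable_const _
  · refine ae_of_all _ fun y => ?_
    rw [Complex.exp_eq_exp_ℂ]
    exact NormedSpace.expSeries_div_hasSum_exp _

/-- Laws on a bounded cube are determined by their mixed moments. -/
theorem ext_of_moments {μ ν : Measure (ι → ℝ)} [IsFiniteMeasure μ] [IsFiniteMeasure ν]
    (hμ : ∀ᵐ y ∂μ, ∀ i, |y i| ≤ 1) (hν : ∀ᵐ y ∂ν, ∀ i, |y i| ≤ 1)
    (h : ∀ k : ι → ℕ, ∫ y, ∏ i, y i ^ k i ∂μ = ∫ y, ∏ i, y i ^ k i ∂ν) : μ = ν := by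
  classical
  have e : ∀ (M : Measure (ι → ℝ)) (t : EuclideanSpace ℝ ι), charFun (M.map (WithLp.toLp 2)) t
      = ∫ y, Complex.exp ((∑ i, t i * y i : ℝ) * Complex.I) ∂M := fun M t => by
    rw [charFun_apply, integral_map (by fun_prop) (by fun_prop)]
    simp [PiLp.inner_apply]
  have h1 : μ.map (WithLp.toLp 2 : (ι → ℝ) → EuclideanSpace ℝ ι) = ν.map (WithLp.toLp 2) := by
    refine Measure.ext_of_charFun (funext fun t => ?_)
    rw [e, e, ← (hasSum_charFun_of_bounded hμ t).tsum_eq,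
      ← (hasSum_charFun_of_bounded hν t).tsum_eq]
    simp_rw [integral_linear_pow hμ, integral_linear_pow hν, h]
  have h2 : ∀ M : Measure (ι → ℝ), (M.map (WithLp.toLp 2 : (ι → ℝ) → EuclideanSpace ℝ ι)).map
      WithLp.ofLp = M := fun M => by
    rw [Measure.map_map (by fun_prop) (by fun_prop)]
    exact Measure.map_id
  rw [← h2 μ, h1, h2]

end

/-! ### Poisson point processes -/

/-- The function `y ↦ -log y` with values in `[0, ∞]`, a left inverse of `expNeg`. -/
def negLog (y : ℝ) : ℝ≥0∞ := if y ≤ 0 then ∞ else ENNReal.ofReal (-Real.log y)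

theorem measurable_negLog : Measurable negLog :=
  Measurable.ite measurableSet_Iic measurable_const (Real.measurable_log.neg.ennreal_ofReal)

theorem negLog_expNeg (x : ℝ≥0∞) : negLog (expNeg x) = x := by
  rcases eq_or_ne x ∞ with rfl | hx
  · simp [negLog]
  lift x to ℝ≥0 using hx
  have h : expNeg x = Real.exp (-x) := by simpa using expNeg_ofReal x.2
  rw [negLog, if_neg (not_le.2 (h ▸ Real.exp_pos _)), h, Real.log_exp, neg_neg]
  exact ENNReal.ofReal_coe_nnreal

theorem abs_expNeg_le_one (x : ℝ≥0∞) : |expNeg x| ≤ 1 := by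
  rw [abs_of_nonneg (expNeg_nonneg x)]
  exact expNeg_le_one x

theorem pointCount_eq_tsum (t : ℕ → ℝ) {s : Set ℝ} (hs : MeasurableSet s) :
    pointCount t s = ∑' j, s.indicator (fun _ => (1 : ℝ≥0∞)) (t j) := by
  rw [pointCount, Measure.sum_apply _ hs]
  refine tsum_congr fun j => ?_
  rw [Measure.dirac_apply' _ hs]
  rfl

section
variable {Ω : Type*} [MeasurableSpace Ω] {P : Measure Ω} [IsProbabilityMeasure P]
  {T : ℕ → Ω → ℝ} {ρ : Measure ℝ}

theorem measurable_pointCount (hT : ∀ j, Measurable (T j)) {s : Set ℝ} (hs : MeasurableSet s) :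
    Measurable fun ω => pointCount (fun j => T j ω) s := by
  simp_rw [pointCount_eq_tsum _ hs]
  exact Measurable.tsum fun j => (measurable_const.indicator hs).comp (hT j)

theorem prod_expNeg_pow {ι : Type*} [Fintype ι] (c : ι → ℝ≥0∞) (k : ι → ℕ) :
    ∏ i, expNeg (c i) ^ k i = expNeg (∑ i, c i * k i) := by
  rw [expNeg_sum]
  exact Finset.prod_congr rfl fun i _ => (expNeg_mul_natCast _ _).symm

/-- The joint moments of the variables `exp (-N(sᵢ))`, for the numbers `N(sᵢ)` of points in
disjoint sets, factorise as for independent Poisson variables. -/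
theorem integral_prod_expNeg_pointCount
    (hlap : ∀ h : ℝ → ℝ≥0∞, Measurable h → h 0 = 0 → ∫ ω, expNeg (∑' j, h (T j ω)) ∂P
      = expNeg (∫⁻ w, ENNReal.ofReal (1 - expNeg (h w)) ∂ρ))
    {ι : Type*} [Fintype ι] {s : ι → Set ℝ} (hs : ∀ i, MeasurableSet (s i))
    (hs0 : ∀ i, s i ⊆ Set.Ioi 0) (hd : Pairwise fun i j => Disjoint (s i) (s j)) (k : ι → ℕ) :
    ∫ ω, ∏ i, expNeg (pointCount (fun j => T j ω) (s i)) ^ k i ∂P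
      = ∏ i, expNeg (ENNReal.ofReal (1 - expNeg (k i)) * ρ (s i)) := by
  classical
  let h : ℝ → ℝ≥0∞ := fun w => ∑ i, (s i).indicator (fun _ => (1 : ℝ≥0∞)) w * k i
  have hm : Measurable h := Finset.measurable_fun_sum _ fun i _ =>
    (measurable_const.indicator (hs i)).mul_const _
  have h0 : h 0 = 0 := Finset.sum_eq_zero fun i _ => by
    rw [Set.indicator_of_notMem fun hi => lt_irrefl _ (Set.mem_Ioi.1 (hs0 i hi)), zero_mul]
  have e1 : ∀ ω, ∏ i, expNeg (pointCount (fun j => T j ω) (s i)) ^ k i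
      = expNeg (∑' j, h (T j ω)) := fun ω => by
    rw [prod_expNeg_pow]
    congr 1
    simp_rw [pointCount_eq_tsum _ (hs _), ← ENNReal.tsum_mul_right]
    exact (Summable.tsum_finsetSum fun i _ => ENNReal.summable).symm
  simp_rw [e1]
  rw [hlap h hm h0, ← expNeg_sum]
  congr 1
  -- at most one of the sets contains a given point
  have e2 : ∀ w, ENNReal.ofReal (1 - expNeg (h w))
      = ∑ i, (s i).indicator (fun _ => ENNReal.ofReal (1 - expNeg (k i))) w := fun w => by
    by_cases hw : ∃ i, w ∈ s i
    · obtain ⟨i, hi⟩ := hw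
      have hne : ∀ j ≠ i, w ∉ s j := fun j hj hwj =>
        Set.disjoint_left.1 (hd hj) hwj hi
      have h1 : h w = k i := by
        simp only [h]
        rw [Finset.sum_eq_single i (fun j _ hj => by
          rw [Set.indicator_of_notMem (hne j hj), zero_mul]) (by simp),
          Set.indicator_of_mem hi, one_mul]
      rw [h1, Finset.sum_eq_single i (fun j _ hj => Set.indicator_of_notMem (hne j hj) _)
        (by simp), Set.indicator_of_mem hi]
    · push Not at hw
      have h1 : h w = 0 := Finset.sum_eq_zero fun i _ => by
        rw [Set.indicator_of_notMem (hw i), zero_mul]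
      rw [h1, Finset.sum_eq_zero fun i _ => Set.indicator_of_notMem (hw i) _]
      simp
  simp_rw [e2]
  rw [lintegral_finsetSum _ fun i _ => measurable_const.indicator (hs i)]
  refine Finset.sum_congr rfl fun i _ => ?_
  rw [lintegral_indicator_const (hs i)]

/-- A point process with the Laplace functional of a Poisson process is Poisson: the numbers `N(sᵢ)`
of points in disjoint sets have the law of independent Poisson variables, since the variables
`exp (-N(sᵢ))`, which determine them, have the right joint moments. -/
theorem isPoissonPoints_of_laplace (hT : ∀ j, Measurable (T j)) (hT0 : ∀ j ω, 0 ≤ T j ω)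
    (hlap : ∀ h : ℝ → ℝ≥0∞, Measurable h → h 0 = 0 → ∫ ω, expNeg (∑' j, h (T j ω)) ∂P
      = expNeg (∫⁻ w, ENNReal.ofReal (1 - expNeg (h w)) ∂ρ)) :
    IsPoissonPoints P T ρ := by
  have hcm : ∀ {s : Set ℝ}, MeasurableSet s →
      Measurable fun ω => expNeg (pointCount (fun j => T j ω) s) := fun hs =>
    continuous_expNeg.measurable.comp (measurable_pointCount hT hs)
  refine ⟨hT, hT0, fun s hs hs0 hρs => ⟨(measurable_pointCount hT hs).aemeasurable, ?_⟩,
    fun r s hs hs0 hd => ?_⟩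
  · set r := (ρ s).toNNReal
    have hr : ρ s = r := (ENNReal.coe_toNNReal hρs.ne).symm
    have hcast : Measurable fun (n : ℕ) (_ : Unit) => expNeg (n : ℝ≥0∞) :=
      Measurable.of_discrete
    have hcm' : Measurable fun ω (_ : Unit) => expNeg (pointCount (fun j => T j ω) s) :=
      measurable_pi_lambda _ fun _ => hcm hs
    have := Measure.isProbabilityMeasure_map (μ := P) hcm'.aemeasurable
    have := Measure.isProbabilityMeasure_map (μ := poissonMeasure r) hcast.aemeasurable
    have hbd : MeasurableSet {y : Unit → ℝ | ∀ i, |y i| ≤ 1} := by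
      have : {y : Unit → ℝ | ∀ i, |y i| ≤ 1} = {y | |y ()| ≤ 1} := Set.ext fun y =>
        ⟨fun h => h (), fun h _ => h⟩
      rw [this]
      exact measurableSet_le (by fun_prop) measurable_const
    have key : P.map (fun ω (_ : Unit) => expNeg (pointCount (fun j => T j ω) s))
        = (poissonMeasure r).map fun (n : ℕ) (_ : Unit) => expNeg n := by
      refine ext_of_moments
        ((ae_map_iff hcm'.aemeasurable hbd).2 (ae_of_all _ fun ω _ => abs_expNeg_le_one _))
        ((ae_map_iff hcast.aemeasurable hbd).2 (ae_of_all _ fun n _ => abs_expNeg_le_one _))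
        fun k => ?_
      have hc : AEStronglyMeasurable (fun y : Unit → ℝ => ∏ i, y i ^ k i)
          (P.map fun ω (_ : Unit) => expNeg (pointCount (fun j => T j ω) s)) :=
        (continuous_prod_pow k).aestronglyMeasurable
      rw [integral_map hcm'.aemeasurable hc, integral_map hcast.aemeasurable
          (continuous_prod_pow k).aestronglyMeasurable,
        integral_prod_expNeg_pointCount hlap (fun _ => hs) (fun _ => hs0)
          (fun i j hij => absurd (Subsingleton.elim i j) hij)]
      simp only [Finset.univ_unique, Finset.prod_singleton]
      have h1 : ∀ n : ℕ, expNeg (n : ℝ≥0∞) ^ k default = expNeg (k default) ^ n := fun n => by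
        rw [← expNeg_mul_natCast, ← expNeg_mul_natCast, mul_comm]
      have h2 : 0 ≤ 1 - expNeg (k default) := by
        have := expNeg_le_one (k default); linarith
      simp_rw [h1]
      rw [integral_pow_poissonMeasure, hr, ← ENNReal.ofReal_coe_nnreal, ← ENNReal.ofReal_mul h2,
        expNeg_ofReal (by positivity), mul_comm]
    have h3 := congrArg (fun M => M.map fun y : Unit → ℝ => negLog (y ())) key
    have hneg : Measurable fun y : Unit → ℝ => negLog (y ()) :=
      measurable_negLog.comp (measurable_pi_apply _)
    rw [Measure.map_map hneg hcm', Measure.map_map hneg hcast] at h3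
    simpa only [Function.comp_def, negLog_expNeg] using h3
  · have hcm' : ∀ i, AEMeasurable (fun ω => expNeg (pointCount (fun j => T j ω) (s i))) P :=
      fun i => (hcm (hs i)).aemeasurable
    have hind : iIndepFun (fun i ω => expNeg (pointCount (fun j => T j ω) (s i))) P := by
      rw [iIndepFun_iff_map_fun_eq_pi_map hcm']
      have hpr : ∀ i, IsProbabilityMeasure
          (P.map fun ω => expNeg (pointCount (fun j => T j ω) (s i))) := fun i =>
        Measure.isProbabilityMeasure_map (hcm' i)
      have hall : AEMeasurable (fun ω i => expNeg (pointCount (fun j => T j ω) (s i))) P :=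
        aemeasurable_pi_lambda _ hcm'
      have := Measure.isProbabilityMeasure_map (μ := P) hall
      have hbd : MeasurableSet {y : Fin r → ℝ | ∀ i, |y i| ≤ 1} := by
        simp only [Set.ofPred_forall]
        exact MeasurableSet.iInter fun i => measurableSet_le (by fun_prop) measurable_const
      refine ext_of_moments
        ((ae_map_iff hall hbd).2 (ae_of_all _ fun ω i => abs_expNeg_le_one _)) ?_ fun k => ?_
      · refine ae_all_iff.2 fun i => ?_
        refine (Measure.quasiMeasurePreserving_eval (μ := fun i =>
          P.map fun ω => expNeg (pointCount (fun j => T j ω) (s i))) i).ae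
          (p := fun y => |y| ≤ 1) ?_
        rw [ae_map_iff (hcm' i) (measurableSet_le (by fun_prop) measurable_const)]
        exact ae_of_all _ fun ω => abs_expNeg_le_one _
      · rw [integral_map hall (continuous_prod_pow k).aestronglyMeasurable,
          integral_prod_expNeg_pointCount hlap hs hs0 hd,
          integral_fintype_prod_eq_prod (𝕜 := ℝ) fun i y => y ^ k i]
        refine Finset.prod_congr rfl fun i _ => ?_
        rw [integral_map (hcm' i) (by fun_prop)]
        have h1 := integral_prod_expNeg_pointCount hlap (ι := Unit) (s := fun _ => s i)
          (fun _ => hs i) (fun _ => hs0 i) (fun i j hij => absurd (Subsingleton.elim i j) hij)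
          (fun _ => k i)
        simpa using h1.symm
    have h2 := hind.comp (fun _ => negLog) fun _ => measurable_negLog
    simpa only [Function.comp_def, negLog_expNeg] using h2

/-- The points of a Poisson process whose mean measure is a Lévy measure are summable. -/
theorem IsPoissonPoints.ae_tsum_lt_top (hT : IsPoissonPoints P T ρ) (hρ : IsLevyMeasure ρ) :
    ∀ᵐ ω ∂P, ∑' j, ENNReal.ofReal (T j ω) < ∞ := by
  -- the Laplace transform of the sum `S` tends to `P (S < ∞)` at `0`
  set S : Ω → ℝ≥0∞ := fun ω => ∑' j, ENNReal.ofReal (T j ω)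
  have hS : Measurable S := Measurable.tsum fun j => (hT.measurable j).ennreal_ofReal
  let θ : ℕ → ℝ := fun n => 1 / ((n : ℝ) + 1)
  have hθ : ∀ n, 0 ≤ θ n := fun n => by positivity
  have hθ1 : ∀ n, θ n ≤ 1 := fun n => by
    rw [div_le_one (by positivity)]; simp
  have hθ0 : Tendsto θ atTop (𝓝 0) := tendsto_one_div_add_atTop_nhds_zero_nat
  have hlap : ∀ n, ∫ ω, expNeg (ENNReal.ofReal (θ n) * S ω) ∂P
      = expNeg (∫⁻ w, ENNReal.ofReal (1 - expNeg (ENNReal.ofReal (θ n * w))) ∂ρ) := fun n => by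
    rw [← hT.laplace hρ (h := fun w => ENNReal.ofReal (θ n * w)) (by fun_prop) (by simp)]
    simp_rw [S, ← ENNReal.tsum_mul_left, ENNReal.ofReal_mul (hθ n)]
  have hlim : Tendsto (fun n => ∫ ω, expNeg (ENNReal.ofReal (θ n) * S ω) ∂P) atTop (𝓝 1) := by
    simp_rw [hlap]
    rw [show 𝓝 (1 : ℝ) = 𝓝 (expNeg 0) by rw [expNeg_zero]]
    refine (continuous_expNeg.tendsto 0).comp ?_
    rw [← lintegral_zero (μ := ρ)]
    refine tendsto_lintegral_of_dominated_convergence (fun w => ENNReal.ofReal (min 1 w))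
      (fun n => ?_) (fun n => ?_) hρ.lintegral_lt_top.ne (ae_of_all _ fun w => ?_)
    · exact ((measurable_const.sub (continuous_expNeg.measurable.comp
        (measurable_id.const_mul _).ennreal_ofReal))).ennreal_ofReal
    · filter_upwards [hρ.ae_pos] with w hw
      refine ENNReal.ofReal_le_ofReal ?_
      rw [expNeg_ofReal (mul_nonneg (hθ n) hw.le)]
      refine le_min (by linarith [Real.exp_pos (-(θ n * w))]) ?_
      have h1 := Real.add_one_le_exp (-(θ n * w))
      have h2 := mul_le_of_le_one_left hw.le (hθ1 n)
      linarith
    · have h1 : Tendsto (fun n => 1 - expNeg (ENNReal.ofReal (θ n * w))) atTop (𝓝 0) := by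
        have h2 : Tendsto (fun n => ENNReal.ofReal (θ n * w)) atTop (𝓝 0) := by
          simpa using ENNReal.tendsto_ofReal (hθ0.mul_const w)
        simpa using ((continuous_expNeg.tendsto 0).comp h2).const_sub 1
      simpa using ENNReal.tendsto_ofReal h1
  have hle : ∀ n, ∫ ω, expNeg (ENNReal.ofReal (θ n) * S ω) ∂P ≤ P.real {ω | S ω < ∞} := by
    intro n
    have hm : MeasurableSet {ω | S ω < ∞} := measurableSet_lt hS measurable_const
    rw [← integral_indicator_one hm]
    refine integral_mono (Integrable.of_bound (C := 1)
      ((measurable_expNeg_const_mul _).comp hS).aestronglyMeasurable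
      (ae_of_all _ fun ω => abs_expNeg_le_one _))
      ((integrable_const (1 : ℝ)).indicator hm) fun ω => ?_
    by_cases h : S ω < ∞
    · simpa [h] using expNeg_le_one _
    · have hθn : ENNReal.ofReal (θ n) ≠ 0 :=
        (ENNReal.ofReal_pos.2 (show 0 < θ n by positivity)).ne'
      rw [not_lt, top_le_iff] at h
      simp [h, ENNReal.mul_top hθn]
  have h1 : 1 ≤ P.real {ω | S ω < ∞} := le_of_tendsto' hlim hle
  have h2 : P {ω | S ω < ∞} = 1 := by
    rw [← (ENNReal.toReal_eq_one_iff _).1 (le_antisymm measureReal_le_one h1)]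
  exact (prob_compl_eq_zero_iff (measurableSet_lt hS measurable_const)).2 h2

end

/-! ### Existence of Poisson point processes -/

theorem integral_prod_infinitePi {ι E : Type*} [MeasurableSpace E] {M : ι → Measure E}
    [∀ i, IsProbabilityMeasure (M i)] {n : ℕ} {e : Fin n → ι} (he : Function.Injective e)
    {g : ι → E → ℝ} (hg : ∀ i, Measurable (g i)) :
    ∫ y, ∏ k, g (e k) (y (e k)) ∂(Measure.infinitePi M) = ∏ k, ∫ w, g (e k) w ∂(M (e k)) := by
  have h := (iIndepFun_infinitePi (P := M) (X := fun _ ω => ω) fun i => measurable_id).precomp he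
  have h1 := h.integral_fun_prod_comp (f := fun k => g (e k))
    (fun k => (measurable_pi_apply (e k)).aemeasurable)
    (fun k => (hg (e k)).aestronglyMeasurable)
  refine h1.trans (Finset.prod_congr rfl fun k _ => ?_)
  have h2 := measurePreserving_eval_infinitePi M (e k)
  rw [← h2.map_eq, integral_map h2.measurable.aemeasurable (hg _).aestronglyMeasurable]

theorem lintegral_one_sub_eq_ofReal {ν : Measure ℝ} [IsFiniteMeasure ν] {g : ℝ → ℝ}
    (hg : Measurable g) (h0 : ∀ w, 0 ≤ g w) (h1 : ∀ w, g w ≤ 1) :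
    ∫⁻ w, ENNReal.ofReal (1 - g w) ∂ν = ENNReal.ofReal (∫ w, (1 - g w) ∂ν) := by
  refine (ofReal_integral_eq_lintegral_ofReal (Integrable.of_bound (C := 1)
    (by fun_prop) (ae_of_all _ fun w => ?_)) (ae_of_all _ fun w => ?_)).symm
  · rw [Real.norm_eq_abs, abs_le]
    constructor <;> linarith [h0 w, h1 w]
  · simpa using h1 w

/-- A Poisson process with finite mean measure: a Poisson number of independent points, padded
with zeros. -/
theorem exists_poissonPoints_of_isFiniteMeasure (ν : Measure ℝ) [IsFiniteMeasure ν] :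
    ∃ Q : Measure (ℕ → ℝ), IsProbabilityMeasure Q ∧
      ∀ h : ℝ → ℝ≥0∞, Measurable h → h 0 = 0 → ∫ s, expNeg (∑' k, h (s k)) ∂Q
        = expNeg (∫⁻ w, ENNReal.ofReal (1 - expNeg (h w)) ∂ν) := by
  rcases eq_or_ne ν 0 with rfl | hν
  · refine ⟨Measure.dirac 0, inferInstance, fun h hh h0 => ?_⟩
    have hE : Measurable fun s : ℕ → ℝ => expNeg (∑' k, h (s k)) :=
      continuous_expNeg.measurable.comp (Measurable.tsum fun k => hh.comp (measurable_pi_apply k))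
    rw [integral_dirac' _ _ hE.stronglyMeasurable]
    simp [h0]
  have : NeZero ν := ⟨hν⟩
  set c := ν Set.univ
  have hc0 : c ≠ 0 := by simpa [c] using hν
  have hc : c ≠ ∞ := measure_ne_top _ _
  let ν₀ : Measure ℝ := c⁻¹ • ν
  have hν₀ : IsProbabilityMeasure ν₀ := isProbabilityMeasureSMul
  have hνν : ν = c • ν₀ := by
    rw [smul_smul, ENNReal.mul_inv_cancel hc0 hc, one_smul]
  let S : ℕ × (ℕ → ℝ) → ℕ → ℝ := fun q k => if k < q.1 then q.2 k else 0
  have hS : Measurable S := measurable_pi_lambda _ fun k => Measurable.ite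
    (measurableSet_lt measurable_const measurable_fst) (by fun_prop) measurable_const
  refine ⟨((poissonMeasure c.toNNReal).prod (Measure.infinitePi fun _ : ℕ => ν₀)).map S,
    Measure.isProbabilityMeasure_map hS.aemeasurable, fun h hh h0 => ?_⟩
  have hE : Measurable fun s : ℕ → ℝ => expNeg (∑' k, h (s k)) := continuous_expNeg.measurable.comp
    (Measurable.tsum fun k => hh.comp (measurable_pi_apply k))
  have hg : Measurable fun w => expNeg (h w) := continuous_expNeg.measurable.comp hh
  rw [integral_map hS.aemeasurable hE.aestronglyMeasurable,
    integral_prod (fun q => expNeg (∑' k, h (S q k))) (Integrable.of_bound (C := 1)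
      (hE.comp hS).aestronglyMeasurable (ae_of_all _ fun _ => abs_expNeg_le_one _))]
  have h1 : ∀ n : ℕ, ∫ y, expNeg (∑' k, h (S (n, y) k)) ∂(Measure.infinitePi fun _ : ℕ => ν₀)
      = (∫ w, expNeg (h w) ∂ν₀) ^ n := fun n => by
    have h2 : ∀ y : ℕ → ℝ, expNeg (∑' k, h (S (n, y) k)) = ∏ k : Fin n, expNeg (h (y k)) :=
      fun y => by
        rw [tsum_eq_sum (s := Finset.range n) fun k hk => by
          simp only [S]; rw [if_neg (by simpa using hk), h0], expNeg_sum, Finset.prod_range]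
        refine Finset.prod_congr rfl fun k _ => ?_
        simp [S]
    simp_rw [h2]
    rw [integral_prod_infinitePi (M := fun _ : ℕ => ν₀) (e := fun k : Fin n => (k : ℕ))
      Fin.val_injective (g := fun _ w => expNeg (h w)) fun _ => hg]
    simp
  simp_rw [h1]
  have hE1 : Integrable (fun w => expNeg (h w)) ν := Integrable.of_bound (C := 1)
    hg.aestronglyMeasurable (ae_of_all _ fun _ => abs_expNeg_le_one _)
  have hν1 : ∫ w, (1 - expNeg (h w)) ∂ν = c.toReal * (1 - ∫ w, expNeg (h w) ∂ν₀) := by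
    have hcr : c.toReal ≠ 0 := ENNReal.toReal_ne_zero.2 ⟨hc0, hc⟩
    rw [integral_sub (integrable_const _) hE1, integral_smul_measure, integral_const, smul_eq_mul,
      smul_eq_mul, ENNReal.toReal_inv, mul_one, mul_sub, mul_inv_cancel_left₀ hcr, mul_one]
    rfl
  rw [integral_pow_poissonMeasure, lintegral_one_sub_eq_ofReal hg (fun w => expNeg_nonneg _)
    fun w => expNeg_le_one _, expNeg_ofReal (integral_nonneg fun w => by
      simpa using expNeg_le_one (h w)), hν1]
  rfl

/-- Every Lévy measure is the mean measure of a Poisson point process. -/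
theorem IsLevyMeasure.exists_isPoissonPoints {ρ : Measure ℝ} (hρ : IsLevyMeasure ρ) :
    ∃ Q : Measure (ℕ → ℝ≥0), IsProbabilityMeasure Q ∧
      IsPoissonPoints Q (fun j t => (t j : ℝ)) ρ := by
  have := hρ.sigmaFinite
  choose Q hQ hlap using fun n => exists_poissonPoints_of_isFiniteMeasure (sfiniteSeq ρ n)
  -- superposition of independent processes with finite mean measures
  let S : (ℕ → ℕ → ℝ) → ℕ → ℝ≥0 := fun ω j => (ω (Nat.unpair j).1 (Nat.unpair j).2).toNNReal
  have hS : Measurable S := by fun_prop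
  have hSQ := Measure.isProbabilityMeasure_map (μ := Measure.infinitePi Q) hS.aemeasurable
  refine ⟨(Measure.infinitePi Q).map S, hSQ, isPoissonPoints_of_laplace (fun j => by fun_prop)
    (fun j t => (t j).2) fun h hh h0 => ?_⟩
  let h' : ℝ → ℝ≥0∞ := fun y => h y.toNNReal
  have hh' : Measurable h' := by fun_prop
  have hg : Measurable fun w => expNeg (h' w) := continuous_expNeg.measurable.comp hh'
  have hE : Measurable fun s : ℕ → ℝ => expNeg (∑' k, h' (s k)) :=
    continuous_expNeg.measurable.comp (Measurable.tsum fun k => hh'.comp (measurable_pi_apply k))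
  have hE' : Measurable fun t : ℕ → ℝ≥0 => expNeg (∑' j, h (t j)) :=
    continuous_expNeg.measurable.comp (Measurable.tsum fun k => by fun_prop)
  rw [integral_map hS.aemeasurable hE'.aestronglyMeasurable]
  have e1 : ∀ ω, ∑' j, h (S ω j) = ∑' n, ∑' k, h' (ω n k) := fun ω => by
    rw [← ENNReal.tsum_prod, ← Nat.pairEquiv.symm.tsum_eq]
    rfl
  have e2 : ∫⁻ w, ENNReal.ofReal (1 - expNeg (h w)) ∂ρ
      = ∑' n, ∫⁻ w, ENNReal.ofReal (1 - expNeg (h' w)) ∂(sfiniteSeq ρ n) := by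
    rw [← lintegral_sum_measure, sum_sfiniteSeq]
    refine lintegral_congr_ae ?_
    filter_upwards [hρ.ae_pos] with w hw
    simp only [h']
    rw [Real.coe_toNNReal _ hw.le]
  rw [e2]
  refine tendsto_nhds_unique (f := fun M => ∫ ω, ∏ n : Fin M, expNeg (∑' k, h' (ω n k))
    ∂(Measure.infinitePi Q)) (l := atTop) ?_ ?_
  · refine tendsto_integral_of_dominated_convergence (fun _ => 1) (fun M => ?_)
      (integrable_const _) (fun M => ae_of_all _ fun ω => ?_) (ae_of_all _ fun ω => ?_)
    · have hn : ∀ n : Fin M, Measurable fun ω : ℕ → ℕ → ℝ => expNeg (∑' k, h' (ω n k)) :=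
        fun n => hE.comp (measurable_pi_apply (n : ℕ))
      exact (Finset.measurable_fun_prod _ fun n _ => hn n).aestronglyMeasurable
    · rw [← expNeg_sum]
      exact abs_expNeg_le_one _
    · rw [e1]
      exact tendsto_expNeg_tsum fun n => ∑' k, h' (ω n k)
  · have hM : ∀ M, ∫ ω, ∏ n : Fin M, expNeg (∑' k, h' (ω n k)) ∂(Measure.infinitePi Q)
        = ∏ n : Fin M, expNeg (∫⁻ w, ENNReal.ofReal (1 - expNeg (h' w)) ∂(sfiniteSeq ρ n)) :=
      fun M => (integral_prod_infinitePi (M := Q) (e := fun k : Fin M => (k : ℕ))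
        Fin.val_injective (g := fun _ s => expNeg (∑' k, h' (s k))) fun _ => hE).trans
        (Finset.prod_congr rfl fun n _ => hlap n h' hh' (by simpa [h'] using h0))
    simp_rw [hM]
    exact tendsto_expNeg_tsum fun n =>
      ∫⁻ w, ENNReal.ofReal (1 - expNeg (h' w)) ∂(sfiniteSeq ρ n)

/-! ### The kernel of the next layer, for all inputs at once -/

section
variable {X : Type*} {φ : ℝ → ℝ} {t : ℕ → ℝ≥0} {z : ℕ → X → ℝ}

/-- The sum `∑ⱼ tⱼ φ(zⱼ(x))²`. -/
def activationEnergy (φ : ℝ → ℝ) (t : ℕ → ℝ≥0) (z : ℕ → X → ℝ) (x : X) : ℝ≥0∞ :=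
  ∑' j, ENNReal.ofReal (t j * φ (z j x) ^ 2)

open Classical in
/-- The activations at `x`, replaced by `0` if the series of their squares with weights `tⱼ`
diverges. This event is negligible, but only for each fixed `x`, so that it cannot be discarded
for all inputs at once. -/
def truncatedActivation (φ : ℝ → ℝ) (t : ℕ → ℝ≥0) (z : ℕ → X → ℝ) (j : ℕ) (x : X) : ℝ :=
  if activationEnergy φ t z x < ∞ then φ (z j x) else 0

/-- The right-hand side of the recursion, with truncated activations. It is a covariance kernel
without any exceptional event. -/
def nextKernel (σb σv : ℝ≥0) (φ : ℝ → ℝ) (a : ℝ) (k : X → X → ℝ) (t : ℕ → ℝ≥0) (z : ℕ → X → ℝ)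
    (x x' : X) : ℝ :=
  (σb : ℝ) ^ 2 + (σv : ℝ) ^ 2 * (a * activationMoment φ k x x')
    + (σv : ℝ) ^ 2 *
      ∑' j, t j * truncatedActivation φ t z j x * truncatedActivation φ t z j x'

theorem summable_sq_truncatedActivation (φ : ℝ → ℝ) (t : ℕ → ℝ≥0) (z : ℕ → X → ℝ) (x : X) :
    Summable fun j => (t j : ℝ) * truncatedActivation φ t z j x ^ 2 := by
  by_cases h : activationEnergy φ t z x < ∞
  · simp only [truncatedActivation, if_pos h]
    have h1 := ENNReal.summable_toReal h.ne
    refine h1.congr fun j => ?_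
    rw [ENNReal.toReal_ofReal (by positivity)]
  · simpa only [truncatedActivation, if_neg h, zero_pow two_ne_zero, mul_zero] using summable_zero

theorem summable_truncatedActivation (φ : ℝ → ℝ) (t : ℕ → ℝ≥0) (z : ℕ → X → ℝ) (x x' : X) :
    Summable fun j =>
      (t j : ℝ) * truncatedActivation φ t z j x * truncatedActivation φ t z j x' := by
  refine Summable.of_norm_bounded ((summable_sq_truncatedActivation φ t z x).add
    (summable_sq_truncatedActivation φ t z x')) fun j => ?_
  rw [← mul_add, mul_assoc, norm_mul, Real.norm_of_nonneg (t j).coe_nonneg]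
  refine mul_le_mul_of_nonneg_left ?_ (t j).2
  rw [Real.norm_eq_abs, abs_le]
  constructor <;> nlinarith [sq_nonneg (truncatedActivation φ t z j x
    + truncatedActivation φ t z j x'), sq_nonneg (truncatedActivation φ t z j x
    - truncatedActivation φ t z j x')]

theorem hasSum_nextKernel {σb σv : ℝ≥0} {a : ℝ} {k : X → X → ℝ} {x x' : X}
    (hx : activationEnergy φ t z x < ∞) (hx' : activationEnergy φ t z x' < ∞) :
    HasSum (fun j => (σv : ℝ) ^ 2 * ((t j : ℝ) * φ (z j x) * φ (z j x')))
      (nextKernel σb σv φ a k t z x x' - (σb : ℝ) ^ 2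
        - (σv : ℝ) ^ 2 * (a * activationMoment φ k x x')) := by
  have h := (summable_truncatedActivation φ t z x x').hasSum.mul_left ((σv : ℝ) ^ 2)
  have e : nextKernel σb σv φ a k t z x x' - (σb : ℝ) ^ 2
        - (σv : ℝ) ^ 2 * (a * activationMoment φ k x x')
      = (σv : ℝ) ^ 2 *
        ∑' j, t j * truncatedActivation φ t z j x * truncatedActivation φ t z j x' := by
    rw [nextKernel]; ring
  rw [e]
  simpa only [truncatedActivation, if_pos hx, if_pos hx'] using h

theorem isCovKernel_nextKernel (σb σv : ℝ≥0) (hφ : Continuous φ)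
    (henv : ∃ A B C : ℝ, 0 < A ∧ 0 < B ∧ 0 < C ∧ ∀ z : ℝ, |φ z| ≤ A + B * |z| ^ C)
    {a : ℝ} (ha : 0 ≤ a) {k : X → X → ℝ} (hk : IsCovKernel k) (t : ℕ → ℝ≥0) (z : ℕ → X → ℝ) :
    IsCovKernel (nextKernel σb σv φ a k t z) := by
  intro n x
  let b : X → X → ℝ := fun x x' =>
    (σb : ℝ) ^ 2 + (σv : ℝ) ^ 2 * (a * activationMoment φ k x x')
  let c : X → X → ℝ := fun x x' => (σv : ℝ) ^ 2 *
    ∑' j, t j * truncatedActivation φ t z j x * truncatedActivation φ t z j x'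
  have h1 : (gramMatrix b x).PosSemidef := by
    refine posSemidef_of_recursion (σb := σb) (σv := σv) (T := fun _ => 0) (z := z) hφ henv ha
      (fun _ => le_rfl) (hk n x) fun i j => ?_
    have : b (x i) (x j) - (σb : ℝ) ^ 2
        - (σv : ℝ) ^ 2 * (a * activationMoment φ k (x i) (x j)) = 0 := by
      simp only [b]; ring
    rw [this]
    simp
  have h2 : (gramMatrix c x).PosSemidef := by
    refine Matrix.PosSemidef.of_dotProduct_mulVec_nonneg ?_ fun v => ?_
    · ext i j
      simp only [gramMatrix, Matrix.conjTranspose_apply, Matrix.of_apply, star_trivial, c]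
      congr 2 with r
      ring
    · rw [star_trivial, dotProduct_gramMatrix_mulVec]
      have hs := hasSum_sum (s := Finset.univ) fun i _ => hasSum_sum (s := Finset.univ) fun j _ =>
        (((summable_truncatedActivation φ t z (x i) (x j)).hasSum.mul_left
          ((σv : ℝ) ^ 2)).mul_left (v i * v j))
      refine hs.nonneg fun r => ?_
      have : ∑ i, ∑ j, v i * v j * ((σv : ℝ) ^ 2 * (t r * truncatedActivation φ t z r (x i)
          * truncatedActivation φ t z r (x j)))
          = (σv : ℝ) ^ 2 * t r * (∑ i, v i * truncatedActivation φ t z r (x i)) ^ 2 := by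
        rw [sq (∑ i, v i * truncatedActivation φ t z r (x i)), Finset.sum_mul_sum]
        simp only [Finset.mul_sum]
        refine Finset.sum_congr rfl fun i _ => Finset.sum_congr rfl fun j _ => by ring
      rw [this]
      positivity
  have h3 : gramMatrix (nextKernel σb σv φ a k t z) x = gramMatrix b x + gramMatrix c x := rfl
  rw [h3]
  exact h1.add h2

theorem measurable_activationEnergy (hφ : Continuous φ) (x : X) :
    Measurable fun q : (ℕ → ℝ≥0) × (ℕ → X → ℝ) => activationEnergy φ q.1 q.2 x := by
  have hz : ∀ j, Measurable fun q : (ℕ → ℝ≥0) × (ℕ → X → ℝ) => φ (q.2 j x) := fun j =>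
    hφ.measurable.comp (by fun_prop)
  exact Measurable.tsum fun j => ((by fun_prop : Measurable fun q : (ℕ → ℝ≥0) × (ℕ → X → ℝ) =>
    (q.1 j : ℝ)).mul ((hz j).pow_const 2)).ennreal_ofReal

theorem measurable_truncatedActivation (hφ : Continuous φ) (j : ℕ) (x : X) :
    Measurable fun q : (ℕ → ℝ≥0) × (ℕ → X → ℝ) => truncatedActivation φ q.1 q.2 j x :=
  Measurable.ite (measurableSet_lt (measurable_activationEnergy hφ x) measurable_const)
    (hφ.measurable.comp (by fun_prop)) measurable_const

theorem measurable_nextKernel (σb σv : ℝ≥0) (hφ : Continuous φ) (a : ℝ) :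
    Measurable fun q : (X → X → ℝ) × (ℕ → ℝ≥0) × (ℕ → X → ℝ) =>
      nextKernel σb σv φ a q.1 q.2.1 q.2.2 := by
  refine measurable_pi_lambda _ fun x => measurable_pi_lambda _ fun x' => ?_
  have h1 : Measurable fun q : (X → X → ℝ) × (ℕ → ℝ≥0) × (ℕ → X → ℝ) =>
      activationMoment φ q.1 x x' := (measurable_activationMoment hφ x x').comp measurable_fst
  have h2 : Measurable fun q : (ℕ → ℝ≥0) × (ℕ → X → ℝ) =>
      ∑' j, q.1 j * truncatedActivation φ q.1 q.2 j x * truncatedActivation φ q.1 q.2 j x' := by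
    have h3 : ∀ j, Measurable fun q : (ℕ → ℝ≥0) × (ℕ → X → ℝ) =>
        (q.1 j : ℝ) * truncatedActivation φ q.1 q.2 j x * truncatedActivation φ q.1 q.2 j x' :=
      fun j => ((by fun_prop : Measurable fun q : (ℕ → ℝ≥0) × (ℕ → X → ℝ) => (q.1 j : ℝ)).mul
        (measurable_truncatedActivation hφ j x)).mul (measurable_truncatedActivation hφ j x')
    have h4 : ∀ J : ℕ, Measurable fun q : (ℕ → ℝ≥0) × (ℕ → X → ℝ) => ∑ j ∈ Finset.range J,
        (q.1 j : ℝ) * truncatedActivation φ q.1 q.2 j x * truncatedActivation φ q.1 q.2 j x' :=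
      fun J => Finset.measurable_fun_sum _ fun j _ => h3 j
    exact measurable_of_tendsto_metrizable h4 (tendsto_pi_nhds.2 fun q =>
      (summable_truncatedActivation φ q.1 q.2 x x').hasSum.tendsto_sum_nat)
  exact (measurable_const.add ((h1.const_mul _).const_mul _)).add
    ((h2.comp measurable_snd).const_mul _)

/-- For each input, the truncation is almost surely void: the points are summable and the
activations have a common finite second moment. -/
theorem ae_activationEnergy_lt_top (hφ : Continuous φ)
    (henv : ∃ A B C : ℝ, 0 < A ∧ 0 < B ∧ 0 < C ∧ ∀ z : ℝ, |φ z| ≤ A + B * |z| ^ C)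
    {k : X → X → ℝ} (hk : IsCovKernel k) (ht : ∑' j, (t j : ℝ≥0∞) < ∞) (x : X) :
    ∀ᵐ z ∂(gaussianProcesses hk), activationEnergy φ t z x < ∞ := by
  have hm : ∀ j, Measurable fun z : ℕ → X → ℝ => φ (z j x) := fun j =>
    hφ.measurable.comp (by fun_prop)
  have hmt : ∀ j, Measurable fun z : ℕ → X → ℝ => ENNReal.ofReal (t j * φ (z j x) ^ 2) :=
    fun j => (((hm j).pow_const 2).const_mul _).ennreal_ofReal
  set c : ℝ≥0∞ := ∫⁻ y : EuclideanSpace ℝ (Fin 1), ENNReal.ofReal (φ (y 0) ^ 2)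
    ∂(multivariateGaussian 0 (gramMatrix k fun _ : Fin 1 => x))
  have hc : c < ∞ := by
    have := integrable_sq_activation hφ henv (gramMatrix k fun _ : Fin 1 => x) 0
    exact this.lintegral_lt_top
  have hj : ∀ j, ∫⁻ z, ENNReal.ofReal (t j * φ (z j x) ^ 2) ∂(gaussianProcesses hk)
      = t j * c := fun j => by
    have h1 : ∀ z : ℕ → X → ℝ, ENNReal.ofReal (t j * φ (z j x) ^ 2)
        = t j * ENNReal.ofReal (φ (z j x) ^ 2) := fun z => by
      rw [ENNReal.ofReal_mul (t j).coe_nonneg, ENNReal.ofReal_coe_nnreal]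
    simp_rw [h1]
    rw [lintegral_const_mul _ (((hm j).pow_const 2).ennreal_ofReal)]
    congr 1
    have h2 := (measurePreserving_eval_infinitePi (fun _ : ℕ => gaussianProcess hk) j)
    have h3 : Measurable fun w : X → ℝ => ENNReal.ofReal (φ (w x) ^ 2) :=
      ((hφ.measurable.comp (measurable_pi_apply x)).pow_const 2).ennreal_ofReal
    have h4 : Measurable fun y : EuclideanSpace ℝ (Fin 1) => ENNReal.ofReal (φ (y 0) ^ 2) :=
      (by fun_prop : Continuous fun y : EuclideanSpace ℝ (Fin 1) =>
        φ (y 0) ^ 2).measurable.ennreal_ofReal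
    simp only [c]
    rw [← gaussianProcess_map hk, lintegral_map h4 (by fun_prop), ← h2.map_eq]
    exact (lintegral_map h3 h2.measurable).symm
  refine ae_lt_top (Measurable.tsum hmt) ?_
  have h1 : ∫⁻ z, activationEnergy φ t z x ∂(gaussianProcesses hk) = (∑' j, (t j : ℝ≥0∞)) * c := by
    rw [← ENNReal.tsum_mul_right, ← tsum_congr hj]
    exact lintegral_tsum fun j => (hmt j).aemeasurable
  rw [h1]
  exact (ENNReal.mul_lt_top ht hc).ne

end

/-! ### The Markov chain of kernels, points and Gaussian processes -/

/-- The covariance kernels on `X`. -/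
abbrev CovKernel (X : Type*) := {k : X → X → ℝ // IsCovKernel k}

/-- A sequence of points, a sequence of random functions and the covariance kernel of the next
layer. -/
abbrev LayerState (X : Type*) := (ℕ → ℝ≥0) × (ℕ → X → ℝ) × CovKernel X

section
variable {X : Type*} {Q : Measure (ℕ → ℝ≥0)} [IsProbabilityMeasure Q]
  {F : CovKernel X × (ℕ → ℝ≥0) × (ℕ → X → ℝ) → CovKernel X}

/-- Given the covariance kernel `k`, draw points with law `Q` and independent Gaussian processes
with covariance kernel `k`, and apply `F`. -/
def layerTransition (Q : Measure (ℕ → ℝ≥0))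
    (F : CovKernel X × (ℕ → ℝ≥0) × (ℕ → X → ℝ) → CovKernel X) :
    Kernel (CovKernel X) (LayerState X) :=
  (Kernel.id ×ₖ (Kernel.const (CovKernel X) Q ×ₖ gaussianProcessesKernel X)).map
    fun q => (q.2.1, q.2.2, F q)

theorem isMarkovKernel_layerTransition (hF : Measurable F) :
    IsMarkovKernel (layerTransition Q F) :=
  Kernel.IsMarkovKernel.map _ (by fun_prop)

theorem layerTransition_apply (hF : Measurable F) (k : CovKernel X) :
    layerTransition Q F k
      = (Q.prod (gaussianProcesses k.2)).map fun q => (q.1, q.2, F (k, q)) := by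
  rw [layerTransition, Kernel.map_apply _ (by fun_prop), Kernel.prod_apply, Kernel.prod_apply,
    Kernel.id_apply, Kernel.const_apply, Measure.dirac_prod, Measure.map_map (by fun_prop)
      (by fun_prop)]
  rfl

end

section
variable {X : Type*} {Q : ℕ → Measure (ℕ → ℝ≥0)} [∀ n, IsProbabilityMeasure (Q n)]
  {F : ℕ → CovKernel X × (ℕ → ℝ≥0) × (ℕ → X → ℝ) → CovKernel X} (k₀ : CovKernel X)

/-- The covariance kernel of layer `n + 1`, which is deterministic in the first layer. -/
def currentKernel (n : ℕ) (y : LayerState X) : CovKernel X := if n = 0 then k₀ else y.2.2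

theorem measurable_currentKernel (n : ℕ) : Measurable (currentKernel k₀ n) := by
  unfold currentKernel
  split_ifs <;> fun_prop

/-- The conditional law of the state at time `n + 1` given the states up to time `n`. -/
def HasLayerTransition (P : Measure (ℕ → LayerState X)) (Q : Measure (ℕ → ℝ≥0))
    (F : CovKernel X × (ℕ → ℝ≥0) × (ℕ → X → ℝ) → CovKernel X) (k₀ : CovKernel X) (n : ℕ) : Prop :=
  ∀ S : Set ((Π _ : Finset.Iic n, LayerState X) × LayerState X), MeasurableSet S →
    P {ω | (Preorder.frestrictLe n ω, ω (n + 1)) ∈ S}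
      = ∫⁻ ω, (Q.prod (gaussianProcesses (currentKernel k₀ n (ω n)).2))
          {q | (Preorder.frestrictLe n ω, q.1, q.2, F (currentKernel k₀ n (ω n), q)) ∈ S} ∂P

/-- There is a Markov chain whose transition at time `n` is `layerTransition (Q n) (F n)`, from the
current covariance kernel. -/
theorem exists_layerChain (hF : ∀ n, Measurable (F n)) :
    ∃ P : Measure (ℕ → LayerState X), IsProbabilityMeasure P ∧
      ∀ n, HasLayerTransition P (Q n) (F n) k₀ n := by
  have hM := fun n => isMarkovKernel_layerTransition (Q := Q n) (hF n)
  let c : ∀ n, (Π _ : Finset.Iic n, LayerState X) → CovKernel X := fun n h =>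
    currentKernel k₀ n (h ⟨n, by simp⟩)
  have hc : ∀ n, Measurable (c n) := fun n =>
    (measurable_currentKernel k₀ n).comp (measurable_pi_apply _)
  let κ : ∀ n, Kernel (Π _ : Finset.Iic n, LayerState X) (LayerState X) := fun n =>
    (layerTransition (Q n) (F n)).comap (c n) (hc n)
  let P := Kernel.trajMeasure (X := fun _ => LayerState X)
    (Measure.dirac (fun _ => 0, fun _ _ => 0, k₀)) κ
  refine ⟨P, inferInstance, fun n S hS => ?_⟩
  have h := Kernel.map_frestrictLe_trajMeasure_compProd_eq_map_trajMeasure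
    (X := fun _ => LayerState X) (μ₀ := Measure.dirac (fun _ => 0, fun _ _ => 0, k₀)) (κ := κ)
    (a := n)
  have h1 := congrArg (fun M => M S) h
  rw [Measure.map_apply (by fun_prop) hS, Measure.compProd_apply hS,
    lintegral_map (Kernel.measurable_kernel_prodMk_left hS) (by fun_prop)] at h1
  refine h1.symm.trans (lintegral_congr fun ω => ?_)
  simp only [κ]
  rw [Kernel.comap_apply, layerTransition_apply (hF n), Measure.map_apply
    (by have := hF n; fun_prop) (hS.preimage (by fun_prop))]
  rfl

end

/-! ### Existence of a solution of the kernel recursion -/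

section
variable {X : Type*} {Q : Measure (ℕ → ℝ≥0)} [IsProbabilityMeasure Q] {k₀ : CovKernel X}
  {F : CovKernel X × (ℕ → ℝ≥0) × (ℕ → X → ℝ) → CovKernel X} {n : ℕ}
  {P : Measure (ℕ → LayerState X)} [IsProbabilityMeasure P]

theorem measurable_points (n : ℕ) : Measurable fun ω : ℕ → LayerState X => (ω (n + 1)).1 :=
  measurable_fst.comp (measurable_pi_apply _)

theorem measurable_processes (n : ℕ) : Measurable fun ω : ℕ → LayerState X => (ω (n + 1)).2.1 :=
  measurable_fst.comp (measurable_snd.comp (measurable_pi_apply _))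

theorem measurable_history_points (n : ℕ) : Measurable fun ω : ℕ → LayerState X =>
    (Preorder.frestrictLe (π := fun _ => LayerState X) n ω, (ω (n + 1)).1) :=
  Measurable.prodMk (by fun_prop) (measurable_points n)

/-- The points are independent of the past, and have law `Q`. -/
theorem HasLayerTransition.map_points (h : HasLayerTransition P Q F k₀ n) :
    P.map (fun ω => (Preorder.frestrictLe (π := fun _ => LayerState X) n ω, (ω (n + 1)).1))
      = (P.map (Preorder.frestrictLe (π := fun _ => LayerState X) n)).prod Q := by
  ext A hA
  have h1 := h ((fun p => (p.1, p.2.1)) ⁻¹' A) (hA.preimage (by fun_prop))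
  rw [Measure.map_apply (by fun_prop) hA, Measure.prod_apply hA,
    lintegral_map (measurable_measure_prodMk_left hA) (by fun_prop)]
  refine h1.trans (lintegral_congr fun ω => ?_)
  have h2 := measurePreserving_fst (μ := Q)
    (ν := gaussianProcesses (currentKernel k₀ n (ω n)).2)
  have h3 : MeasurableSet {t | (Preorder.frestrictLe (π := fun _ => LayerState X) n ω, t) ∈ A} :=
    hA.preimage (by fun_prop)
  exact h2.measure_preimage h3.nullMeasurableSet

theorem HasLayerTransition.map_fst (h : HasLayerTransition P Q F k₀ n) :
    P.map (fun ω => (ω (n + 1)).1) = Q := by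
  have := Measure.isProbabilityMeasure_map (μ := P)
    (f := Preorder.frestrictLe (π := fun _ => LayerState X) n) (by fun_prop)
  have h1 := congrArg (fun M => M.map Prod.snd) h.map_points
  rw [Measure.map_map measurable_snd (measurable_history_points n)] at h1
  refine h1.trans ?_
  exact (measurePreserving_snd (μ := P.map (Preorder.frestrictLe n)) (ν := Q)).map_eq

theorem HasLayerTransition.indepFun (h : HasLayerTransition P Q F k₀ n) :
    IndepFun (fun ω => (ω (n + 1)).1)
      (Preorder.frestrictLe (π := fun _ => LayerState X) n) P := by
  refine IndepFun.symm ?_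
  rw [indepFun_iff_map_prod_eq_prod_map_map (by fun_prop) (measurable_points n).aemeasurable,
    h.map_fst]
  exact h.map_points

theorem HasLayerTransition.isPoissonPoints (h : HasLayerTransition P Q F k₀ n) {ρ : Measure ℝ}
    (hρ : IsLevyMeasure ρ) (hQ : IsPoissonPoints Q (fun j t => (t j : ℝ)) ρ) :
    IsPoissonPoints P (fun j ω => ((ω (n + 1)).1 j : ℝ)) ρ := by
  refine isPoissonPoints_of_laplace (fun j => by fun_prop) (fun j ω => NNReal.coe_nonneg _)
    fun g hg h0 => ?_
  have hm : Measurable fun t : ℕ → ℝ≥0 => expNeg (∑' j, g (t j)) :=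
    continuous_expNeg.measurable.comp (Measurable.tsum fun j => by fun_prop)
  rw [← hQ.laplace hρ hg h0, ← h.map_fst,
    integral_map (measurable_points n).aemeasurable hm.aestronglyMeasurable]

theorem measurable_iidGaussian_currentKernel (k₀ : CovKernel X) (n m : ℕ) {N : ℕ} (x : Fin N → X)
    {C : Set (Fin m → EuclideanSpace ℝ (Fin N))} (hC : MeasurableSet C) :
    Measurable fun y => iidGaussian (currentKernel k₀ n y).1 x m C :=
  ((Measure.measurable_coe hC).comp (measurable_iidGaussian x m)).comp
    (measurable_subtype_coe.comp (measurable_currentKernel k₀ n))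

theorem HasLayerTransition.setLIntegral_iidGaussian (h : HasLayerTransition P Q F k₀ n) (m : ℕ)
    {N : ℕ} (x : Fin N → X) {C : Set (Fin m → EuclideanSpace ℝ (Fin N))} (hC : MeasurableSet C)
    {A : Set ((Π _ : Finset.Iic n, LayerState X) × (ℕ → ℝ≥0))} (hA : MeasurableSet A) :
    ∫⁻ ω in {ω | (Preorder.frestrictLe n ω, (ω (n + 1)).1) ∈ A},
        iidGaussian (currentKernel k₀ n (ω n)).1 x m C ∂P
      = ∫⁻ ω, iidGaussian (currentKernel k₀ n (ω n)).1 x m C *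
          Q {t | (Preorder.frestrictLe n ω, t) ∈ A} ∂P := by
  let g : (Π _ : Finset.Iic n, LayerState X) → ℝ≥0∞ := fun y =>
    iidGaussian (currentKernel k₀ n (y ⟨n, by simp⟩)).1 x m C
  have hg : Measurable g :=
    (measurable_iidGaussian_currentKernel k₀ n m x hC).comp (measurable_pi_apply _)
  let G : (Π _ : Finset.Iic n, LayerState X) × (ℕ → ℝ≥0) → ℝ≥0∞ := fun q => g q.1
  have hG : Measurable G := hg.comp measurable_fst
  have h2 : ∫⁻ q in A, G q ∂(P.map (Preorder.frestrictLe (π := fun _ => LayerState X) n)).prod Q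
      = ∫⁻ ω, g (Preorder.frestrictLe n ω) *
        Q {t | (Preorder.frestrictLe (π := fun _ => LayerState X) n ω, t) ∈ A} ∂P := by
    rw [← lintegral_indicator hA, lintegral_prod _
      (hG.indicator hA).aemeasurable,
      lintegral_map (Measurable.lintegral_prod_right' (hG.indicator hA))
        (by fun_prop)]
    refine lintegral_congr fun ω => ?_
    have h3 : ∀ t, A.indicator G (Preorder.frestrictLe n ω, t)
        = {t | (Preorder.frestrictLe (π := fun _ => LayerState X) n ω, t) ∈ A}.indicator
          (fun _ => g (Preorder.frestrictLe n ω)) t := fun t => by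
      by_cases ht : (Preorder.frestrictLe (π := fun _ => LayerState X) n ω, t) ∈ A
      · rw [Set.indicator_of_mem ht, Set.indicator_of_mem (by exact ht)]
      · rw [Set.indicator_of_notMem ht, Set.indicator_of_notMem (by exact ht)]
    exact (lintegral_congr h3).trans (lintegral_indicator_const (hA.preimage (by fun_prop)) _)
  rw [← h.map_points, setLIntegral_map hA hG
    (measurable_history_points n)] at h2
  exact h2

theorem measurableSet_processes (n m : ℕ) {N : ℕ} (x : Fin N → X)
    {C : Set (Fin m → EuclideanSpace ℝ (Fin N))} (hC : MeasurableSet C) :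
    MeasurableSet {ω : ℕ → LayerState X | (fun j : Fin m =>
      (WithLp.toLp 2 fun r : Fin N => (ω (n + 1)).2.1 j (x r) :
        EuclideanSpace ℝ (Fin N))) ∈ C} := by
  have hz : Measurable fun (z : ℕ → X → ℝ) (j : Fin m) =>
      (WithLp.toLp 2 fun r : Fin N => z j (x r) : EuclideanSpace ℝ (Fin N)) := by fun_prop
  exact hC.preimage (hz.comp (measurable_processes n))

theorem HasLayerTransition.setIntegral_iidGaussian (h : HasLayerTransition P Q F k₀ n) (m : ℕ)
    {N : ℕ} (x : Fin N → X) {C : Set (Fin m → EuclideanSpace ℝ (Fin N))} (hC : MeasurableSet C)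
    {A : Set ((Π _ : Finset.Iic n, LayerState X) × (ℕ → ℝ≥0))} (hA : MeasurableSet A) :
    ∫ ω in {ω | (Preorder.frestrictLe n ω, (ω (n + 1)).1) ∈ A},
        (iidGaussian (currentKernel k₀ n (ω n)).1 x m).real C ∂P
      = P.real ({ω | (fun j : Fin m =>
          (WithLp.toLp 2 fun r : Fin N => (ω (n + 1)).2.1 j (x r) : EuclideanSpace ℝ (Fin N))) ∈ C}
        ∩ {ω | (Preorder.frestrictLe n ω, (ω (n + 1)).1) ∈ A}) := by
  have hz : Measurable fun (z : ℕ → X → ℝ) (j : Fin m) =>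
      (WithLp.toLp 2 fun r : Fin N => z j (x r) : EuclideanSpace ℝ (Fin N)) := by fun_prop
  have h2 := h {p | (fun j : Fin m =>
      (WithLp.toLp 2 fun r : Fin N => p.2.2.1 j (x r) : EuclideanSpace ℝ (Fin N))) ∈ C ∧
        (p.1, p.2.1) ∈ A}
    ((hC.preimage (hz.comp (by fun_prop : Measurable fun p :
      (Π _ : Finset.Iic n, LayerState X) × LayerState X => p.2.2.1))).inter
        (hA.preimage (by fun_prop)))
  have h3 : ∀ ω : ℕ → LayerState X, (Q.prod (gaussianProcesses (currentKernel k₀ n (ω n)).2))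
      {q | (fun j : Fin m =>
        (WithLp.toLp 2 fun r : Fin N => q.2 j (x r) : EuclideanSpace ℝ (Fin N))) ∈ C ∧
          (Preorder.frestrictLe (π := fun _ => LayerState X) n ω, q.1) ∈ A}
      = iidGaussian (currentKernel k₀ n (ω n)).1 x m C *
          Q {t | (Preorder.frestrictLe n ω, t) ∈ A} := fun ω => by
    rw [← gaussianProcesses_map (currentKernel k₀ n (ω n)).2 x m, Measure.map_apply hz hC,
      mul_comm, ← Measure.prod_prod]
    congr 1
    ext q
    exact and_comm
  have h4 := h2.trans (lintegral_congr h3)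
  rw [← h.setLIntegral_iidGaussian m x hC hA] at h4
  refine (integral_toReal ?_ (ae_of_all _ fun ω => measure_lt_top _ _)).trans
    (congrArg ENNReal.toReal h4.symm)
  exact ((measurable_iidGaussian_currentKernel k₀ n m x hC).comp
    (measurable_pi_apply n)).aemeasurable

/-- Given the past and the points, the Gaussian processes have the current covariance kernel. -/
theorem HasLayerTransition.condExp_eq (h : HasLayerTransition P Q F k₀ n)
    {m' : MeasurableSpace (ℕ → LayerState X)}
    (hm' : m' ≤ MeasurableSpace.comap (fun ω =>
      (Preorder.frestrictLe (π := fun _ => LayerState X) n ω, (ω (n + 1)).1))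
        Prod.instMeasurableSpace)
    (hK : Measurable[m'] fun ω => (currentKernel k₀ n (ω n)).1) (m : ℕ) {N : ℕ} (x : Fin N → X)
    {C : Set (Fin m → EuclideanSpace ℝ (Fin N))} (hC : MeasurableSet C) :
    P⟦{ω | (fun j : Fin m => WithLp.toLp 2 fun r : Fin N => (ω (n + 1)).2.1 j (x r)) ∈ C} | m'⟧
      =ᵐ[P] fun ω => (iidGaussian (currentKernel k₀ n (ω n)).1 x m).real C := by
  have hm : m' ≤ MeasurableSpace.pi := hm'.trans (measurable_history_points n).comap_le
  have hE := measurableSet_processes n m x hC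
  have hG : Measurable fun k : X → X → ℝ => iidGaussian k x m C :=
    (Measure.measurable_coe hC).comp (measurable_iidGaussian x m)
  have hGm : StronglyMeasurable[m'] fun ω =>
      (iidGaussian (currentKernel k₀ n (ω n)).1 x m).real C :=
    (hG.ennreal_toReal.comp hK).stronglyMeasurable
  have hGi : Integrable (fun ω => (iidGaussian (currentKernel k₀ n (ω n)).1 x m).real C) P :=
    Integrable.of_bound (C := 1) (hGm.mono hm).aestronglyMeasurable (ae_of_all _ fun ω => by
      rw [Real.norm_of_nonneg measureReal_nonneg]; exact measureReal_le_one)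
  refine (ae_eq_condExp_of_forall_setIntegral_eq hm
    ((integrable_const (1 : ℝ)).indicator hE) (fun _ _ _ => hGi.integrableOn) (fun s hs _ => ?_)
    hGm.aestronglyMeasurable).symm
  obtain ⟨A, hA, rfl⟩ := hm' s hs
  refine (h.setIntegral_iidGaussian m x hC hA).trans ?_
  rw [← measureReal_restrict_apply hE]
  exact (integral_indicator_one hE).symm

/-- The state at time `n + 1` satisfies the recursion. -/
theorem HasLayerTransition.ae_recursion {σb σv : ℝ≥0} {φ : ℝ → ℝ} (hφ : Continuous φ)
    (henv : ∃ A B C : ℝ, 0 < A ∧ 0 < B ∧ 0 < C ∧ ∀ z : ℝ, |φ z| ≤ A + B * |z| ^ C) {a : ℝ}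
    (hF : ∀ q, (F q).1 = nextKernel σb σv φ a q.1.1 q.2.1 q.2.2)
    (h : HasLayerTransition P Q F k₀ n)
    (hQ : ∀ᵐ t ∂Q, ∑' j, (t j : ℝ≥0∞) < ∞) (x x' : X) :
    ∀ᵐ ω ∂P, HasSum (fun j => (σv : ℝ) ^ 2 * (((ω (n + 1)).1 j : ℝ) * φ ((ω (n + 1)).2.1 j x)
          * φ ((ω (n + 1)).2.1 j x')))
        ((ω (n + 1)).2.2.1 x x' - (σb : ℝ) ^ 2
          - (σv : ℝ) ^ 2 * (a * activationMoment φ (currentKernel k₀ n (ω n)).1 x x')) := by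
  let S : Set ((Π _ : Finset.Iic n, LayerState X) × LayerState X) := {p |
    p.2.2.2.1 x x' = nextKernel σb σv φ a (currentKernel k₀ n (p.1 ⟨n, by simp⟩)).1 p.2.1 p.2.2.1
      x x' ∧ activationEnergy φ p.2.1 p.2.2.1 x < ∞ ∧ activationEnergy φ p.2.1 p.2.2.1 x' < ∞}
  have hE : ∀ x, Measurable fun p : (Π _ : Finset.Iic n, LayerState X) × LayerState X =>
      activationEnergy φ p.2.1 p.2.2.1 x := fun x =>
    (measurable_activationEnergy hφ x).comp (by fun_prop : Measurable
      fun p : (Π _ : Finset.Iic n, LayerState X) × LayerState X => (p.2.1, p.2.2.1))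
  have hS : MeasurableSet S := by
    refine (measurableSet_eq_fun ?_ ?_).inter ((measurableSet_lt (hE x) measurable_const).inter
      (measurableSet_lt (hE x') measurable_const))
    · exact (measurable_pi_apply x').comp ((measurable_pi_apply x).comp
        (measurable_subtype_coe.comp (by fun_prop : Measurable
          fun p : (Π _ : Finset.Iic n, LayerState X) × LayerState X => p.2.2.2)))
    · have h1 : Measurable fun p : (Π _ : Finset.Iic n, LayerState X) × LayerState X =>
          ((currentKernel k₀ n (p.1 ⟨n, by simp⟩)).1, p.2.1, p.2.2.1) := by
        refine Measurable.prodMk (measurable_subtype_coe.comp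
          ((measurable_currentKernel k₀ n).comp (by fun_prop))) (by fun_prop)
      exact (measurable_pi_apply x').comp ((measurable_pi_apply x).comp
        ((measurable_nextKernel σb σv hφ a).comp h1))
  have h1 := h Sᶜ hS.compl
  have h2 : ∀ ω : ℕ → LayerState X, (Q.prod (gaussianProcesses (currentKernel k₀ n (ω n)).2))
      {q | (Preorder.frestrictLe (π := fun _ => LayerState X) n ω, q.1, q.2,
        F (currentKernel k₀ n (ω n), q)) ∈ Sᶜ} = 0 := fun ω => by
    set k := currentKernel k₀ n (ω n)
    have h3 : ∀ x, ∀ᵐ q ∂(Q.prod (gaussianProcesses k.2)),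
        activationEnergy φ q.1 q.2 x < ∞ := fun x => by
      refine (Measure.ae_prod_iff_ae_ae (p := fun q => activationEnergy φ q.1 q.2 x < ∞)
        (measurableSet_lt (measurable_activationEnergy hφ x) measurable_const)).2 ?_
      filter_upwards [hQ] with t ht
      exact ae_activationEnergy_lt_top hφ henv k.2 ht x
    have h4 : ∀ᵐ q ∂(Q.prod (gaussianProcesses k.2)),
        (Preorder.frestrictLe (π := fun _ => LayerState X) n ω, q.1, q.2, F (k, q)) ∈ S := by
      filter_upwards [h3 x, h3 x'] with q hq hq'
      refine ⟨?_, hq, hq'⟩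
      simp only [hF]
      rfl
    exact h4
  simp_rw [h2, lintegral_zero] at h1
  have h3 : ∀ᵐ ω ∂P, (Preorder.frestrictLe (π := fun _ => LayerState X) n ω, ω (n + 1)) ∈ S := h1
  filter_upwards [h3] with ω hω
  rw [hω.1]
  exact hasSum_nextKernel hω.2.1 hω.2.2

end

/-- The kernel recursion has a solution consisting of covariance kernels. -/
theorem exists_isKernelRecursion {L d : ℕ} (σb σv : ℝ≥0) {φ : ℝ → ℝ} (hφ : Continuous φ)
    (henv : ∃ A B C : ℝ, 0 < A ∧ 0 < B ∧ 0 < C ∧ ∀ z : ℝ, |φ z| ≤ A + B * |z| ^ C)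
    {a : Fin L → ℝ} (ha : ∀ i, 0 ≤ a i) {ρ : Fin L → Measure ℝ} (hρ : ∀ i, IsLevyMeasure (ρ i)) :
    ∃ (Ω' : Type) (_ : MeasurableSpace Ω') (P' : Measure Ω') (_ : IsProbabilityMeasure P')
      (K : Fin (L + 1) → Ω' → EuclideanSpace ℝ (Fin d) → EuclideanSpace ℝ (Fin d) → ℝ)
      (T : Fin L → ℕ → Ω' → ℝ) (ζ : Fin L → ℕ → Ω' → EuclideanSpace ℝ (Fin d) → ℝ),
      IsKernelRecursion P' σb σv φ a ρ K T ζ ∧ ∀ l ω, IsCovKernel (K l ω) := by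
  -- `Q i` is the law of the points of a Poisson process with mean measure `ρ i`
  choose Q hQ hQP using fun i => (hρ i).exists_isPoissonPoints
  let k₀ : CovKernel (EuclideanSpace ℝ (Fin d)) :=
    ⟨inputKernel d σb σv, isCovKernel_inputKernel d σb σv⟩
  -- the chain is run for an infinite time, with arbitrary transitions after the last layer
  let Q' : ℕ → Measure (ℕ → ℝ≥0) := fun n => if h : n < L then Q ⟨n, h⟩ else Measure.dirac 0
  have hQ' : ∀ n, IsProbabilityMeasure (Q' n) := fun n => by
    simp only [Q']
    split_ifs <;> infer_instance
  let a' : ℕ → ℝ := fun n => if h : n < L then a ⟨n, h⟩ else 0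
  have ha' : ∀ n, 0 ≤ a' n := fun n => by
    simp only [a']
    split_ifs
    exacts [ha _, le_rfl]
  let F : ℕ → CovKernel (EuclideanSpace ℝ (Fin d)) × (ℕ → ℝ≥0) ×
      (ℕ → EuclideanSpace ℝ (Fin d) → ℝ) → CovKernel (EuclideanSpace ℝ (Fin d)) := fun n q =>
    ⟨nextKernel σb σv φ (a' n) q.1.1 q.2.1 q.2.2,
      isCovKernel_nextKernel σb σv hφ henv (ha' n) q.1.2 q.2.1 q.2.2⟩
  have hF : ∀ n, Measurable (F n) := fun n => Measurable.subtype_mk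
    ((measurable_nextKernel σb σv hφ (a' n)).comp
      (Measurable.prodMk (measurable_subtype_coe.comp measurable_fst) measurable_snd))
  obtain ⟨P, hP, hchain⟩ := exists_layerChain (Q := Q') k₀ hF
  have htr : ∀ i : Fin L, HasLayerTransition P (Q i) (F i) k₀ i := fun i => by
    have h := hchain i
    have e : Q' i = Q i := by simp [Q']
    rwa [e] at h
  let K : Fin (L + 1) → (ℕ → LayerState (EuclideanSpace ℝ (Fin d))) →
      EuclideanSpace ℝ (Fin d) → EuclideanSpace ℝ (Fin d) → ℝ :=
    fun l ω => (currentKernel k₀ l (ω l)).1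
  have hcur : ∀ n : ℕ, Measurable fun ω : ℕ → LayerState (EuclideanSpace ℝ (Fin d)) =>
      (currentKernel k₀ n (ω n)).1 := fun n =>
    measurable_subtype_coe.comp ((measurable_currentKernel k₀ n).comp (measurable_pi_apply n))
  have hhist : ∀ i : Fin L, historySigma K i.castSucc ≤ MeasurableSpace.comap
      (Preorder.frestrictLe (π := fun _ : ℕ => LayerState (EuclideanSpace ℝ (Fin d))) (i : ℕ))
      MeasurableSpace.pi := fun i => by
    refine iSup₂_le fun l hl => ?_
    have hl' : (l : ℕ) ∈ Finset.Iic (i : ℕ) := Finset.mem_Iic.2 hl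
    have hm : Measurable fun y : (Π _ : Finset.Iic (i : ℕ), LayerState (EuclideanSpace ℝ (Fin d)))
        => (currentKernel k₀ l (y ⟨l, hl'⟩)).1 :=
      measurable_subtype_coe.comp ((measurable_currentKernel k₀ l).comp (measurable_pi_apply _))
    exact (hm.comp (comap_measurable (Preorder.frestrictLe
      (π := fun _ : ℕ => LayerState (EuclideanSpace ℝ (Fin d))) (i : ℕ)))).comap_le
  have hcoe : Measurable fun (t : ℕ → ℝ≥0) (j : ℕ) => (t j : ℝ) := by fun_prop
  refine ⟨ℕ → LayerState (EuclideanSpace ℝ (Fin d)), inferInstance, P, hP, K,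
    fun i j ω => (ω (i + 1)).1 j, fun i j ω => (ω (i + 1)).2.1 j, ⟨fun l => hcur l, fun i j => ?_,
    fun ω x x' => rfl, fun i => (htr i).isPoissonPoints (hρ i) (hQP i), fun i => ?_, ?_, ?_⟩,
    fun l ω => (currentKernel k₀ l (ω l)).2⟩
  · exact (measurable_pi_apply j).comp (measurable_processes i)
  · refine indep_of_indep_of_le_right ?_ (hhist i)
    exact (IndepFun_iff_Indep _ _ _).1 ((htr i).indepFun.comp hcoe measurable_id)
  · intro i m n x C hC
    refine (htr i).condExp_eq (sup_le ((hhist i).trans ?_) ?_) ?_ m x hC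
    · have h : MeasurableSpace.comap (Preorder.frestrictLe
          (π := fun _ : ℕ => LayerState (EuclideanSpace ℝ (Fin d))) (i : ℕ)) MeasurableSpace.pi
          = MeasurableSpace.comap (fun ω => (Preorder.frestrictLe
            (π := fun _ : ℕ => LayerState (EuclideanSpace ℝ (Fin d))) (i : ℕ) ω, (ω (i + 1)).1))
              (MeasurableSpace.comap Prod.fst MeasurableSpace.pi) := by
        rw [MeasurableSpace.comap_comp]; rfl
      rw [h]
      exact MeasurableSpace.comap_mono measurable_fst.comap_le
    · exact ((hcoe.comp measurable_snd).comp (comap_measurable (fun ω => (Preorder.frestrictLe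
        (π := fun _ : ℕ => LayerState (EuclideanSpace ℝ (Fin d))) (i : ℕ) ω,
          (ω (i + 1)).1)))).comap_le
    · exact (comap_measurable (K i.castSucc)).mono
        ((kernelSigma_le_historySigma K i.castSucc).trans le_sup_left) le_rfl
  · intro i x x'
    have hsum : ∀ᵐ t ∂(Q i), ∑' j, (t j : ℝ≥0∞) < ∞ := by
      simpa only [ENNReal.ofReal_coe_nnreal] using (hQP i).ae_tsum_lt_top (hρ i)
    have h := (htr i).ae_recursion hφ henv (fun q => rfl) hsum x x'
    have e : a' i = a i := by simp [a']
    rw [e] at h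
    exact h

end

theorem mainTheorem2 {L d dout : ℕ} (σb σv : ℝ≥0) (hσv : 0 < σv)
    (φ : ℝ → ℝ) (hφ : Continuous φ)
    (henv : ∃ A B C : ℝ, 0 < A ∧ 0 < B ∧ 0 < C ∧ ∀ z : ℝ, |φ z| ≤ A + B * |z| ^ C)
    (μ : Fin L → ℕ+ → ProbabilityMeasure ℝ)
    (hμ : ∀ i q, (μ i q : Measure ℝ) (Set.Iio 0) = 0)
    (a : Fin L → ℝ) (ha : ∀ i, 0 ≤ a i)
    (ρ : Fin L → Measure ℝ) (hρ : ∀ i, IsLevyMeasure (ρ i))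
    (hlim : ∀ i, ∃ Λ : ProbabilityMeasure ℝ, IsIDLaw (a i) (ρ i) Λ ∧
      Tendsto (fun q : ℕ+ => iidSumLaw q (μ i q)) atTop (𝓝 Λ))
    {Ω : (Fin L → ℕ+) → Type*} [∀ p, MeasurableSpace (Ω p)]
    (P : ∀ p, Measure (Ω p)) [∀ p, IsProbabilityMeasure (P p)]
    (lam : ∀ p, Fin L → ℕ → Ω p → ℝ) (V : ∀ p, Fin (L + 1) → ℕ → ℕ → Ω p → ℝ)
    (B : ∀ p, Fin (L + 1) → ℕ → Ω p → ℝ)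
    (hnet : ∀ p, IsNetwork d dout σb σv μ p (P p) (lam p) (V p) (B p)) :
    -- the recursion has a solution consisting of random covariance kernels
    (∃ (Ω' : Type) (_ : MeasurableSpace Ω') (P' : Measure Ω') (_ : IsProbabilityMeasure P')
      (K : Fin (L + 1) → Ω' → EuclideanSpace ℝ (Fin d) → EuclideanSpace ℝ (Fin d) → ℝ)
      (T : Fin L → ℕ → Ω' → ℝ) (ζ : Fin L → ℕ → Ω' → EuclideanSpace ℝ (Fin d) → ℝ),
      IsKernelRecursion P' σb σv φ a ρ K T ζ ∧ ∀ l ω, IsCovKernel (K l ω)) ∧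
    -- every solution is a Markov sequence and describes the limit of the network
    ∀ (Ω' : Type*) [MeasurableSpace Ω'] (P' : Measure Ω') [IsProbabilityMeasure P']
      (K : Fin (L + 1) → Ω' → EuclideanSpace ℝ (Fin d) → EuclideanSpace ℝ (Fin d) → ℝ)
      (T : Fin L → ℕ → Ω' → ℝ) (ζ : Fin L → ℕ → Ω' → EuclideanSpace ℝ (Fin d) → ℝ),
      IsKernelRecursion P' σb σv φ a ρ K T ζ →
      (∀ (i : Fin L)
        (S : Set (EuclideanSpace ℝ (Fin d) → EuclideanSpace ℝ (Fin d) → ℝ)), MeasurableSet S →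
        P'⟦K i.succ ⁻¹' S | historySigma K i.castSucc⟧
          =ᵐ[P'] P'⟦K i.succ ⁻¹' S | kernelSigma (K i.castSucc)⟧) ∧
      ∀ (n : ℕ) (x : Fin n → EuclideanSpace ℝ (Fin d)) (l : Fin (L + 1)),
        (∀ᵐ ω ∂P', (gramMatrix (K l ω) x).PosSemidef) ∧
        ∀ m : ℕ, (l = Fin.last L → m ≤ dout) →
          ∃ ν : ProbabilityMeasure (Fin m → EuclideanSpace ℝ (Fin n)),
            (ν : Measure (Fin m → EuclideanSpace ℝ (Fin n)))
              = P'.bind (fun ω => iidGaussian (K l ω) x m) ∧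
            IteratedTendsto L (fun p => outputsLaw (hnet p) hφ x l m) ν := by
  refine ⟨exists_isKernelRecursion σb σv hφ henv ha hρ, fun Ω' _ P' _ K T ζ h =>
    ⟨fun i S hS => h.markov hφ i hS, fun n x l => ⟨h.ae_posSemidef hφ henv ha x l, fun m hm =>
      ⟨h.limitLaw x l m, rfl, ?_⟩⟩⟩⟩
  refine IteratedTendsto.extend (Nat.lt_succ_iff.1 l.2) m
    (h.iteratedTendsto_netLaw hφ henv ha hρ hμ hlim x l.1 l.2 m)
    fun p hp => (hnet p).outputsLaw_eq_netLaw hφ x (h.limitLaw_zero x) l.1 l.2 m ?_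
  -- for large widths, the layer has at least `m` nodes
  rcases (Nat.lt_succ_iff.1 l.2).lt_or_eq with hl | hl
  · exact (hp ⟨l, hl⟩ le_rfl).trans (layerWidth_castSucc_succ d dout p ⟨l, hl⟩).ge
  · have : l = Fin.last L := Fin.ext hl
    subst this
    exact (hm rfl).trans (layerWidth_last d dout p).ge
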